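/- **Setting.** Let $\mathscr X\subseteq\mathbb R^n$ be open and let $\mathscr F=\{w_0,\dots,w_N\}$ be a finite library of fault profiles $w_k:[0,\infty)\to\mathbb R^p$, measurable and bounded on bounded time intervals, with $w_0=0$. Put $F_{w}(x,t)=f(x,t)+g(x,t)u_{cl}(x,t)+\psi(x,t)w(t)$ and $\Sigma=\sigma\sigma^\top$, where $f,g,u_{cl},\psi$ are $C^1$ in $x$, and $\Sigma$ is $C^2$ in $x$, with these spatial derivatives jointly continuous on $\mathscr X\times[0,\infty)$. Assume that for some $L_1,L_2>0$, all $w\in\mathscr F$, $x,y\in\mathscr X$, $t\ge0$: $\|F_w(x,t)\|^2+\|\sigma(x,t)\|_F^2\le L_1(1+\|x\|^2)$ and $\|F_w(x,t)-F_w(y,t)\|+\|\sigma(x,t)-\sigma(y,t)\|_F\le L_2\|x-y\|$. Fix $w_i,w_j\in\mathscr F$ and a probability density $\rho_0$ on $\mathscr X$ with finite second moment. For $w\in\{w_i,w_j\}$ let $\rho^{w}(\cdot,t)$, $t\ge 0$, be the densities of the marginals of an $\mathscr X$-valued solution of $dx=F_w(x,t)\,dt+\sigma(x,t)\,dW$ with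 $\rho^{w}(\cdot,0)=\rho_0$; they are assumed strictly positive and $C^2$ in $x$, with spatial derivatives of order at most two jointly continuous on $\mathscr X\times[0,\infty)$. Let $s^w=\nabla_x\log\rho^w$ and let $$v_w=F_w-\tfrac12\bigl[\nabla_x\cdot\Sigma+\Sigma\, s^w\bigr],\qquad [\nabla_x\cdot\Sigma]_a=\textstyle\sum_b\partial_{x_b}\Sigma_{ab},$$ be the probability-flow field; assume that $\dot x=v_w(x,t)$ (in integral form) generates a two-time flow map $\Phi^{v_w}_{s,t}:\mathscr X\to\mathscr X$, $0\le s\le t$. Let $\mathscr P^{v_w}_{s,t}\rho$ be the density of the pushforward of $\rho(x)\,dx$ under $\Phi^{v_w}_{s,t}$. Let $\mathbb W_2$ be the 2-Wasserstein distance. For $\epsilon>0$, the profiles $w_i,w_j$ are called *$\epsilon$-identifiable in density on $[0,T]$ from $\rho_0$* if $\mathbb W_2(\mathscr P^{v_{w_i}}_{0,T}\rho_0,\mathscr P^{v_{w_j}}_{0,T}\rho_0)\ge\epsilon$. **Theorem 3 (Fault detectability bound).** Assume that for finite constants $\bar\psi,\bar\sigma,\bar s_{ij}$ and all $x\in\mathscr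 X$, $t\ge0$, $$\|\psi(x,t)\|_F\le\bar\psi,\qquad \|\Sigma(x,t)\|_F\le\bar\sigma,\qquad \|s^{w_j}(x,t)-s^{w_i}(x,t)\|\le\bar s_{ij}.$$ Assume that the probability flow for $w_i$ is contracting with rate $\alpha_{ij}\in\mathbb R$: there are a $C^1$ matrix field $\Theta(x,t)\in\mathbb R^{n\times n}$ and constants $\underline m,\overline m>0$ such that $M=\Theta^\top\Theta$ satisfies, for all $x\in\mathscr X$, $t\ge0$, $$\underline m I\preceq M\preceq\overline m I,\qquad \dot M+2\,\mathrm{sym}\Bigl(M\frac{\partial v_{w_i}}{\partial x}\Bigr)\preceq2\alpha_{ij}M,$$ where $\dot M$ is the total derivative along $\dot x=v_{w_i}(x,t)$ and $\mathrm{sym}(A)=\tfrac12(A+A^\top)$. Put $\kappa^{ij}=\sqrt{\overline m/\underline m}$, $\Delta w_{ij}=\sup_{t\ge0}\|w_i(t)-w_j(t)\|$ (assumed finite) and $\bar d^{ij}=\bar\psi\,\Delta w_{ij}+\tfrac12\bar\sigma\,\bar s_{ij}$. Then: 1. For all $t\ge0$, $\ \mathbb W_2(\rho^{w_i}(\cdot,t),\rho^{w_j}(\cdot,t))\le\kappa^{ij}\bar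 d^{ij}\int_0^te^{\alpha_{ij}(t-r)}\,dr$. 2. For $T\ge0$ and $\epsilon>0$, if $w_i,w_j$ are $\epsilon$-identifiable in density on $[0,T]$ from $\rho_0$, then $\epsilon\le\kappa^{ij}\bar d^{ij}\int_0^Te^{\alpha_{ij}(T-r)}\,dr$. 3. If $\alpha_{ij}<0$, then $\limsup_{t\to\infty}\mathbb W_2(\rho^{w_i}(\cdot,t),\rho^{w_j}(\cdot,t))\le\kappa^{ij}\bar d^{ij}/|\alpha_{ij}|$; and if $\rho^{w_i}(\cdot,t)$ and $\rho^{w_j}(\cdot,t)$ converge weakly, as $t\to\infty$, to probability measures $\rho^{w_i}_\infty$ and $\rho^{w_j}_\infty$ on $\mathbb R^n$, then $\mathbb W_2(\rho^{w_i}_\infty,\rho^{w_j}_\infty)\le\kappa^{ij}\bar d^{ij}/|\alpha_{ij}|$. -/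

import Mathlib

open Set Filter Topology MeasureTheory ProbabilityTheory
open scoped NNReal ENNReal Matrix ContDiff

namespace FaultDetection

/-- The Euclidean space of dimension `n` (with the Euclidean norm). -/
abbrev Vec (n : ℕ) : Type := EuclideanSpace ℝ (Fin n)

/-- The standard basis vector with index `a`. -/
noncomputable def basisVec {n : ℕ} (a : Fin n) : Vec n := EuclideanSpace.single a 1

/-- Matrix-vector product on Euclidean spaces. -/
noncomputable def mulV {a b : ℕ} (A : Matrix (Fin a) (Fin b) ℝ) (y : Vec b) : Vec a :=
  Matrix.toEuclideanLin A y

/-- The Frobenius norm of a matrix. -/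
noncomputable def frob {a b : ℕ} (A : Matrix (Fin a) (Fin b) ℝ) : ℝ :=
  Real.sqrt (∑ k, ∑ l, A k l ^ 2)

/-- The symmetric part of a square matrix. -/
noncomputable def symPart {n : ℕ} (A : Matrix (Fin n) (Fin n) ℝ) : Matrix (Fin n) (Fin n) ℝ :=
  (1 / 2 : ℝ) • (A + Aᵀ)

/-- The time-dependent function `h` is `k` times differentiable in space on `X`, at every time
`t ≥ 0`, and its spatial derivatives up to the order `k` are jointly continuous on
`X × [0, ∞)`. -/
def SmoothInSpace {n : ℕ} {G : Type*} [NormedAddCommGroup G] [NormedSpace ℝ G]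
    (k : ℕ) (X : Set (Vec n)) (h : Vec n → ℝ → G) : Prop :=
  (∀ t, 0 ≤ t → ContDiffOn ℝ k (fun x => h x t) X) ∧
  ∀ l ≤ k, ContinuousOn
    (fun z : Vec n × ℝ => iteratedFDeriv ℝ l (fun y => h y z.2) z.1) (X ×ˢ Ici 0)

/-! ### Densities, the 2-Wasserstein distance, pushforward of densities -/

/-- The admissible densities on `X`: nonnegative, integrable, of total mass one, with finite
second moment. -/
def admissibleDensities {n : ℕ} (X : Set (Vec n)) : Set (Vec n → ℝ) :=
  {ρ | IntegrableOn ρ X ∧ (∀ x ∈ X, 0 ≤ ρ x) ∧ ∫ x in X, ρ x = 1 ∧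
    IntegrableOn (fun x => ‖x‖ ^ 2 * ρ x) X}

/-- The measure `ρ(x) dx` on `X`. -/
noncomputable def densMeasure {n : ℕ} (X : Set (Vec n)) (ρ : Vec n → ℝ) : Measure (Vec n) :=
  (volume.restrict X).withDensity (fun x => ENNReal.ofReal (ρ x))

/-- The couplings of two measures. -/
def couplings {n : ℕ} (μ ν : Measure (Vec n)) : Set (Measure (Vec n × Vec n)) :=
  {π | π.map Prod.fst = μ ∧ π.map Prod.snd = ν}

/-- The 2-Wasserstein distance, with values in `[0, ∞]`. -/
noncomputable def W2 {n : ℕ} (μ ν : Measure (Vec n)) : ℝ≥0∞ :=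
  (⨅ π ∈ couplings μ ν, ∫⁻ z, ‖z.1 - z.2‖ₑ ^ 2 ∂π) ^ (1 / 2 : ℝ)

/-- The 2-Wasserstein distance of two densities on `X`. -/
noncomputable def W2dens {n : ℕ} (X : Set (Vec n)) (ρ η : Vec n → ℝ) : ℝ≥0∞ :=
  W2 (densMeasure X ρ) (densMeasure X η)

/-- The density-level Perron-Frobenius operator of a map `T`: the Radon-Nikodym density of the
pushforward under `T` of the measure `ρ(x) dx` on `X`. -/
noncomputable def pfDensity {n : ℕ} (X : Set (Vec n)) (T : Vec n → Vec n) (ρ : Vec n → ℝ) :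
    Vec n → ℝ :=
  fun x => (((densMeasure X ρ).map T).rnDeriv volume x).toReal

/-- Convergence in law of `μ t` to `ν` as `t → ∞`. -/
def ConvergesWeakly {n : ℕ} (μ : ℝ → Measure (Vec n)) (ν : Measure (Vec n)) : Prop :=
  ∀ φ : BoundedContinuousFunction (Vec n) ℝ,
    Tendsto (fun t => ∫ x, φ x ∂(μ t)) atTop (𝓝 (∫ x, φ x ∂ν))

/-! ### Flows of time-dependent vector fields -/

/-- `Φ s t`, `0 ≤ s ≤ t`, is the two-time flow map on `X` generated by `x' = v(x, t)`; the
differential equation is understood in the sense of Carathéodory, i.e. in integral form. -/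
structure IsFlow {n : ℕ} (X : Set (Vec n)) (v : Vec n → ℝ → Vec n)
    (Φ : ℝ → ℝ → Vec n → Vec n) : Prop where
  mapsTo : ∀ s t, 0 ≤ s → s ≤ t → MapsTo (Φ s t) X X
  continuousOn : ∀ s, 0 ≤ s → ∀ x ∈ X, ContinuousOn (fun t => Φ s t x) (Ici s)
  integrable : ∀ s t, 0 ≤ s → s ≤ t → ∀ x ∈ X,
    IntervalIntegrable (fun r => v (Φ s r x) r) volume s t
  integral_eq : ∀ s t, 0 ≤ s → s ≤ t → ∀ x ∈ X,
    Φ s t x = x + ∫ r in s..t, v (Φ s r x) r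

/-- Two density evolutions, given by the flow maps `Φ` and `Ψ`, are `ε`-identifiable in density
on `[s, t]` from the density `ρ`. -/
def Identifiable {n : ℕ} (X : Set (Vec n)) (Φ Ψ : ℝ → ℝ → Vec n → Vec n) (ε : ℝ)
    (ρ : Vec n → ℝ) (s t : ℝ) : Prop :=
  0 < ε ∧ ENNReal.ofReal ε ≤ W2dens X (pfDensity X (Φ s t) ρ) (pfDensity X (Ψ s t) ρ)

/-! ### Contraction metrics -/

/-- The spatial Jacobian matrix of a time-dependent vector field. -/
noncomputable def jacobian {n : ℕ} (v : Vec n → ℝ → Vec n) (x : Vec n) (t : ℝ) :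
    Matrix (Fin n) (Fin n) ℝ :=
  Matrix.of fun a b => (fderiv ℝ (fun y => v y t) x (basisVec b)) a

/-- The total time derivative of the matrix field `M` along `x' = v(x, t)`
(one-sided in time at `t = 0`). -/
noncomputable def totalDeriv {n : ℕ} (v : Vec n → ℝ → Vec n)
    (M : Vec n → ℝ → Matrix (Fin n) (Fin n) ℝ) (x : Vec n) (t : ℝ) :
    Matrix (Fin n) (Fin n) ℝ :=
  Matrix.of fun a b =>
    derivWithin (fun r => M x r a b) (Ici 0) t + fderiv ℝ (fun y => M y t a b) x (v x t)

/-- The dynamics `x' = v(x, t)` on `X` satisfy the contraction condition with rate `α` in the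
metric `M = Θᵀ Θ`, whose eigenvalues lie between `mlo > 0` and `mhi`. -/
structure IsContracting {n : ℕ} (X : Set (Vec n)) (v : Vec n → ℝ → Vec n)
    (Θ : Vec n → ℝ → Matrix (Fin n) (Fin n) ℝ) (α mlo mhi : ℝ) : Prop where
  smooth : ∀ a b, ContDiffOn ℝ 1 (fun z : Vec n × ℝ => Θ z.1 z.2 a b) (X ×ˢ Ici 0)
  mlo_pos : 0 < mlo
  mhi_pos : 0 < mhi
  lower : ∀ x ∈ X, ∀ t, 0 ≤ t →
    ((Θ x t)ᵀ * Θ x t - mlo • (1 : Matrix (Fin n) (Fin n) ℝ)).PosSemidef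
  upper : ∀ x ∈ X, ∀ t, 0 ≤ t →
    (mhi • (1 : Matrix (Fin n) (Fin n) ℝ) - (Θ x t)ᵀ * Θ x t).PosSemidef
  contraction : ∀ x ∈ X, ∀ t, 0 ≤ t →
    ((2 * α) • ((Θ x t)ᵀ * Θ x t) -
      (totalDeriv v (fun y r => (Θ y r)ᵀ * Θ y r) x t +
        (2 : ℝ) • symPart ((Θ x t)ᵀ * Θ x t * jacobian v x t))).PosSemidef

/-! ### Stochastic differential equations -/

/-- The generator at time `t` of `dX = F(X, t) dt + σ(X, t) dW`, applied to `φ`; here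
`A = σ σᵀ`. -/
noncomputable def generator {n : ℕ} (F : Vec n → ℝ → Vec n)
    (A : Vec n → ℝ → Matrix (Fin n) (Fin n) ℝ) (φ : Vec n → ℝ) (x : Vec n) (t : ℝ) : ℝ :=
  fderiv ℝ φ x (F x t) +
    (1 / 2) * ∑ a, ∑ b, A x t a b *
      fderiv ℝ (fun y => fderiv ℝ φ y (basisVec b)) x (basisVec a)

/-- The process `Z` with continuous paths in the open set `X` is a (weak) solution of the Itô
equation `dZ = F(Z, t) dt + σ(Z, t) dW` under the probability measure `P`, in the sense of the
martingale problem of Stroock and Varadhan. -/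
structure IsSDESolution {n q : ℕ} {Ω : Type*} [MeasurableSpace Ω] (P : Measure Ω)
    (X : Set (Vec n)) (F : Vec n → ℝ → Vec n) (σ : Vec n → ℝ → Matrix (Fin n) (Fin q) ℝ)
    (Z : ℝ≥0 → Ω → Vec n) : Prop where
  isProbabilityMeasure : IsProbabilityMeasure P
  mem : ∀ t o, Z t o ∈ X
  continuous : ∀ o, Continuous fun t => Z t o
  martingale : ∃ 𝓕 : Filtration ℝ≥0 ‹MeasurableSpace Ω›, Adapted 𝓕 Z ∧
    ∀ φ : Vec n → ℝ, ContDiff ℝ ∞ φ → HasCompactSupport φ → tsupport φ ⊆ X →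
      Martingale (fun (t : ℝ≥0) o => φ (Z t o) - φ (Z 0 o) -
        ∫ r in (0 : ℝ)..t,
          generator F (fun x s => σ x s * (σ x s)ᵀ) φ (Z r.toNNReal o) r) 𝓕 P

/-! ### Control-affine systems with a finite fault library -/

/-- The data of a stochastic control-affine system
`dx = (f + g u + ψ w) dt + σ dW` on `X` with feedback law `u` and the fault library
`w 0, …, w N`. -/
structure FaultSystem (n m p q N : ℕ) where
  /-- the state space -/
  X : Set (Vec n)
  /-- the drift -/
  f : Vec n → ℝ → Vec n
  /-- the input matrix -/
  g : Vec n → ℝ → Matrix (Fin n) (Fin m) ℝ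
  /-- the nominal feedback law -/
  u : Vec n → ℝ → Vec m
  /-- the fault matrix -/
  ψ : Vec n → ℝ → Matrix (Fin n) (Fin p) ℝ
  /-- the diffusion coefficient -/
  σ : Vec n → ℝ → Matrix (Fin n) (Fin q) ℝ
  /-- the fault profiles -/
  w : Fin (N + 1) → ℝ → Vec p

namespace FaultSystem

variable {n m p q N : ℕ}

/-- The closed-loop vector field under the `k`-th fault. -/
noncomputable def F (S : FaultSystem n m p q N) (k : Fin (N + 1)) (x : Vec n) (t : ℝ) : Vec n :=
  S.f x t + mulV (S.g x t) (S.u x t) + mulV (S.ψ x t) (S.w k t)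

/-- The diffusion matrix `Σ = σ σᵀ`. -/
noncomputable def diffusion (S : FaultSystem n m p q N) (x : Vec n) (t : ℝ) :
    Matrix (Fin n) (Fin n) ℝ :=
  S.σ x t * (S.σ x t)ᵀ

/-- The row-wise divergence of `Σ`. -/
noncomputable def divDiffusion (S : FaultSystem n m p q N) (x : Vec n) (t : ℝ) : Vec n :=
  WithLp.toLp 2 fun a => ∑ b, fderiv ℝ (fun y => S.diffusion y t a b) x (basisVec b)

/-- The standing assumptions: open state space, smooth coefficients, measurable and locally
bounded fault profiles, `w 0 = 0`, linear growth and Lipschitz continuity. -/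
structure Regular (S : FaultSystem n m p q N) : Prop where
  isOpen : IsOpen S.X
  smooth_f : SmoothInSpace 1 S.X S.f
  smooth_g : ∀ a b, SmoothInSpace 1 S.X (fun x t => S.g x t a b)
  smooth_u : SmoothInSpace 1 S.X S.u
  smooth_ψ : ∀ a b, SmoothInSpace 1 S.X (fun x t => S.ψ x t a b)
  smooth_diffusion : ∀ a b, SmoothInSpace 2 S.X (fun x t => S.diffusion x t a b)
  measurable_w : ∀ k, Measurable (S.w k)
  bounded_w : ∀ k T, ∃ C, ∀ t ∈ Icc 0 T, ‖S.w k t‖ ≤ C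
  nominal : ∀ t, 0 ≤ t → S.w 0 t = 0
  growth : ∃ L₁ > 0, ∀ k, ∀ x ∈ S.X, ∀ t, 0 ≤ t →
    ‖S.F k x t‖ ^ 2 + frob (S.σ x t) ^ 2 ≤ L₁ * (1 + ‖x‖ ^ 2)
  lipschitz : ∃ L₂ > 0, ∀ k, ∀ x ∈ S.X, ∀ y ∈ S.X, ∀ t, 0 ≤ t →
    ‖S.F k x t - S.F k y t‖ + frob (S.σ x t - S.σ y t) ≤ L₂ * ‖x - y‖

end FaultSystem

/-- The score `∇ log ρ(·, t)` of a time-dependent density. -/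
noncomputable def score {n : ℕ} (ρ : Vec n → ℝ → ℝ) (x : Vec n) (t : ℝ) : Vec n :=
  gradient (fun y => Real.log (ρ y t)) x

namespace FaultSystem

variable {n m p q N : ℕ}

/-- The probability-flow vector field `F - ½ (∇·Σ + Σ ∇ log ρ)` of the `k`-th fault. -/
noncomputable def probFlow (S : FaultSystem n m p q N) (k : Fin (N + 1)) (ρ : Vec n → ℝ → ℝ)
    (x : Vec n) (t : ℝ) : Vec n :=
  S.F k x t - (1 / 2 : ℝ) • (S.divDiffusion x t + mulV (S.diffusion x t) (score ρ x t))

/-- `ρ` is the (strictly positive, twice differentiable in space) density of the marginals of a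
solution `Z` of the stochastic system under the `k`-th fault, with initial density `ρ₀`. -/
structure IsMarginal (S : FaultSystem n m p q N) (k : Fin (N + 1)) (ρ₀ : Vec n → ℝ)
    {Ω : Type*} [MeasurableSpace Ω] (P : Measure Ω) (Z : ℝ≥0 → Ω → Vec n)
    (ρ : Vec n → ℝ → ℝ) : Prop where
  solution : IsSDESolution P S.X (S.F k) S.σ Z
  law : ∀ t : ℝ≥0, P.map (Z t) = densMeasure S.X (fun x => ρ x t)
  initial : ∀ x ∈ S.X, ρ x 0 = ρ₀ x
  pos : ∀ x ∈ S.X, ∀ t, 0 ≤ t → 0 < ρ x t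
  smooth : SmoothInSpace 2 S.X ρ

end FaultSystem

end FaultDetection

open FaultDetection

/-!
Two facts carry the proof: the probability flow transports the initial density to the marginals of
the stochastic system, and the flows of two nearby fields stay close when one of them contracts.

**Comparison of flows** (`IsFlow.norm_sub_le`). Contraction bounds the local Lipschitz constant of
`Φⁱ_{s,t}` along a compact curve by `√(mhi / mlo) e^{α (t - s)}`: the squared length `|Θ (y - z)|²`
of the difference of two nearby solutions is absolutely continuous, and its derivative is at most
`2 (α + ε)` times itself, so no differentiability of the flow in space is needed. The curve
`r ↦ Φⁱ_{r,t} (Φʲ_{0,r} x)` joins `Φⁱ_{0,t} x` to `Φʲ_{0,t} x`, and its speed at `r` is at most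
`√(mhi / mlo) e^{α (t - r)} d`, where `d` bounds the difference of the fields.
`FaultSystem.norm_probFlow_sub_le` is the value of `d` for the two probability flows.

**Transport of densities** (`IsFlow.map_densMeasure`). Testing the martingale problem with smooth
compactly supported functions and integrating by parts twice yields the Fokker-Planck equation,
which is the continuity equation `∂ₜ ρ + ∇ · (ρ v) = 0` of the probability flow, integrated in time
and almost everywhere in space (`FaultSystem.IsMarginal.solvesContinuity`). Along the flow the
quantity `ρ(Φ x, t) det DΦ(x)` then does not decrease, to first order in the time step and at almost
every `x`, so the mass of the image of a compact set does not decrease (`IsFlow.mass_le`). Hence the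
pushforward of the initial measure is dominated by the marginal at time `t`, and the two agree
because both have mass one. The flow is only defined forward in time and on an open set, which it
need not map onto itself; this one-sided argument avoids the adjoint transport equation, whose
solutions need not have compact support.

Thus `(Φⁱ_{0,t}, Φʲ_{0,t})` couples the marginals at time `t` with displacement bounded pointwise.
This bounds `W2`, for the marginals and for the pushforward densities, and such couplings pass to
weak limits by Prokhorov's theorem (`coupledWithin_of_tendsto`).
-/


namespace FaultDetection

/-! ### Grönwall inequalities and continuation on an interval -/

/-- Grönwall's inequality for absolutely continuous functions, with the differential inequality
required almost everywhere only. -/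
theorem le_mul_exp_of_ae_deriv_le {f : ℝ → ℝ} {a b c : ℝ} (hab : a ≤ b)
    (hf : AbsolutelyContinuousOnInterval f a b)
    (h : ∀ᵐ x, x ∈ Ioo a b → ∃ f', HasDerivAt f f' x ∧ f' ≤ c * f x) :
    f b ≤ f a * Real.exp (c * (b - a)) := by
  set e : ℝ → ℝ := fun x => Real.exp (-(c * (x - a))) with he
  have hed : ∀ x, HasDerivAt e (e x * (-c)) x := fun x => by
    have h1 : HasDerivAt (fun x => -(c * (x - a))) (-c) x := by
      simpa using ((hasDerivAt_id x).sub_const a).const_mul (-c) |>.congr_of_eventuallyEq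
        (Eventually.of_forall fun y => by simp)
    exact h1.exp
  have hac : AbsolutelyContinuousOnInterval e a b := by
    refine ContDiffOn.absolutelyContinuousOnInterval ?_
    exact ContDiff.contDiffOn (by fun_prop)
  have hg := (hac.mul hf).integral_deriv_eq_sub
  have hle : ∫ x in a..b, deriv (e * f) x ≤ 0 := by
    rw [intervalIntegral.integral_of_le hab, integral_Ioc_eq_integral_Ioo]
    refine integral_nonpos_of_ae ?_
    rw [EventuallyLE, ae_restrict_iff' measurableSet_Ioo]
    filter_upwards [h] with x hx hxm
    obtain ⟨f', h1, h2⟩ := hx hxm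
    rw [((hed x).mul h1).deriv]
    have h0 : 0 < e x := Real.exp_pos _
    simp only [Pi.zero_apply]
    nlinarith
  rw [hg] at hle
  have h1 : e a = 1 := by simp [he]
  simp only [Pi.mul_apply, h1] at hle
  have h2 : f b = (e b * f b) * Real.exp (c * (b - a)) := by
    rw [mul_comm (e b), mul_assoc, he, ← Real.exp_add]; simp
  rw [h2]
  have := Real.exp_pos (c * (b - a))
  nlinarith

/-- Grönwall's inequality in integral form. -/
theorem le_mul_exp_of_le_integral {g : ℝ → ℝ} {a b c₀ L : ℝ} (hL : 0 ≤ L) (hab : a ≤ b)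
    (hg : ContinuousOn g (Icc a b))
    (h : ∀ t ∈ Icc a b, g t ≤ c₀ + L * ∫ r in a..t, g r) :
    g b ≤ c₀ * Real.exp (L * (b - a)) := by
  have hi : IntervalIntegrable g volume a b := by
    rw [← uIcc_of_le hab] at hg; exact hg.intervalIntegrable
  set G : ℝ → ℝ := fun t => c₀ + L * ∫ r in a..t, g r with hG
  have hac : AbsolutelyContinuousOnInterval G a b := by
    have h1 := (hi.absolutelyContinuousOnInterval_intervalIntegral
      (c := a) (by simp)).const_mul L
    have h2 : AbsolutelyContinuousOnInterval (fun _ : ℝ => c₀) a b :=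
      ContDiffOn.absolutelyContinuousOnInterval contDiffOn_const
    exact h2.add h1
  have key : G b ≤ G a * Real.exp (L * (b - a)) := by
    refine le_mul_exp_of_ae_deriv_le hab hac ?_
    filter_upwards [hi.ae_hasDerivAt_integral] with x hx hxm
    have hxI : x ∈ Icc a b := Ioo_subset_Icc_self hxm
    refine ⟨L * g x, ?_, mul_le_mul_of_nonneg_left (h x hxI) hL⟩
    exact ((hx (by rwa [uIcc_of_le hab]) a (by simp)).const_mul L).const_add c₀
  have hGa : G a = c₀ := by simp [hG]
  rw [hGa] at key
  exact (h b (right_mem_Icc.2 hab)).trans key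

/-- A continuous function which, as long as it stays below `η`, is bounded by a constant
`c < η`, never reaches `η`. -/
theorem le_of_continuation {g : ℝ → ℝ} {a b c η : ℝ}
    (hg : ContinuousOn g (Icc a b)) (hcη : c < η) (ha : g a ≤ η)
    (h : ∀ t ∈ Icc a b, (∀ r ∈ Icc a t, g r ≤ η) → g t ≤ c) :
    ∀ t ∈ Icc a b, g t ≤ c := by
  rcases lt_or_ge b a with hba | hab
  · intro t ht; exact absurd (ht.1.trans ht.2) (not_le.2 hba)
  have key : Icc a b ⊆ {t | ∀ r ∈ Icc a t, g r ≤ η} := by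
    refine IsClosed.Icc_subset_of_forall_exists_gt (a := a) (b := b)
      (s := {t | ∀ r ∈ Icc a t, g r ≤ η}) ?_ ?_ ?_
    · refine isClosed_of_closure_subset fun t ht => ?_
      have htI : t ∈ Icc a b := closure_minimal inter_subset_right isClosed_Icc ht
      refine ⟨fun r hr => ?_, htI⟩
      rcases hr.2.eq_or_lt with rfl | hrt
      · by_contra hcon
        push Not at hcon
        have h1 : ∀ᶠ y in 𝓝[Icc a b] r, η < g y := (hg r htI).eventually (lt_mem_nhds hcon)
        obtain ⟨u, hu, hu'⟩ := mem_nhdsWithin_iff_exists_mem_nhds_inter.1 h1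
        obtain ⟨y, hy1, hy2, hy3⟩ := mem_closure_iff_nhds.1 ht u hu
        exact absurd (hy2 y (right_mem_Icc.2 hy3.1)) (not_le.2 (hu' ⟨hy1, hy3⟩))
      · obtain ⟨y, hy1, hy2, hy3⟩ := mem_closure_iff_nhds.1 ht (Ioi r) (Ioi_mem_nhds hrt)
        exact hy2 r ⟨hr.1, le_of_lt hy1⟩
    · intro r hr; rw [le_antisymm hr.2 hr.1]; exact ha
    · rintro t ⟨ht, htI⟩ y hy
      have htI' : t ∈ Icc a b := Ico_subset_Icc_self htI
      have h1 : g t < η := (h t htI' ht).trans_lt hcη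
      have h2 : ∀ᶠ y in 𝓝[Icc a b] t, g y < η := (hg t htI').eventually (gt_mem_nhds h1)
      obtain ⟨δ, hδ, hδ'⟩ := Metric.mem_nhdsWithin_iff.1 h2
      refine ⟨min (min y b) (t + δ / 2), fun r hr => ?_, ?_, ?_⟩
      · rcases le_or_gt r t with hrt | hrt
        · exact ht r ⟨hr.1, hrt⟩
        · have h3 := hr.2
          simp only [le_min_iff] at h3
          refine le_of_lt (hδ' ⟨?_, hr.1, h3.1.2⟩)
          rw [Metric.mem_ball, Real.dist_eq, abs_lt]
          constructor <;> linarith [h3.2]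
      · simp only [mem_Ioi] at hy
        simp only [lt_min_iff]; exact ⟨⟨hy, htI.2⟩, by linarith⟩
      · exact (min_le_left _ _).trans (min_le_left _ _)
  exact fun t ht => h t ht (key ht)

variable {n : ℕ} {X : Set (Vec n)} {v : Vec n → ℝ → Vec n}

/-! ### Vector fields of class `C¹` in space and measurable in time -/

/-- A time-dependent vector field on the open set `X` which satisfies the Carathéodory form of
`C¹` regularity: at every time it is differentiable in space, on compact subsets of
`X × [0, ∞)` it is bounded together with its spatial derivative, and the spatial derivative is
uniformly continuous in space, uniformly in time. In time only measurability is required;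
values outside `X × [0, ∞)` are irrelevant, whence the indicators. -/
structure RegField {n : ℕ} (X : Set (Vec n)) (v : Vec n → ℝ → Vec n) : Prop where
  isOpen : IsOpen X
  diff : ∀ t, 0 ≤ t → ∀ x ∈ X, DifferentiableAt ℝ (fun y => v y t) x
  bdd : ∀ K, IsCompact K → K ⊆ X → ∀ T, ∃ C, ∀ x ∈ K, ∀ t ∈ Icc 0 T,
    ‖v x t‖ ≤ C ∧ ‖fderiv ℝ (fun y => v y t) x‖ ≤ C
  equi : ∀ K, IsCompact K → K ⊆ X → ∀ T, ∀ ε > 0, ∃ η > 0, ∀ x ∈ K, ∀ y ∈ K, ‖x - y‖ ≤ η →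
    ∀ t ∈ Icc 0 T, ‖fderiv ℝ (fun y => v y t) x - fderiv ℝ (fun y => v y t) y‖ ≤ ε
  meas : Measurable ((X ×ˢ Ici (0 : ℝ)).indicator fun z => v z.1 z.2)
  meas_fderiv : Measurable
    ((X ×ˢ Ici (0 : ℝ)).indicator fun z => fderiv ℝ (fun y => v y z.2) z.1)


theorem exists_cthickening_subset {K : Set (Vec n)} (hX : IsOpen X) (hK : IsCompact K)
    (hKX : K ⊆ X) : ∃ η > 0, Metric.cthickening η K ⊆ X ∧ IsCompact (Metric.cthickening η K) := by
  obtain ⟨η, hη, h⟩ := hK.exists_cthickening_subset_open hX hKX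
  exact ⟨η, hη, h, hK.cthickening⟩

theorem closedBall_subset_cthickening' {K : Set (Vec n)} {x : Vec n} (hx : x ∈ K) {η η' : ℝ}
    (h : η ≤ η') : Metric.closedBall x η ⊆ Metric.cthickening η' K :=
  (Metric.closedBall_subset_closedBall h).trans (Metric.closedBall_subset_cthickening hx η')

/-- First-order Taylor expansion in space, uniformly on compact sets. -/
theorem RegField.taylor (hv : RegField X v) {K : Set (Vec n)} (hK : IsCompact K) (hKX : K ⊆ X)
    (T : ℝ) {ε : ℝ} (hε : 0 < ε) : ∃ η > 0, Metric.cthickening η K ⊆ X ∧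
      ∀ x ∈ K, ∀ y ∈ Metric.closedBall x η, ∀ y' ∈ Metric.closedBall x η, ∀ t ∈ Icc 0 T,
        ‖v y t - v y' t - fderiv ℝ (fun y => v y t) x (y - y')‖ ≤ ε * ‖y - y'‖ := by
  obtain ⟨η₁, hη₁, hsub, hcomp⟩ := exists_cthickening_subset hv.isOpen hK hKX
  obtain ⟨η₂, hη₂, heq⟩ := hv.equi _ hcomp hsub T ε hε
  refine ⟨min η₁ η₂, lt_min hη₁ hη₂,
    (Metric.cthickening_mono (min_le_left _ _) K).trans hsub, fun x hx y hy y' hy' t ht => ?_⟩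
  have hb : Metric.closedBall x (min η₁ η₂) ⊆ Metric.cthickening η₁ K :=
    closedBall_subset_cthickening' hx (min_le_left _ _)
  refine Convex.norm_image_sub_le_of_norm_fderiv_le' (𝕜 := ℝ) (f := fun y => v y t)
    (s := Metric.closedBall x (min η₁ η₂))
    (fun p hp => hv.diff t ht.1 p (hsub (hb hp))) (fun p hp => ?_) (convex_closedBall _ _) hy' hy
  refine heq p (hb hp) x (Metric.self_subset_cthickening K hx) ?_ t ht
  rw [← dist_eq_norm]; exact (Metric.mem_closedBall.1 hp).trans (min_le_right _ _)

/-- Bounds and Lipschitz continuity in space near a compact set. -/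
theorem RegField.lip (hv : RegField X v) {K : Set (Vec n)} (hK : IsCompact K) (hKX : K ⊆ X)
    (T : ℝ) : ∃ η > 0, ∃ L > 0, Metric.cthickening η K ⊆ X ∧
      ∀ x ∈ K, ∀ y ∈ Metric.closedBall x η, ∀ t ∈ Icc 0 T,
        ‖v y t‖ ≤ L ∧ ‖fderiv ℝ (fun y => v y t) y‖ ≤ L ∧
        ∀ y' ∈ Metric.closedBall x η, ‖v y t - v y' t‖ ≤ L * ‖y - y'‖ := by
  obtain ⟨η, hη, hsub, hcomp⟩ := exists_cthickening_subset hv.isOpen hK hKX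
  obtain ⟨C, hC⟩ := hv.bdd _ hcomp hsub T
  refine ⟨η, hη, max C 1, lt_max_of_lt_right one_pos, hsub, fun x hx y hy t ht => ?_⟩
  have hb : Metric.closedBall x η ⊆ Metric.cthickening η K :=
    closedBall_subset_cthickening' hx le_rfl
  refine ⟨(hC y (hb hy) t ht).1.trans (le_max_left _ _),
    (hC y (hb hy) t ht).2.trans (le_max_left _ _), fun y' hy' => ?_⟩
  exact Convex.norm_image_sub_le_of_norm_fderiv_le (𝕜 := ℝ) (f := fun y => v y t)
    (s := Metric.closedBall x η) (fun p hp => hv.diff t ht.1 p (hsub (hb hp)))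
    (fun p hp => (hC p (hb hp) t ht).2.trans (le_max_left _ _)) (convex_closedBall _ _) hy' hy

/-! ### Solutions in integral form -/

/-- `z` solves `z' = v(z, t)` in integral form on `[a, b]`, with values in `X`. -/
structure IsSol (X : Set (Vec n)) (v : Vec n → ℝ → Vec n) (a b : ℝ) (z : ℝ → Vec n) : Prop where
  mem : ∀ t ∈ Icc a b, z t ∈ X
  cont : ContinuousOn z (Icc a b)
  integrable : IntervalIntegrable (fun r => v (z r) r) volume a b
  eq : ∀ t ∈ Icc a b, z t = z a + ∫ r in a..t, v (z r) r

theorem IsFlow.isSol {Φ : ℝ → ℝ → Vec n → Vec n} (hΦ : IsFlow X v Φ) {s t : ℝ} (hs : 0 ≤ s)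
    (hst : s ≤ t) {x : Vec n} (hx : x ∈ X) : IsSol X v s t (fun r => Φ s r x) where
  mem r hr := hΦ.mapsTo s r hs hr.1 hx
  cont := (hΦ.continuousOn s hs x hx).mono Icc_subset_Ici_self
  integrable := hΦ.integrable s t hs hst x hx
  eq r hr := by
    have h0 : Φ s s x = x := by simpa using hΦ.integral_eq s s hs le_rfl x hx
    simp only [h0]
    exact hΦ.integral_eq s r hs hr.1 x hx

theorem IsFlow.self {Φ : ℝ → ℝ → Vec n → Vec n} (hΦ : IsFlow X v Φ) {s : ℝ} (hs : 0 ≤ s)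
    {x : Vec n} (hx : x ∈ X) : Φ s s x = x := by
  simpa using hΦ.integral_eq s s hs le_rfl x hx

/-- Solutions starting in a compact set leave their starting point at bounded speed. -/
theorem RegField.exists_speed (hv : RegField X v) {K : Set (Vec n)} (hK : IsCompact K)
    (hKX : K ⊆ X) (T : ℝ) : ∃ δ > 0, ∃ C > 0, ∀ s t, 0 ≤ s → t ≤ T → t - s ≤ δ → ∀ z,
      IsSol X v s t z → z s ∈ K → ∀ r ∈ Icc s t, ‖z r - z s‖ ≤ C * (r - s) := by
  obtain ⟨η, hη, L, hL, -, hlip⟩ := hv.lip hK hKX T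
  refine ⟨η / (2 * L), by positivity, L, hL, fun s t hs ht hst z hz hzK => ?_⟩
  have step : ∀ r ∈ Icc s t, (∀ q ∈ Icc s r, ‖z q - z s‖ ≤ η) → ‖z r - z s‖ ≤ L * (r - s) := by
    intro r hr hq
    have h1 : z r - z s = ∫ q in s..r, v (z q) q := by rw [hz.eq r hr]; abel
    rw [h1, ← abs_of_nonneg (sub_nonneg.2 hr.1)]
    refine intervalIntegral.norm_integral_le_of_norm_le_const fun q hq' => ?_
    rw [uIoc_of_le hr.1] at hq'
    have hqr : q ∈ Icc s r := Ioc_subset_Icc_self hq'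
    refine (hlip _ hzK (z q) ?_ q ⟨hs.trans hqr.1, hqr.2.trans (hr.2.trans ht)⟩).1
    rw [Metric.mem_closedBall, dist_eq_norm]; exact hq q hqr
  have hle : ∀ r ∈ Icc s t, L * (r - s) ≤ η / 2 := fun r hr => by
    have : r - s ≤ η / (2 * L) := by linarith [hr.2]
    calc L * (r - s) ≤ L * (η / (2 * L)) := by gcongr
      _ = η / 2 := by field_simp
  intro r hr
  have hall := le_of_continuation (g := fun r => ‖z r - z s‖)
    (hz.cont.sub continuousOn_const).norm (half_lt_self hη) (by simpa using hη.le)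
    (fun r hr h => (step r hr h).trans (hle r hr))
  exact step r hr fun q hq => (hall q ⟨hq.1, hq.2.trans hr.2⟩).trans (half_lt_self hη).le

namespace IsSol

variable {a b : ℝ} {z y : ℝ → Vec n}

theorem intervalIntegrable (hz : IsSol X v a b z) {s t : ℝ} (hs : s ∈ Icc a b)
    (ht : t ∈ Icc a b) : IntervalIntegrable (fun r => v (z r) r) volume s t := by
  refine hz.integrable.mono_set ?_
  rw [uIcc_of_le (hs.1.trans hs.2)]
  exact uIcc_subset_Icc hs ht

theorem sub_eq (hz : IsSol X v a b z) {s t : ℝ} (hs : s ∈ Icc a b) (ht : t ∈ Icc a b) :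
    z t - z s = ∫ r in s..t, v (z r) r := by
  have ha : a ∈ Icc a b := left_mem_Icc.2 (hs.1.trans hs.2)
  rw [hz.eq t ht, hz.eq s hs, add_sub_add_left_eq_sub,
    intervalIntegral.integral_interval_sub_left (hz.intervalIntegrable ha ht)
      (hz.intervalIntegrable ha hs)]

theorem mono (hz : IsSol X v a b z) {a' b' : ℝ} (ha : a ≤ a') (hab : a' ≤ b') (hb : b' ≤ b) :
    IsSol X v a' b' z := by
  have hsub : Icc a' b' ⊆ Icc a b := Icc_subset_Icc ha hb
  have ha' : a' ∈ Icc a b := ⟨ha, hab.trans hb⟩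
  refine ⟨fun t ht => hz.mem t (hsub ht), hz.cont.mono hsub,
    hz.intervalIntegrable ha' ⟨ha.trans hab, hb⟩, fun t ht => ?_⟩
  rw [← hz.sub_eq ha' (hsub ht)]; abel

theorem isCompact_image (hz : IsSol X v a b z) : IsCompact (z '' Icc a b) :=
  isCompact_Icc.image_of_continuousOn hz.cont

theorem norm_sub_le (hz : IsSol X v a b z) {C : ℝ}
    (hC : ∀ r ∈ Icc a b, ‖v (z r) r‖ ≤ C) {s t : ℝ} (hs : s ∈ Icc a b) (ht : t ∈ Icc a b) :
    ‖z t - z s‖ ≤ C * |t - s| := by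
  rw [hz.sub_eq hs ht]
  refine intervalIntegral.norm_integral_le_of_norm_le_const fun r hr => hC r ?_
  exact uIcc_subset_Icc hs ht (uIoc_subset_uIcc hr)

theorem ae_hasDerivAt (hz : IsSol X v a b z) (hab : a ≤ b) :
    ∀ᵐ t, t ∈ Ioo a b → HasDerivAt z (v (z t) t) t := by
  filter_upwards [hz.integrable.ae_hasDerivAt_integral] with t ht htm
  have h1 := (ht (by rw [uIcc_of_le hab]; exact Ioo_subset_Icc_self htm) a (by simp)).const_add
    (z a)
  refine h1.congr_of_eventuallyEq ?_
  filter_upwards [Icc_mem_nhds htm.1 htm.2] with r hr using hz.eq r hr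

/-- Solutions depend continuously on their initial value: near a solution with values in `K`,
around which `v` is Lipschitz, distances grow at most exponentially. -/
theorem stability (hz : IsSol X v a b z) (hy : IsSol X v a b y) {K : Set (Vec n)}
    {η L T : ℝ} (hL : 0 ≤ L)
    (hlip : ∀ x ∈ K, ∀ p ∈ Metric.closedBall x η, ∀ t ∈ Icc 0 T, ‖v p t - v x t‖ ≤ L * ‖p - x‖)
    (ha : 0 ≤ a) (hbT : b ≤ T) (hzK : ∀ t ∈ Icc a b, z t ∈ K)
    (hsmall : ‖y a - z a‖ * Real.exp (L * (b - a)) < η) :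
    ∀ t ∈ Icc a b, ‖y t - z t‖ ≤ ‖y a - z a‖ * Real.exp (L * (t - a)) := by
  have hcont : ContinuousOn (fun t => ‖y t - z t‖) (Icc a b) := (hy.cont.sub hz.cont).norm
  have step : ∀ t ∈ Icc a b, (∀ r ∈ Icc a t, ‖y r - z r‖ ≤ η) →
      ‖y t - z t‖ ≤ ‖y a - z a‖ * Real.exp (L * (t - a)) := by
    intro t ht hr
    refine le_mul_exp_of_le_integral (g := fun t => ‖y t - z t‖) hL ht.1
      (hcont.mono (Icc_subset_Icc_right ht.2)) fun s hs => ?_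
    have haI : a ∈ Icc a b := ⟨le_rfl, ht.1.trans ht.2⟩
    have hsI : s ∈ Icc a b := ⟨hs.1, hs.2.trans ht.2⟩
    have h1 : y s - z s = (y a - z a) + ∫ r in a..s, (v (y r) r - v (z r) r) := by
      rw [intervalIntegral.integral_sub (hy.intervalIntegrable haI hsI)
        (hz.intervalIntegrable haI hsI), ← hy.sub_eq haI hsI, ← hz.sub_eq haI hsI]
      abel
    have h2 : ‖∫ r in a..s, (v (y r) r - v (z r) r)‖ ≤ ∫ r in a..s, L * ‖y r - z r‖ := by
      refine intervalIntegral.norm_integral_le_of_norm_le hs.1 ?_ ?_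
      · refine Eventually.of_forall fun r hr' => ?_
        have hrt : r ∈ Icc a t := ⟨hr'.1.le, hr'.2.trans hs.2⟩
        refine hlip _ (hzK r ⟨hrt.1, hrt.2.trans ht.2⟩) _ ?_ r
          ⟨ha.trans hrt.1, hrt.2.trans (ht.2.trans hbT)⟩
        rw [Metric.mem_closedBall, dist_eq_norm]; exact hr r hrt
      · refine ContinuousOn.intervalIntegrable ?_
        rw [uIcc_of_le hs.1]
        exact continuousOn_const.mul (hcont.mono (Icc_subset_Icc_right hsI.2))
    rw [intervalIntegral.integral_const_mul] at h2
    change ‖y s - z s‖ ≤ _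
    rw [h1]
    exact (norm_add_le _ _).trans (by gcongr)
  intro t ht
  have hab : a ≤ b := ht.1.trans ht.2
  have hmono : ∀ t ∈ Icc a b, ‖y a - z a‖ * Real.exp (L * (t - a)) ≤
      ‖y a - z a‖ * Real.exp (L * (b - a)) := fun t ht => by
    gcongr; exact ht.2
  have hall := le_of_continuation hcont hsmall (by
    have := hmono a (left_mem_Icc.2 hab)
    simp only [sub_self, mul_zero, Real.exp_zero, mul_one] at this
    exact (this.trans_lt hsmall).le) (fun t ht h => (step t ht h).trans (hmono t ht))
  exact step t ht fun r hr => (hall r ⟨hr.1, hr.2.trans ht.2⟩).trans hsmall.le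

theorem unique (hv : RegField X v) (ha : 0 ≤ a) (hz : IsSol X v a b z) (hy : IsSol X v a b y)
    (h : y a = z a) : ∀ t ∈ Icc a b, y t = z t := by
  obtain ⟨η, hη, L, hL, -, hlip⟩ := hv.lip hz.isCompact_image (image_subset_iff.2 hz.mem) b
  intro t ht
  have := hz.stability hy hL.le (fun x hx p hp t ht =>
    (hlip x hx p hp t ht).2.2 x (Metric.mem_closedBall_self hη.le)) ha le_rfl
    (fun t ht => mem_image_of_mem z ht) (by simpa [h] using hη) t ht
  rw [h, sub_self, norm_zero, zero_mul] at this
  exact sub_eq_zero.1 (norm_le_zero_iff.1 this)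

end IsSol

/-! ### Properties of the flow -/

namespace IsFlow

variable {Φ : ℝ → ℝ → Vec n → Vec n}

theorem comp (hΦ : IsFlow X v Φ) (hv : RegField X v) {s r t : ℝ} (hs : 0 ≤ s) (hsr : s ≤ r)
    (hrt : r ≤ t) {x : Vec n} (hx : x ∈ X) : Φ r t (Φ s r x) = Φ s t x := by
  have hr : 0 ≤ r := hs.trans hsr
  have hm := hΦ.mapsTo s r hs hsr hx
  exact IsSol.unique hv hr ((hΦ.isSol hs (hsr.trans hrt) hx).mono hsr hrt le_rfl)
    (hΦ.isSol hr hrt hm) (hΦ.self hr hm) t ⟨hrt, le_rfl⟩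

theorem exists_lipschitz (hΦ : IsFlow X v Φ) (hv : RegField X v) {s T : ℝ} (hs : 0 ≤ s)
    {x₀ : Vec n} (hx₀ : x₀ ∈ X) : ∃ η > 0, ∃ L > 0, ∀ x ∈ X, ‖x - x₀‖ < η →
      ∀ t ∈ Icc s T, ‖Φ s t x - Φ s t x₀‖ ≤ L * ‖x - x₀‖ := by
  rcases lt_or_ge T s with hT | hT
  · exact ⟨1, one_pos, 1, one_pos, fun x _ _ t ht =>
      absurd (ht.1.trans ht.2) (not_le.2 hT)⟩
  have hz := hΦ.isSol hs hT hx₀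
  obtain ⟨η, hη, L, hL, -, hlip⟩ := hv.lip hz.isCompact_image (image_subset_iff.2 hz.mem) T
  refine ⟨η / Real.exp (L * (T - s)), by positivity, Real.exp (L * (T - s)), by positivity,
    fun x hx hxx t ht => ?_⟩
  have hy := hΦ.isSol hs hT hx
  have := hz.stability hy hL.le (fun x hx p hp t ht =>
    (hlip x hx p hp t ht).2.2 x (Metric.mem_closedBall_self hη.le)) hs le_rfl
    (fun t ht => mem_image_of_mem _ ht) (by
      rw [hΦ.self hs hx, hΦ.self hs hx₀]
      rwa [lt_div_iff₀ (Real.exp_pos _)] at hxx) t ht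
  rw [hΦ.self hs hx, hΦ.self hs hx₀] at this
  rw [mul_comm]
  refine this.trans ?_
  gcongr
  exact ht.2

theorem continuousOn_space (hΦ : IsFlow X v Φ) (hv : RegField X v) {s T : ℝ} (hs : 0 ≤ s)
    (hT : s ≤ T) : ContinuousOn (Φ s T) X := by
  intro x₀ hx₀
  obtain ⟨η, hη, L, hL, h⟩ := hΦ.exists_lipschitz hv (T := T) hs hx₀
  have h1 : ContinuousWithinAt (fun x => L * ‖x - x₀‖) X x₀ := by fun_prop
  rw [ContinuousWithinAt, tendsto_iff_norm_sub_tendsto_zero]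
  refine squeeze_zero' (Eventually.of_forall fun _ => norm_nonneg _) ?_
    (by simpa [ContinuousWithinAt] using h1)
  filter_upwards [self_mem_nhdsWithin, mem_nhdsWithin_of_mem_nhds (Metric.ball_mem_nhds x₀ hη)]
    with x hx hx'
  exact h x hx (by rwa [Metric.mem_ball, dist_eq_norm] at hx') T ⟨hT, le_rfl⟩

theorem continuousOn_prod (hΦ : IsFlow X v Φ) (hv : RegField X v) {s T : ℝ} (hs : 0 ≤ s) :
    ContinuousOn (fun p : Vec n × ℝ => Φ s p.2 p.1) (X ×ˢ Icc s T) := by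
  rintro ⟨x₀, t₀⟩ ⟨hx₀, ht₀⟩
  simp only at hx₀ ht₀
  obtain ⟨η, hη, L, hL, h⟩ := hΦ.exists_lipschitz hv (T := T) hs hx₀
  have h1 : ContinuousWithinAt (fun p : Vec n × ℝ => L * ‖p.1 - x₀‖ +
      ‖Φ s p.2 x₀ - Φ s t₀ x₀‖) (X ×ˢ Icc s T) (x₀, t₀) := by
    have h2 : ContinuousWithinAt (fun p : Vec n × ℝ => Φ s p.2 x₀) (X ×ˢ Icc s T) (x₀, t₀) :=
      ContinuousWithinAt.comp (t := Icc s T) (g := fun t => Φ s t x₀)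
        (((hΦ.continuousOn s hs x₀ hx₀).mono Icc_subset_Ici_self) t₀ ht₀)
        continuousWithinAt_snd fun p hp => hp.2
    exact (continuousWithinAt_const.mul
      (continuousWithinAt_fst.sub continuousWithinAt_const).norm).add
      (h2.sub continuousWithinAt_const).norm
  rw [ContinuousWithinAt, tendsto_iff_norm_sub_tendsto_zero]
  refine squeeze_zero' (Eventually.of_forall fun _ => norm_nonneg _) ?_
    (by simpa [ContinuousWithinAt] using h1)
  have hb : ∀ᶠ p in 𝓝[X ×ˢ Icc s T] ((x₀, t₀) : Vec n × ℝ), p.1 ∈ Metric.ball x₀ η :=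
    (continuous_fst.tendsto _).mono_left nhdsWithin_le_nhds (Metric.ball_mem_nhds x₀ hη)
  filter_upwards [self_mem_nhdsWithin, hb] with p hp hp'
  have h3 := h p.1 hp.1 (by rwa [Metric.mem_ball, dist_eq_norm] at hp') p.2 hp.2
  calc ‖Φ s p.2 p.1 - Φ s t₀ x₀‖ = ‖(Φ s p.2 p.1 - Φ s p.2 x₀) + (Φ s p.2 x₀ - Φ s t₀ x₀)‖ := by
        congr 1; abel
    _ ≤ _ := (norm_add_le _ _).trans (by gcongr)

end IsFlow

/-! ### Contraction of nearby solutions -/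

theorem norm_sq_eq_dotProduct (x : Vec n) : ‖x‖ ^ 2 = x.ofLp ⬝ᵥ x.ofLp := by
  rw [EuclideanSpace.real_norm_sq_eq]
  simp [dotProduct, pow_two]

/-- A function of class `C¹` along a Lipschitz curve is absolutely continuous. -/
theorem absolutelyContinuous_comp {E : Type*} [NormedAddCommGroup E] [NormedSpace ℝ E]
    {G : E → ℝ} {γ : ℝ → E} {a b : ℝ} {C : ℝ≥0} (hab : a ≤ b)
    (hγ : LipschitzOnWith C γ (Icc a b)) (hG : ∀ t ∈ Icc a b, ContDiffAt ℝ 1 G (γ t)) :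
    AbsolutelyContinuousOnInterval (fun t => G (γ t)) a b := by
  have hcomp : IsCompact (γ '' Icc a b) := isCompact_Icc.image_of_continuousOn hγ.continuousOn
  have hloc : LocallyLipschitzOn (γ '' Icc a b) G := by
    rintro _ ⟨t, ht, rfl⟩
    obtain ⟨K, s, hs, hK⟩ := (hG t ht).exists_lipschitzOnWith
    exact ⟨K, s, mem_nhdsWithin_of_mem_nhds hs, hK⟩
  obtain ⟨K, hK⟩ := hloc.exists_lipschitzOnWith_of_compact hcomp
  refine LipschitzOnWith.absolutelyContinuousOnInterval (K := K * C) ?_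
  rw [uIcc_of_le hab]
  exact hK.comp hγ (mapsTo_image _ _)

theorem IsSol.exists_lipschitzOnWith {a b : ℝ} {z : ℝ → Vec n} (hz : IsSol X v a b z)
    (hv : RegField X v) (ha : 0 ≤ a) : ∃ C : ℝ≥0, LipschitzOnWith C z (Icc a b) := by
  obtain ⟨C, hC⟩ := hv.bdd _ hz.isCompact_image (image_subset_iff.2 hz.mem) b
  refine ⟨C.toNNReal, LipschitzOnWith.of_dist_le_mul fun s hs t ht => ?_⟩
  rw [dist_eq_norm, Real.dist_eq]
  refine (hz.norm_sub_le (fun r hr => (hC _ (mem_image_of_mem z hr) r ⟨ha.trans hr.1, hr.2⟩).1)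
    ht hs).trans ?_
  gcongr
  exact Real.le_coe_toNNReal C

/-- The total derivative is the derivative along solution curves. -/
theorem hasDerivAt_totalDeriv {M : Vec n → ℝ → Matrix (Fin n) (Fin n) ℝ} {z : ℝ → Vec n}
    {t : ℝ} (ht : 0 < t) {a b : Fin n} (hz : HasDerivAt z (v (z t) t) t)
    (hM : DifferentiableAt ℝ (fun p : Vec n × ℝ => M p.1 p.2 a b) (z t, t)) :
    HasDerivAt (fun r => M (z r) r a b) (totalDeriv v M (z t) t a b) t := by
  have h1 := HasFDerivAt.comp_hasDerivAt (f := fun r => (z r, r)) t hM.hasFDerivAt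
    (hz.prodMk (hasDerivAt_id t))
  refine h1.congr_deriv ?_
  set L := fderiv ℝ (fun p : Vec n × ℝ => M p.1 p.2 a b) (z t, t)
  have hx : HasFDerivAt (fun y => M y t a b) (L.comp (ContinuousLinearMap.inl ℝ (Vec n) ℝ))
      (z t) := HasFDerivAt.comp (g := fun p : Vec n × ℝ => M p.1 p.2 a b) (f := fun e => (e, t))
        (z t) hM.hasFDerivAt (hasFDerivAt_prodMk_left (z t) t)
  have hr : HasDerivAt (fun r => M (z t) r a b) (L (0, 1)) t :=
    HasFDerivAt.comp_hasDerivAt (f := fun r => (z t, r)) t hM.hasFDerivAt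
      ((hasDerivAt_const t (z t)).prodMk (hasDerivAt_id t))
  simp only [totalDeriv, Matrix.of_apply]
  rw [hx.fderiv, hr.hasDerivWithinAt.derivWithin (uniqueDiffOn_Ici 0 t ht.le)]
  simp only [ContinuousLinearMap.coe_comp, Function.comp_apply, ContinuousLinearMap.inl_apply]
  rw [← map_add]
  simp

theorem mulV_jacobian {w : Vec n → Vec n} {x : Vec n} (d : Vec n) :
    (Matrix.of fun a b => (fderiv ℝ w x (basisVec b)) a) *ᵥ d.ofLp =
      (fderiv ℝ w x d).ofLp := by
  have hd : d = ∑ b, d b • (basisVec b : Vec n) := by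
    ext a
    simp [basisVec, Finset.sum_apply, Pi.single_apply]
  ext a
  conv_rhs => rw [hd]
  simp [Matrix.mulVec, dotProduct, map_sum, mul_comm]

/-- The differential inequality behind the contraction estimate: `Q` is the derivative of the
squared length `d ⬝ᵥ M *ᵥ d` when `d' = J *ᵥ d + e`, and `e` is small compared to `d`. -/
theorem contraction_quadratic {Θ D J : Matrix (Fin n) (Fin n) ℝ} {α mlo mhi ε : ℝ}
    (hlo : 0 < mlo) (hhi : 0 < mhi) (hε : 0 < ε)
    (lower : (Θᵀ * Θ - mlo • (1 : Matrix (Fin n) (Fin n) ℝ)).PosSemidef)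
    (upper : (mhi • (1 : Matrix (Fin n) (Fin n) ℝ) - Θᵀ * Θ).PosSemidef)
    (contr : ((2 * α) • (Θᵀ * Θ) - (D + (2 : ℝ) • symPart (Θᵀ * Θ * J))).PosSemidef)
    {d e : Fin n → ℝ} (he : e ⬝ᵥ e ≤ ε ^ 2 * (mlo / mhi) * (d ⬝ᵥ d)) :
    d ⬝ᵥ D *ᵥ d + 2 * (d ⬝ᵥ (Θᵀ * Θ) *ᵥ (J *ᵥ d + e)) ≤
      2 * (α + ε) * (d ⬝ᵥ (Θᵀ * Θ) *ᵥ d) := by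
  set M := Θᵀ * Θ with hM
  have hsym : ∀ x y, x ⬝ᵥ M *ᵥ y = y ⬝ᵥ M *ᵥ x := fun x y => by
    rw [Matrix.dotProduct_mulVec, ← Matrix.mulVec_transpose, dotProduct_comm]
    simp [hM, Matrix.transpose_mul]
  have hpos : ∀ x, 0 ≤ x ⬝ᵥ M *ᵥ x := fun x => by
    have : x ⬝ᵥ M *ᵥ x = (Θ *ᵥ x) ⬝ᵥ (Θ *ᵥ x) := by
      rw [hM, ← Matrix.mulVec_mulVec, Matrix.dotProduct_mulVec, Matrix.vecMul_transpose]
    rw [this]; exact Finset.sum_nonneg fun i _ => mul_self_nonneg _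
  have h1 := lower.dotProduct_mulVec_nonneg d
  have h2 := upper.dotProduct_mulVec_nonneg e
  have h3 := contr.dotProduct_mulVec_nonneg d
  have h4 := hpos (ε • d - e)
  simp only [star_trivial, Matrix.sub_mulVec, Matrix.smul_mulVec, Matrix.one_mulVec,
    dotProduct_sub, dotProduct_smul, smul_eq_mul, Matrix.add_mulVec, dotProduct_add, symPart,
    Matrix.mulVec_sub, Matrix.mulVec_smul, sub_dotProduct, smul_dotProduct] at h1 h2 h3 h4
  have h5 : d ⬝ᵥ (M * J)ᵀ *ᵥ d = d ⬝ᵥ (M * J) *ᵥ d := by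
    rw [Matrix.mulVec_transpose, dotProduct_comm, ← Matrix.dotProduct_mulVec]
  rw [h5, ← Matrix.mulVec_mulVec d M J] at h3
  rw [hsym e d] at h4
  rw [Matrix.mulVec_add, dotProduct_add]
  have h6 : mhi * (e ⬝ᵥ e) ≤ ε ^ 2 * (d ⬝ᵥ M *ᵥ d) := by
    calc mhi * (e ⬝ᵥ e) ≤ mhi * (ε ^ 2 * (mlo / mhi) * (d ⬝ᵥ d)) := by gcongr
      _ = ε ^ 2 * (mlo * (d ⬝ᵥ d)) := by field_simp
      _ ≤ ε ^ 2 * (d ⬝ᵥ M *ᵥ d) := by gcongr; linarith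
  have h7 : 2 * ε * (d ⬝ᵥ M *ᵥ e) ≤ 2 * ε * (ε * (d ⬝ᵥ M *ᵥ d)) := by nlinarith
  have h8 : d ⬝ᵥ M *ᵥ e ≤ ε * (d ⬝ᵥ M *ᵥ d) := le_of_mul_le_mul_left h7 (by positivity)
  linarith

/-- Along a fixed solution, nearby solutions approach it at the contraction rate, up to an
arbitrarily small loss `ε`. -/
theorem IsContracting.exists_near (hv : RegField X v)
    {Θ : Vec n → ℝ → Matrix (Fin n) (Fin n) ℝ} {α mlo mhi : ℝ}
    (hΘ : IsContracting X v Θ α mlo mhi) {r₀ t : ℝ} (hr₀ : 0 ≤ r₀) {z : ℝ → Vec n}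
    (hz : IsSol X v r₀ t z) {ε : ℝ} (hε : 0 < ε) :
    ∃ η > 0, ∀ r ∈ Ioc r₀ t, ∀ y, IsSol X v r t y → ‖y r - z r‖ < η →
      ‖y t - z t‖ ≤ Real.sqrt (mhi / mlo) * Real.exp ((α + ε) * (t - r)) * ‖y r - z r‖ := by
  have hlo := hΘ.mlo_pos
  have hhi := hΘ.mhi_pos
  set K := z '' Icc r₀ t with hKdef
  have hK : IsCompact K := hz.isCompact_image
  have hKX : K ⊆ X := image_subset_iff.2 hz.mem
  set ε₀ := ε * Real.sqrt (mlo / mhi) with hε₀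
  have hε₀pos : 0 < ε₀ := mul_pos hε (Real.sqrt_pos.2 (div_pos hlo hhi))
  obtain ⟨η₁, hη₁, -, htay⟩ := hv.taylor hK hKX t hε₀pos
  obtain ⟨η₂, hη₂, L, hL, -, hlip⟩ := hv.lip hK hKX t
  set E := Real.exp (L * (t - r₀)) with hE
  have hEpos : 0 < E := Real.exp_pos _
  refine ⟨min η₁ η₂ / E, by positivity, fun r hr y hy hyr => ?_⟩
  have hzr : IsSol X v r t z := hz.mono hr.1.le hr.2 le_rfl
  have hr0 : 0 < r := hr₀.trans_lt hr.1
  have hzK : ∀ s ∈ Icc r t, z s ∈ K := fun s hs => mem_image_of_mem z ⟨hr.1.le.trans hs.1, hs.2⟩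
  have hexp : ∀ s ∈ Icc r t, ‖y r - z r‖ * Real.exp (L * (s - r)) < min η₁ η₂ := fun s hs => by
    have h1 : Real.exp (L * (s - r)) ≤ E := by
      rw [hE]; gcongr
      · exact hs.2
      · exact hr.1.le
    rw [lt_div_iff₀ hEpos] at hyr
    exact (mul_le_mul_of_nonneg_left h1 (norm_nonneg _)).trans_lt hyr
  have hclose : ∀ s ∈ Icc r t, ‖y s - z s‖ ≤ η₁ := fun s hs =>
    (hzr.stability hy hL.le (fun x hx p hp t ht =>
      (hlip x hx p hp t ht).2.2 x (Metric.mem_closedBall_self hη₂.le)) hr0.le le_rfl hzK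
      ((hexp t ⟨hr.2, le_rfl⟩).trans_le (min_le_right _ _)) s hs).trans
      ((hexp s hs).le.trans (min_le_left _ _))
  -- the squared length of the difference in the metric `M`
  set M : Vec n → ℝ → Matrix (Fin n) (Fin n) ℝ := fun x s => (Θ x s)ᵀ * Θ x s with hM
  set d : ℝ → Fin n → ℝ := fun s => (y s - z s).ofLp with hd
  set V : ℝ → ℝ := fun s => d s ⬝ᵥ M (z s) s *ᵥ d s with hV
  have hMsm : ∀ s ∈ Icc r t, ∀ a b,
      ContDiffAt ℝ 1 (fun p : Vec n × ℝ => M p.1 p.2 a b) (z s, s) := by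
    intro s hs a b
    have h1 : ∀ a b, ContDiffAt ℝ 1 (fun p : Vec n × ℝ => Θ p.1 p.2 a b) (z s, s) :=
      fun a b => (hΘ.smooth a b).contDiffAt
        (prod_mem_nhds (hv.isOpen.mem_nhds (hzr.mem s hs)) (Ici_mem_nhds (hr0.trans_le hs.1)))
    simp only [hM, Matrix.mul_apply, Matrix.transpose_apply]
    exact ContDiffAt.sum fun k _ => (h1 k a).mul (h1 k b)
  have hVac : AbsolutelyContinuousOnInterval V r t := by
    obtain ⟨C₁, hC₁⟩ := hzr.exists_lipschitzOnWith hv hr0.le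
    obtain ⟨C₂, hC₂⟩ := hy.exists_lipschitzOnWith hv hr0.le
    refine absolutelyContinuous_comp (E := (Vec n × ℝ) × Vec n)
      (G := fun p => (p.2 - p.1.1).ofLp ⬝ᵥ M p.1.1 p.1.2 *ᵥ (p.2 - p.1.1).ofLp)
      (γ := fun s => ((z s, s), y s)) hr.2
      ((hC₁.prodMk LipschitzWith.id.lipschitzOnWith).prodMk hC₂) fun s hs => ?_
    simp only [dotProduct, Matrix.mulVec]
    refine ContDiffAt.sum fun a _ => ContDiffAt.mul ?_ (ContDiffAt.sum fun b _ => ContDiffAt.mul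
      ?_ ?_)
    · fun_prop
    · exact ContDiffAt.comp (g := fun p : Vec n × ℝ => M p.1 p.2 a b)
        (f := fun p : (Vec n × ℝ) × Vec n => p.1) ((z s, s), y s) (hMsm s hs a b) contDiffAt_fst
    · fun_prop
  have hVd : ∀ᵐ s, s ∈ Ioo r t → ∃ f', HasDerivAt V f' s ∧ f' ≤ 2 * (α + ε) * V s := by
    filter_upwards [hzr.ae_hasDerivAt hr.2, hy.ae_hasDerivAt hr.2] with s h1 h2 hs
    have hsI : s ∈ Icc r t := Ioo_subset_Icc_self hs
    have hs0 : 0 < s := hr0.trans hs.1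
    specialize h1 hs
    specialize h2 hs
    set J := jacobian v (z s) s with hJ
    set e : Vec n := v (y s) s - v (z s) s - fderiv ℝ (fun p => v p s) (z s) (y s - z s) with he
    have hd' : (v (y s) s - v (z s) s).ofLp = J *ᵥ d s + e.ofLp := by
      rw [hJ, jacobian, mulV_jacobian, he]; simp
    have hdd : ∀ a, HasDerivAt (fun q => d q a) ((J *ᵥ d s + e.ofLp) a) s := fun a => by
      rw [← hd']
      exact (EuclideanSpace.proj a : Vec n →L[ℝ] ℝ).hasFDerivAt.comp_hasDerivAt s (h2.sub h1)
    have hMd : ∀ a b, HasDerivAt (fun q => M (z q) q a b) (totalDeriv v M (z s) s a b) s :=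
      fun a b => hasDerivAt_totalDeriv hs0 h1 ((hMsm s hsI a b).differentiableAt one_ne_zero)
    have hVs : HasDerivAt (fun q => ∑ a, d q a * ∑ b, M (z q) q a b * d q b) _ s :=
      HasDerivAt.fun_sum fun a _ => (hdd a).fun_mul
        (HasDerivAt.fun_sum fun b _ => (hMd a b).fun_mul (hdd b))
    refine ⟨_, hVs, ?_⟩
    have hes : e.ofLp ⬝ᵥ e.ofLp ≤ ε ^ 2 * (mlo / mhi) * (d s ⬝ᵥ d s) := by
      rw [← norm_sq_eq_dotProduct, hd, ← norm_sq_eq_dotProduct]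
      have h3 : ‖e‖ ≤ ε₀ * ‖y s - z s‖ := htay _ (hzK s hsI) (y s)
        (by rw [Metric.mem_closedBall, dist_eq_norm]; exact hclose s hsI) (z s)
        (Metric.mem_closedBall_self hη₁.le) s ⟨hs0.le, hs.2.le⟩
      calc ‖e‖ ^ 2 ≤ (ε₀ * ‖y s - z s‖) ^ 2 := by gcongr
        _ = _ := by
          rw [mul_pow, hε₀, mul_pow, Real.sq_sqrt (div_pos hlo hhi).le]
    refine le_trans (le_of_eq ?_) (contraction_quadratic hlo hhi hε
      (hΘ.lower _ (hzr.mem s hsI) s hs0.le) (hΘ.upper _ (hzr.mem s hsI) s hs0.le)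
      (hΘ.contraction _ (hzr.mem s hsI) s hs0.le) hes)
    have hsym : ∀ x w : Fin n → ℝ, x ⬝ᵥ M (z s) s *ᵥ w = w ⬝ᵥ M (z s) s *ᵥ x := fun x w => by
      rw [Matrix.dotProduct_mulVec, ← Matrix.mulVec_transpose, dotProduct_comm]
      simp [hM, Matrix.transpose_mul]
    change _ = d s ⬝ᵥ totalDeriv v M (z s) s *ᵥ d s + 2 * (d s ⬝ᵥ M (z s) s *ᵥ (J *ᵥ d s + e.ofLp))
    rw [two_mul]
    nth_rewrite 2 [hsym (d s)]
    simp only [dotProduct, Matrix.mulVec, Finset.mul_sum, ← Finset.sum_add_distrib]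
    refine Finset.sum_congr rfl fun a _ => Finset.sum_congr rfl fun b _ => ?_
    ring
  have hfin := le_mul_exp_of_ae_deriv_le hr.2 hVac hVd
  have hVlo : mlo * ‖y t - z t‖ ^ 2 ≤ V t := by
    have := (hΘ.lower _ (hzr.mem t ⟨hr.2, le_rfl⟩) t (hr0.le.trans hr.2)).dotProduct_mulVec_nonneg
      (d t)
    simp only [star_trivial, Matrix.sub_mulVec, Matrix.smul_mulVec, Matrix.one_mulVec,
      dotProduct_sub, dotProduct_smul, smul_eq_mul] at this
    rw [norm_sq_eq_dotProduct]; linarith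
  have hVhi : V r ≤ mhi * ‖y r - z r‖ ^ 2 := by
    have := (hΘ.upper _ (hzr.mem r ⟨le_rfl, hr.2⟩) r hr0.le).dotProduct_mulVec_nonneg
      (d r)
    simp only [star_trivial, Matrix.sub_mulVec, Matrix.smul_mulVec, Matrix.one_mulVec,
      dotProduct_sub, dotProduct_smul, smul_eq_mul] at this
    rw [norm_sq_eq_dotProduct]; linarith
  refine (abs_le_of_sq_le_sq' ?_ (by positivity)).2
  have h3 : mlo * ‖y t - z t‖ ^ 2 ≤
      mhi * ‖y r - z r‖ ^ 2 * Real.exp (2 * (α + ε) * (t - r)) :=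
    hVlo.trans (hfin.trans (by gcongr))
  rw [mul_pow, mul_pow, Real.sq_sqrt (div_pos hhi hlo).le, ← Real.exp_nat_mul]
  rw [← le_div_iff₀' hlo] at h3
  refine h3.trans (le_of_eq ?_)
  rw [show ((2 : ℕ) : ℝ) * ((α + ε) * (t - r)) = 2 * (α + ε) * (t - r) by push_cast; ring]
  field_simp

/-! ### Comparison of two flows -/

/-- Solutions of two equations whose right-hand sides differ by at most `d` separate, from a common
starting point, at most at the speed `d`, to first order. -/
theorem IsSol.eventually_norm_sub_le {v₁ v₂ : Vec n → ℝ → Vec n} (hv : RegField X v₁) {d ε : ℝ}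
    (hε : 0 < ε) (hd : ∀ x ∈ X, ∀ t, 0 ≤ t → ‖v₁ x t - v₂ x t‖ ≤ d) {r t : ℝ} (hr : 0 ≤ r)
    (hrt : r < t) {u y : ℝ → Vec n} (hu : IsSol X v₁ r t u) (hy : IsSol X v₂ r t y)
    (h0 : y r = u r) : ∀ᶠ q in 𝓝[>] r, ‖y q - u q‖ ≤ (d + ε) * (q - r) := by
  have hrI : r ∈ Icc r t := ⟨le_rfl, hrt.le⟩
  obtain ⟨η, hη, L, hL, -, hlip⟩ := hv.lip (K := {u r}) isCompact_singleton
    (singleton_subset_iff.2 (hu.mem r hrI)) t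
  have hnear : ∀ w : ℝ → Vec n, ContinuousOn w (Icc r t) → ∀ c > 0,
      ∃ δ > 0, ∀ s ∈ Icc r t, s - r < δ → ‖w s - w r‖ < c := by
    intro w hw c hc
    obtain ⟨δ, hδ, h⟩ := Metric.continuousOn_iff.1 hw r hrI c hc
    refine ⟨δ, hδ, fun s hs hsr => ?_⟩
    rw [← dist_eq_norm]
    refine h s hs ?_
    rw [Real.dist_eq, abs_of_nonneg (sub_nonneg.2 hs.1)]; exact hsr
  have hc : 0 < min η (ε / (2 * L)) := by positivity
  obtain ⟨δ₁, hδ₁, h₁⟩ := hnear u hu.cont _ hc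
  obtain ⟨δ₂, hδ₂, h₂⟩ := hnear y hy.cont _ hc
  have hev : ∀ᶠ q in 𝓝[>] r, q < min (r + min δ₁ δ₂) t :=
    mem_nhdsWithin_of_mem_nhds (gt_mem_nhds (lt_min (by
      have := lt_min hδ₁ hδ₂; linarith) hrt))
  filter_upwards [self_mem_nhdsWithin, hev] with q hq hq'
  have hrq : r ≤ q := le_of_lt hq
  obtain ⟨hq1, hq2⟩ := lt_min_iff.1 hq'
  have hqI : q ∈ Icc r t := ⟨hrq, hq2.le⟩
  have h3 : y q - u q = ∫ s in r..q, (v₂ (y s) s - v₁ (u s) s) := by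
    rw [intervalIntegral.integral_sub (hy.intervalIntegrable hrI hqI)
      (hu.intervalIntegrable hrI hqI), ← hy.sub_eq hrI hqI, ← hu.sub_eq hrI hqI, h0]
    abel
  rw [h3, ← abs_of_nonneg (sub_nonneg.2 hrq)]
  refine intervalIntegral.norm_integral_le_of_norm_le_const fun s hs => ?_
  rw [uIoc_of_le hrq] at hs
  have hsI : s ∈ Icc r t := ⟨hs.1.le, hs.2.trans hqI.2⟩
  have hs1 : s - r < min δ₁ δ₂ := by linarith [hs.2]
  have hu1 := lt_min_iff.1 (h₁ s hsI (hs1.trans_le (min_le_left _ _)))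
  have hy1 := lt_min_iff.1 (h₂ s hsI (hs1.trans_le (min_le_right _ _)))
  rw [h0] at hy1
  have h4 : ‖v₁ (y s) s - v₁ (u s) s‖ ≤ L * ‖y s - u s‖ :=
    (hlip _ rfl (y s) (by rw [Metric.mem_closedBall, dist_eq_norm]; exact hy1.1.le) s
      ⟨hr.trans hsI.1, hsI.2⟩).2.2 _ (by rw [Metric.mem_closedBall, dist_eq_norm]; exact hu1.1.le)
  have h5 : ‖y s - u s‖ ≤ ε / L := by
    calc ‖y s - u s‖ = ‖(y s - u r) - (u s - u r)‖ := by congr 1; abel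
      _ ≤ ‖y s - u r‖ + ‖u s - u r‖ := _root_.norm_sub_le _ _
      _ ≤ ε / (2 * L) + ε / (2 * L) := add_le_add hy1.2.le hu1.2.le
      _ = ε / L := by field_simp; ring
  calc ‖v₂ (y s) s - v₁ (u s) s‖
      = ‖(v₁ (y s) s - v₁ (u s) s) - (v₁ (y s) s - v₂ (y s) s)‖ := by congr 1; abel
    _ ≤ ‖v₁ (y s) s - v₁ (u s) s‖ + ‖v₁ (y s) s - v₂ (y s) s‖ := _root_.norm_sub_le _ _
    _ ≤ L * (ε / L) + d := add_le_add (h4.trans (by gcongr))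
        (hd _ (hy.mem s hsI) s (hr.trans hsI.1))
    _ = d + ε := by field_simp; ring

/-- Transporting the points of a curve to the final time `t` by the flow depends continuously on
the point at which the flow takes over. -/
theorem IsFlow.continuousOn_transport {Φ : ℝ → ℝ → Vec n → Vec n} (hΦ : IsFlow X v Φ)
    (hv : RegField X v) {t : ℝ} {y : ℝ → Vec n} (hy : ContinuousOn y (Icc 0 t))
    (hyX : ∀ r ∈ Icc 0 t, y r ∈ X) : ContinuousOn (fun r => Φ r t (y r)) (Icc 0 t) := by
  obtain ⟨δ, hδ, C, hC, hsp⟩ := hv.exists_speed (isCompact_Icc.image_of_continuousOn hy)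
    (image_subset_iff.2 hyX) t
  intro r hr
  -- Both one-sided statements reduce to the continuity of `Φ (max r q) t`: the earlier of the two
  -- points is first moved up to the time of the later one.
  have hmem : y r ∈ X := hyX r hr
  rw [← Icc_union_Icc_eq_Icc hr.1 hr.2]
  refine ContinuousWithinAt.union ?_ ?_
  · have hcont := hΦ.continuousOn_space hv hr.1 hr.2 (y r) hmem
    have hg : Tendsto (fun q => Φ q r (y q)) (𝓝[Icc 0 r] r) (𝓝[X] (y r)) := by
      refine tendsto_nhdsWithin_iff.2 ⟨?_, ?_⟩
      · rw [tendsto_iff_norm_sub_tendsto_zero]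
        have hlim : Tendsto (fun q => C * |r - q| + ‖y q - y r‖) (𝓝[Icc 0 r] r) (𝓝 0) := by
          have h1 : Tendsto y (𝓝[Icc 0 r] r) (𝓝 (y r)) :=
            (hy r hr).mono_left (nhdsWithin_mono _ (Icc_subset_Icc_right hr.2))
          have h2 : Tendsto (fun q => C * |r - q|) (𝓝[Icc 0 r] r) (𝓝 (C * |r - r|)) :=
            (Continuous.tendsto (by fun_prop) r).mono_left nhdsWithin_le_nhds
          simpa using h2.add (tendsto_iff_norm_sub_tendsto_zero.1 h1)
        refine squeeze_zero' (Eventually.of_forall fun _ => norm_nonneg _) ?_ hlim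
        have hev : ∀ᶠ q in 𝓝[Icc 0 r] r, r - δ < q :=
          mem_nhdsWithin_of_mem_nhds (lt_mem_nhds (by linarith))
        filter_upwards [self_mem_nhdsWithin, hev] with q hq hq'
        have hqI : q ∈ Icc 0 t := ⟨hq.1, hq.2.trans hr.2⟩
        have h3 := hsp q r hq.1 hr.2 (by linarith) _ (hΦ.isSol hq.1 hq.2 (hyX q hqI))
          (by rw [hΦ.self hq.1 (hyX q hqI)]; exact mem_image_of_mem _ hqI) r ⟨hq.2, le_rfl⟩
        rw [hΦ.self hq.1 (hyX q hqI)] at h3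
        rw [abs_of_nonneg (sub_nonneg.2 hq.2)]
        calc ‖Φ q r (y q) - y r‖ = ‖(Φ q r (y q) - y q) + (y q - y r)‖ := by congr 1; abel
          _ ≤ _ := (norm_add_le _ _).trans (by gcongr)
      · filter_upwards [self_mem_nhdsWithin] with q hq
        exact hΦ.mapsTo q r hq.1 hq.2 (hyX q ⟨hq.1, hq.2.trans hr.2⟩)
    have h4 : Tendsto (fun q => Φ r t (Φ q r (y q))) (𝓝[Icc 0 r] r) (𝓝 (Φ r t (y r))) :=
      hcont.tendsto.comp hg
    refine h4.congr' ?_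
    filter_upwards [self_mem_nhdsWithin] with q hq
    exact hΦ.comp hv hq.1 hq.2 hr.2 (hyX q ⟨hq.1, hq.2.trans hr.2⟩)
  · obtain ⟨η, hη, L, hL, -, hlip⟩ := hv.lip (hΦ.isSol hr.1 hr.2 hmem).isCompact_image
      (image_subset_iff.2 (hΦ.isSol hr.1 hr.2 hmem).mem) t
    set E := Real.exp (L * (t - r)) with hE
    have hEpos : 0 < E := Real.exp_pos _
    have hz := hΦ.isSol hr.1 hr.2 hmem
    have hself := hΦ.self hr.1 hmem
    have hdist : Tendsto (fun q => ‖y q - Φ r q (y r)‖ * E) (𝓝[Icc r t] r) (𝓝 0) := by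
      have h1 : Tendsto y (𝓝[Icc r t] r) (𝓝 (y r)) :=
        (hy r hr).mono_left (nhdsWithin_mono _ (Icc_subset_Icc_left hr.1))
      have h2 : Tendsto (fun q => Φ r q (y r)) (𝓝[Icc r t] r) (𝓝 (Φ r r (y r))) :=
        hz.cont r ⟨le_rfl, hr.2⟩
      rw [hself] at h2
      simpa using (h1.sub h2).norm.mul_const E
    rw [ContinuousWithinAt, tendsto_iff_norm_sub_tendsto_zero]
    refine squeeze_zero' (Eventually.of_forall fun _ => norm_nonneg _) ?_ hdist
    filter_upwards [self_mem_nhdsWithin, hdist.eventually (gt_mem_nhds hη)] with q hq hq'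
    have hq0 : 0 ≤ q := hr.1.trans hq.1
    have hqX := hyX q ⟨hq0, hq.2⟩
    have hle : Real.exp (L * (t - q)) ≤ E := by rw [hE]; gcongr; exact hq.1
    have h5 := (hz.mono hq.1 hq.2 le_rfl).stability (hΦ.isSol hq0 hq.2 hqX) hL.le
      (fun x hx p hp t ht => (hlip x hx p hp t ht).2.2 x (Metric.mem_closedBall_self hη.le))
      hq0 le_rfl (fun s hs => mem_image_of_mem _ ⟨hq.1.trans hs.1, hs.2⟩)
      (by rw [hΦ.self hq0 hqX]
          exact (mul_le_mul_of_nonneg_left hle (norm_nonneg _)).trans_lt hq') t ⟨hq.2, le_rfl⟩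
    rw [hΦ.self hq0 hqX] at h5
    exact h5.trans (by gcongr)

/-- **Robustness of contracting flows.** The flow of a contracting field and the flow of a field at
uniform distance at most `d` from it differ by at most `κ d ∫ e^{α (t - r)} dr`. The bound is
obtained along the curve `r ↦ Φ₁ r t (Φ₂ 0 r x)`, which connects the two end points and stays
in `X`, so that no convexity of `X` is needed. -/
theorem IsFlow.norm_sub_le {v₁ v₂ : Vec n → ℝ → Vec n} (hv₁ : RegField X v₁)
    {Φ₁ Φ₂ : ℝ → ℝ → Vec n → Vec n} (hΦ₁ : IsFlow X v₁ Φ₁) (hΦ₂ : IsFlow X v₂ Φ₂)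
    {Θ : Vec n → ℝ → Matrix (Fin n) (Fin n) ℝ} {α mlo mhi : ℝ}
    (hΘ : IsContracting X v₁ Θ α mlo mhi) {d : ℝ}
    (hd : ∀ x ∈ X, ∀ t, 0 ≤ t → ‖v₁ x t - v₂ x t‖ ≤ d) {t : ℝ} (ht : 0 ≤ t) {x : Vec n}
    (hx : x ∈ X) : ‖Φ₂ 0 t x - Φ₁ 0 t x‖ ≤
      Real.sqrt (mhi / mlo) * d * ∫ r in (0 : ℝ)..t, Real.exp (α * (t - r)) := by
  set κ := Real.sqrt (mhi / mlo) with hκ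
  have hκ0 : 0 ≤ κ := Real.sqrt_nonneg _
  have hd0 : 0 ≤ d := (norm_nonneg _).trans (hd x hx 0 le_rfl)
  set y : ℝ → Vec n := fun r => Φ₂ 0 r x with hy
  have hyX : ∀ r ∈ Icc 0 t, y r ∈ X := fun r hr => hΦ₂.mapsTo 0 r le_rfl hr.1 hx
  set G : ℝ → Vec n := fun r => Φ₁ r t (y r) with hG
  have hGc : ContinuousOn G (Icc 0 t) :=
    hΦ₁.continuousOn_transport hv₁ (hΦ₂.isSol le_rfl ht hx).cont hyX
  have hB : ∀ r, HasDerivAt (fun r => κ * d * ∫ q in (0 : ℝ)..r, Real.exp (α * (t - q)))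
      (κ * d * Real.exp (α * (t - r))) r := fun r =>
    (intervalIntegral.integral_hasDerivAt_right
      (Continuous.intervalIntegrable (by fun_prop) _ _)
      (Continuous.stronglyMeasurableAtFilter (by fun_prop) _ _)
      (Continuous.continuousAt (by fun_prop))).const_mul _
  have key := image_le_of_liminf_slope_right_le_deriv_boundary
    (f := fun r => ‖G r - G 0‖) (hGc.sub continuousOn_const).norm
    (B := fun r => κ * d * ∫ q in (0 : ℝ)..r, Real.exp (α * (t - q)))
    (B' := fun r => κ * d * Real.exp (α * (t - r))) (by simp)
    (fun r _ => (hB r).continuousAt.continuousWithinAt)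
    (fun r _ => (hB r).hasDerivWithinAt) (fun r hr ρ hρ => Eventually.frequently ?_)
    (right_mem_Icc.2 ht)
  · have h0 : Φ₂ 0 0 x = x := hΦ₂.self le_rfl hx
    have h1 : Φ₁ t t (Φ₂ 0 t x) = Φ₂ 0 t x := hΦ₁.self ht (hyX t ⟨ht, le_rfl⟩)
    simpa [hG, hy, h0, h1] using key
  · have hrI : r ∈ Icc 0 t := Ico_subset_Icc_self hr
    -- room for the loss `ε` in the contraction rate and in the speed of separation
    obtain ⟨ε, hε, hερ⟩ : ∃ ε > 0, κ * (d + ε) * Real.exp ((α + ε) * (t - r)) < ρ := by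
      have hc : Tendsto (fun ε => κ * (d + ε) * Real.exp ((α + ε) * (t - r))) (𝓝[>] 0)
          (𝓝 (κ * (d + 0) * Real.exp ((α + 0) * (t - r)))) :=
        (Continuous.tendsto (by fun_prop) 0).mono_left nhdsWithin_le_nhds
      simp only [add_zero] at hc
      obtain ⟨ε, h1, h2⟩ := ((hc.eventually (gt_mem_nhds hρ)).and self_mem_nhdsWithin).exists
      exact ⟨ε, h2, h1⟩
    have hmem := hyX r hrI
    have hz := hΦ₁.isSol hrI.1 hrI.2 hmem
    have hself := hΦ₁.self hrI.1 hmem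
    obtain ⟨η, hη, hcon⟩ := hΘ.exists_near hv₁ hrI.1 hz hε
    have hsep := IsSol.eventually_norm_sub_le hv₁ hε hd hrI.1 hr.2 hz
      ((hΦ₂.isSol le_rfl ht hx).mono hrI.1 hrI.2 le_rfl) hself.symm
    have hρ' : ∀ᶠ q in 𝓝[>] r, κ * (d + ε) * Real.exp ((α + ε) * (t - q)) < ρ :=
      mem_nhdsWithin_of_mem_nhds ((Continuous.tendsto (f := fun q =>
        κ * (d + ε) * Real.exp ((α + ε) * (t - q))) (by fun_prop) r).eventually (gt_mem_nhds hερ))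
    have hsmall : ∀ᶠ q in 𝓝[>] r, (d + ε) * (q - r) < η :=
      mem_nhdsWithin_of_mem_nhds ((Continuous.tendsto (f := fun q => (d + ε) * (q - r))
        (by fun_prop) r).eventually (gt_mem_nhds (by simpa using hη)))
    have htq : ∀ᶠ q in 𝓝[>] r, q < t := mem_nhdsWithin_of_mem_nhds (gt_mem_nhds hr.2)
    filter_upwards [self_mem_nhdsWithin, hsep, hρ', hsmall, htq] with q hq h1 h2 h3 h4
    have hrq : r < q := hq
    have hqX := hyX q ⟨hrI.1.trans hrq.le, h4.le⟩
    have hq0 : 0 ≤ q := hrI.1.trans hrq.le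
    have hqs := hΦ₁.self hq0 hqX
    have h5 := hcon q ⟨hrq, h4.le⟩ _ (hΦ₁.isSol hq0 h4.le hqX)
      (by rw [hqs]; exact h1.trans_lt h3)
    rw [hqs] at h5
    have h6 : ‖G q - G r‖ ≤ κ * (d + ε) * Real.exp ((α + ε) * (t - q)) * (q - r) := by
      refine h5.trans ?_
      calc κ * Real.exp ((α + ε) * (t - q)) * ‖y q - Φ₁ r q (y r)‖
          ≤ κ * Real.exp ((α + ε) * (t - q)) * ((d + ε) * (q - r)) := by gcongr
        _ = _ := by ring
    rw [slope_def_field, div_lt_iff₀ (sub_pos.2 hrq)]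
    have h7 : ‖G q - G 0‖ - ‖G r - G 0‖ ≤ ‖G q - G r‖ := by
      have := norm_sub_norm_le (G q - G 0) (G r - G 0)
      simpa using this
    exact (h7.trans h6).trans_lt (mul_lt_mul_of_pos_right h2 (sub_pos.2 hrq))

/-! ### The Jacobian determinant of the flow over short times -/

/-- The trace as a continuous linear functional on the endomorphisms of `Vec n`. -/
noncomputable def traceCLM (n : ℕ) : (Vec n →L[ℝ] Vec n) →L[ℝ] ℝ :=
  LinearMap.toContinuousLinearMap
    ((LinearMap.trace ℝ (Vec n)).comp (ContinuousLinearMap.coeLM ℝ))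

theorem traceCLM_apply (A : Vec n →L[ℝ] Vec n) : traceCLM n A = ∑ a, (A (basisVec a)) a := by
  change LinearMap.trace ℝ (Vec n) (A : Vec n →ₗ[ℝ] Vec n) = _
  rw [LinearMap.trace_eq_matrix_trace ℝ (EuclideanSpace.basisFun (Fin n) ℝ).toBasis]
  simp [Matrix.trace, LinearMap.toMatrix_apply, basisVec]

/-- The derivative of the determinant at the identity is the trace. -/
theorem hasFDerivAt_det_one : HasFDerivAt (fun A : Vec n →L[ℝ] Vec n => A.det) (traceCLM n) 1 := by
  set b := (EuclideanSpace.basisFun (Fin n) ℝ).toBasis with hb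
  have hdet : ∀ A : Vec n →L[ℝ] Vec n, A.det =
      (LinearMap.toMatrix b b (A : Vec n →ₗ[ℝ] Vec n)).det := fun A =>
    (LinearMap.det_toMatrix b _).symm
  have hd : DifferentiableAt ℝ (fun A : Vec n →L[ℝ] Vec n => A.det) 1 := by
    simp only [hdet, Matrix.det_apply, LinearMap.toMatrix_apply]
    refine (ContDiff.differentiable (n := 1) ?_ one_ne_zero) 1
    refine ContDiff.sum fun σ _ => ContDiff.const_smul _ (contDiff_prod fun i _ => ?_)
    have : (fun A : Vec n →L[ℝ] Vec n => (b.repr ((A : Vec n →ₗ[ℝ] Vec n) (b i))) (σ i)) =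
        fun A : Vec n →L[ℝ] Vec n => (A (b i)) (σ i) := by
      ext A; simp [hb]
    rw [this]
    fun_prop
  refine hd.hasFDerivAt.congr_fderiv ?_
  ext A
  have h1 : HasDerivAt (fun t : ℝ => (1 + t • A).det)
      (fderiv ℝ (fun A : Vec n →L[ℝ] Vec n => A.det) 1 A) 0 := by
    have h2 : HasDerivAt (fun t : ℝ => 1 + t • A) A 0 := by
      simpa using ((hasDerivAt_id (0 : ℝ)).smul_const A).const_add 1
    have h3 : HasFDerivAt (fun A : Vec n →L[ℝ] Vec n => A.det)
        (fderiv ℝ (fun A : Vec n →L[ℝ] Vec n => A.det) 1) (1 + (0 : ℝ) • A) := by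
      have h0 : (1 + (0 : ℝ) • A : Vec n →L[ℝ] Vec n) = 1 := by ext x; simp
      rw [h0]; exact hd.hasFDerivAt
    exact h3.comp_hasDerivAt (0 : ℝ) h2
  set M := LinearMap.toMatrix b b (A : Vec n →ₗ[ℝ] Vec n) with hM
  have h4 : ∀ t : ℝ, (1 + t • A).det = (1 + t • M).det := fun t => by
    rw [hdet]
    congr 1
    simp [hM, map_add, map_smul]
  have h5 : HasDerivAt (fun t : ℝ => (1 + t • A).det) (M.trace) 0 := by
    have hp : HasDerivAt (fun t : ℝ => 1 + M.trace * t) M.trace 0 := by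
      simpa using ((hasDerivAt_id (0 : ℝ)).const_mul M.trace).const_add 1
    set P := Polynomial.divX (Polynomial.divX
      (1 + (Polynomial.X : Polynomial ℝ) • M.map Polynomial.C).det) with hP
    have hq : HasDerivAt (fun t : ℝ => P.eval t * t ^ 2) 0 0 :=
      ((P.hasDerivAt 0).fun_mul (hasDerivAt_pow 2 0)).congr_deriv (by simp)
    have hpq : (fun t : ℝ => (1 + t • A).det) = fun t => 1 + M.trace * t + P.eval t * t ^ 2 :=
      funext fun t => by rw [h4, Matrix.det_one_add_smul]
    rw [hpq]
    exact (hp.fun_add hq).congr_deriv (by simp)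
  rw [h1.unique h5]
  change _ = LinearMap.trace ℝ (Vec n) (A : Vec n →ₗ[ℝ] Vec n)
  rw [LinearMap.trace_eq_matrix_trace ℝ b]

/-- The determinant near the identity, bounded below by its linearization. -/
theorem exists_le_det_of_near_one {ε : ℝ} (hε : 0 < ε) :
    ∃ c > 0, ∀ B : Vec n →L[ℝ] Vec n, ‖B - 1‖ ≤ c →
      1 + traceCLM n (B - 1) - ε * ‖B - 1‖ ≤ B.det := by
  have h := (hasFDerivAt_iff_isLittleO.1 (hasFDerivAt_det_one (n := n))).def hε
  obtain ⟨c, hc, hball⟩ := Metric.eventually_nhds_iff.1 h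
  refine ⟨c / 2, by positivity, fun B hB => ?_⟩
  have h1 := hball (y := B) (by rw [dist_eq_norm]; linarith)
  have h2 : (1 : Vec n →L[ℝ] Vec n).det = 1 := by
    simp [ContinuousLinearMap.det]
  rw [h2, Real.norm_eq_abs] at h1
  linarith [(abs_le.1 h1).1]

/-- Over short times the flow is close to the identity: trajectories move at bounded speed and the
displacement `Φ s t - id` has small Lipschitz constant. -/
theorem IsFlow.exists_shortTime {Φ : ℝ → ℝ → Vec n → Vec n} (hΦ : IsFlow X v Φ)
    (hv : RegField X v) {K : Set (Vec n)} (hK : IsCompact K) (hKX : K ⊆ X) (T : ℝ) :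
    ∃ η > 0, ∃ δ > 0, ∃ C > 0, Metric.cthickening η K ⊆ X ∧ C * δ ≤ 1 / 4 ∧ C * δ ≤ η / 4 ∧
      ∀ s t, 0 ≤ s → s ≤ t → t ≤ T → t - s ≤ δ →
        (∀ x ∈ Metric.cthickening η K, ‖Φ s t x - x‖ ≤ C * (t - s)) ∧
        ∀ x ∈ Metric.cthickening η K, ∀ y ∈ Metric.cthickening η K, ‖y - x‖ ≤ η →
          ‖Φ s t y - Φ s t x - (y - x)‖ ≤ 2 * C * (t - s) * ‖y - x‖ := by
  obtain ⟨η₀, hη₀, hsub, hcomp⟩ := exists_cthickening_subset hv.isOpen hK hKX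
  obtain ⟨η₁, hη₁, L, hL, -, hlip⟩ := hv.lip hcomp hsub T
  obtain ⟨δ₀, hδ₀, C₀, hC₀, hsp⟩ := hv.exists_speed hcomp hsub T
  set C := max L C₀ with hC
  have hCpos : 0 < C := lt_max_of_lt_left hL
  set η := min η₀ (η₁ / 2) with hη
  have hηpos : 0 < η := by positivity
  set δ := min δ₀ (min (1 / (4 * C)) (η / (4 * C))) with hδ
  have hδpos : 0 < δ := by positivity
  have hCδ1 : C * δ ≤ 1 / 4 := by
    calc C * δ ≤ C * (1 / (4 * C)) := by
          gcongr; exact (min_le_right _ _).trans (min_le_left _ _)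
      _ = 1 / 4 := by field_simp
  have hCδ2 : C * δ ≤ η / 4 := by
    calc C * δ ≤ C * (η / (4 * C)) := by
          gcongr; exact (min_le_right _ _).trans (min_le_right _ _)
      _ = η / 4 := by field_simp
  have hKη : Metric.cthickening η K ⊆ Metric.cthickening η₀ K :=
    Metric.cthickening_mono (min_le_left _ _) K
  have hspeed : ∀ s t, 0 ≤ s → s ≤ t → t ≤ T → t - s ≤ δ → ∀ x ∈ Metric.cthickening η K,
      ‖Φ s t x - x‖ ≤ C * (t - s) := by
    intro s t hs hst ht hts x hx
    have hxX := hsub (hKη hx)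
    have := hsp s t hs ht (hts.trans (min_le_left _ _)) _ (hΦ.isSol hs hst hxX)
      (by rw [hΦ.self hs hxX]; exact hKη hx) t ⟨hst, le_rfl⟩
    rw [hΦ.self hs hxX] at this
    refine this.trans (mul_le_mul_of_nonneg_right (le_max_right _ _) (sub_nonneg.2 hst))
  refine ⟨η, hηpos, δ, hδpos, C, hCpos, hKη.trans hsub, hCδ1, hCδ2, fun s t hs hst ht hts =>
    ⟨hspeed s t hs hst ht hts, fun x hx y hy hxy => ?_⟩⟩
  have hxX := hsub (hKη hx)
  have hyX := hsub (hKη hy)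
  have hsx := hΦ.isSol hs hst hxX
  have hsy := hΦ.isSol hs hst hyX
  have hηη₁ : η ≤ η₁ / 2 := min_le_right _ _
  have hmove : ∀ r ∈ Icc s t, ∀ p ∈ Metric.cthickening η K, ‖Φ s r p - p‖ ≤ η / 4 := by
    intro r hr p hp
    refine (hspeed s r hs hr.1 (hr.2.trans ht) (by linarith [hr.2]) p hp).trans
      (le_trans ?_ hCδ2)
    gcongr; linarith [hr.2]
  have hdiff : ∀ r ∈ Icc s t, ‖v (Φ s r y) r - v (Φ s r x) r‖ ≤ C * ‖Φ s r y - Φ s r x‖ := by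
    intro r hr
    have h1 : Φ s r x ∈ Metric.closedBall x η₁ := by
      rw [Metric.mem_closedBall, dist_eq_norm]
      linarith [hmove r hr x hx]
    have h2 : Φ s r y ∈ Metric.closedBall x η₁ := by
      rw [Metric.mem_closedBall, dist_eq_norm]
      calc ‖Φ s r y - x‖ = ‖(Φ s r y - y) + (y - x)‖ := by congr 1; abel
        _ ≤ η / 4 + η := (norm_add_le _ _).trans (add_le_add (hmove r hr y hy) hxy)
        _ ≤ η₁ := by linarith
    refine ((hlip x (hKη hx) _ h2 r ⟨hs.trans hr.1, hr.2.trans ht⟩).2.2 _ h1).trans ?_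
    gcongr; exact le_max_left _ _
  have hint : ∀ r ∈ Icc s t, Φ s r y - Φ s r x - (y - x) =
      ∫ q in s..r, (v (Φ s q y) q - v (Φ s q x) q) := by
    intro r hr
    have hsI : s ∈ Icc s t := ⟨le_rfl, hst⟩
    rw [intervalIntegral.integral_sub (hsy.intervalIntegrable hsI hr)
      (hsx.intervalIntegrable hsI hr), ← hsy.sub_eq hsI hr, ← hsx.sub_eq hsI hr, hΦ.self hs hxX,
      hΦ.self hs hyX]
    abel
  have hcont : ContinuousOn (fun r => ‖Φ s r y - Φ s r x‖) (Icc s t) :=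
    (hsy.cont.sub hsx.cont).norm
  have hgron : ∀ r ∈ Icc s t, ‖Φ s r y - Φ s r x‖ ≤ 2 * ‖y - x‖ := by
    intro r hr
    have h3 := le_mul_exp_of_le_integral (g := fun r => ‖Φ s r y - Φ s r x‖) (c₀ := ‖y - x‖)
      hCpos.le hr.1 (hcont.mono (Icc_subset_Icc_right hr.2)) fun q hq => by
        have hqI : q ∈ Icc s t := ⟨hq.1, hq.2.trans hr.2⟩
        have h4 : ‖∫ p in s..q, (v (Φ s p y) p - v (Φ s p x) p)‖ ≤
            ∫ p in s..q, C * ‖Φ s p y - Φ s p x‖ := by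
          refine intervalIntegral.norm_integral_le_of_norm_le hq.1 (Eventually.of_forall
            fun p hp => hdiff p ⟨hp.1.le, hp.2.trans hqI.2⟩) ?_
          refine ContinuousOn.intervalIntegrable ?_
          rw [uIcc_of_le hq.1]
          exact continuousOn_const.mul (hcont.mono (Icc_subset_Icc_right hqI.2))
        rw [intervalIntegral.integral_const_mul, ← hint q hqI] at h4
        calc ‖Φ s q y - Φ s q x‖ = ‖(y - x) + (Φ s q y - Φ s q x - (y - x))‖ := by congr 1; abel
          _ ≤ _ := (norm_add_le _ _).trans (by gcongr)
    refine h3.trans ?_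
    rw [mul_comm]
    gcongr
    have h5 : C * (r - s) ≤ 1 / 4 := le_trans (by gcongr; linarith [hr.2]) hCδ1
    have h6 : Real.exp (C * (r - s)) ≤ Real.exp (1 / 4) := by gcongr
    have h7 : Real.exp (1 / 4 : ℝ) ≤ 1 / (1 - 1 / 4) :=
      Real.exp_bound_div_one_sub_of_interval (by norm_num) (by norm_num)
    linarith
  rw [hint t ⟨hst, le_rfl⟩]
  have h8 := intervalIntegral.norm_integral_le_of_norm_le_const (a := s) (b := t)
    (f := fun q => v (Φ s q y) q - v (Φ s q x) q) (C := C * (2 * ‖y - x‖)) fun q hq => by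
      rw [uIoc_of_le hst] at hq
      have hqI := Ioc_subset_Icc_self hq
      exact (hdiff q hqI).trans (by gcongr; exact hgron q hqI)
  rw [abs_of_nonneg (sub_nonneg.2 hst)] at h8
  exact h8.trans (le_of_eq (by ring))

theorem RegField.measurable_section (hv : RegField X v) {x : Vec n} (hx : x ∈ X) {s t : ℝ}
    (hs : 0 ≤ s) : AEStronglyMeasurable (fun r => v x r) (volume.restrict (Ioc s t)) := by
  have h1 := hv.meas.comp (measurable_prodMk_left (x := x))
  refine AEStronglyMeasurable.congr h1.aestronglyMeasurable ?_
  rw [EventuallyEq, ae_restrict_iff' measurableSet_Ioc]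
  exact Eventually.of_forall fun r hr =>
    indicator_of_mem (show (x, r) ∈ X ×ˢ Ici (0 : ℝ) from ⟨hx, hs.trans hr.1.le⟩) _

theorem RegField.measurable_section_fderiv (hv : RegField X v) {x : Vec n} (hx : x ∈ X) {s t : ℝ}
    (hs : 0 ≤ s) : AEStronglyMeasurable (fun r => fderiv ℝ (fun y => v y r) x)
      (volume.restrict (Ioc s t)) := by
  have h1 := hv.meas_fderiv.comp (measurable_prodMk_left (x := x))
  refine AEStronglyMeasurable.congr h1.aestronglyMeasurable ?_
  rw [EventuallyEq, ae_restrict_iff' measurableSet_Ioc]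
  exact Eventually.of_forall fun r hr =>
    indicator_of_mem (show (x, r) ∈ X ×ˢ Ici (0 : ℝ) from ⟨hx, hs.trans hr.1.le⟩) _

theorem intervalIntegrable_of_bound {E : Type*} [NormedAddCommGroup E] {f : ℝ → E} {s t C : ℝ}
    (hst : s ≤ t) (hm : AEStronglyMeasurable f (volume.restrict (Ioc s t)))
    (hC : ∀ r ∈ Ioc s t, ‖f r‖ ≤ C) : IntervalIntegrable f volume s t := by
  rw [intervalIntegrable_iff_integrableOn_Ioc_of_le hst]
  refine Integrable.of_bound hm C ?_
  rw [ae_restrict_iff' measurableSet_Ioc]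
  exact Eventually.of_forall hC

theorem RegField.intervalIntegrable (hv : RegField X v) {x : Vec n} (hx : x ∈ X) {s t : ℝ}
    (hs : 0 ≤ s) (hst : s ≤ t) : IntervalIntegrable (fun r => v x r) volume s t := by
  obtain ⟨C, hC⟩ := hv.bdd {x} isCompact_singleton (singleton_subset_iff.2 hx) t
  exact intervalIntegrable_of_bound hst (hv.measurable_section hx hs)
    fun r hr => (hC x rfl r ⟨hs.trans hr.1.le, hr.2⟩).1

theorem RegField.intervalIntegrable_fderiv (hv : RegField X v) {x : Vec n} (hx : x ∈ X)
    {s t : ℝ} (hs : 0 ≤ s) (hst : s ≤ t) :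
    IntervalIntegrable (fun r => fderiv ℝ (fun y => v y r) x) volume s t := by
  obtain ⟨C, hC⟩ := hv.bdd {x} isCompact_singleton (singleton_subset_iff.2 hx) t
  exact intervalIntegrable_of_bound hst (hv.measurable_section_fderiv hx hs)
    fun r hr => (hC x rfl r ⟨hs.trans hr.1.le, hr.2⟩).2

/-- Wherever the flow map over a short time is differentiable, its derivative is the identity plus
the integrated derivative of the field, to first order and uniformly on compact sets. -/
theorem IsFlow.exists_fderiv_le {Φ : ℝ → ℝ → Vec n → Vec n} (hΦ : IsFlow X v Φ)
    (hv : RegField X v) {K : Set (Vec n)} (hK : IsCompact K) (hKX : K ⊆ X) (T : ℝ) {ε : ℝ}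
    (hε : 0 < ε) : ∃ δ > 0, ∀ s t, 0 ≤ s → s ≤ t → t ≤ T → t - s ≤ δ → ∀ x ∈ K, ∀ B,
      HasFDerivAt (Φ s t) B x →
        ‖B - 1 - ∫ r in s..t, fderiv ℝ (fun y => v y r) x‖ ≤ ε * (t - s) := by
  obtain ⟨η, hη, δ, hδ, C, hC, hsub, hCδ1, -, hshort⟩ := hΦ.exists_shortTime hv hK hKX T
  obtain ⟨η', hη', -, htay⟩ := hv.taylor hK hKX T (ε := ε / 4) (by positivity)
  obtain ⟨D, hD⟩ := hv.bdd K hK hKX T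
  set D' := max D 1 with hD'
  have hD'pos : 0 < D' := lt_max_of_lt_right one_pos
  refine ⟨min δ (min (η' / (2 * C)) (ε / (4 * C * D'))), by positivity,
    fun s t hs hst ht hts x hx B hB => ?_⟩
  simp only [le_min_iff] at hts
  have hxK : ∀ y ∈ Metric.closedBall x η, y ∈ Metric.cthickening η K := fun y hy =>
    closedBall_subset_cthickening' hx le_rfl hy
  have hxx := hxK x (Metric.mem_closedBall_self hη.le)
  set A := ∫ r in s..t, fderiv ℝ (fun y => v y r) x with hA
  have hAi := hv.intervalIntegrable_fderiv (hKX hx) hs hst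
  have hfd : HasFDerivAt (fun y => Φ s t y - y - A y) (B - 1 - A) x :=
    (hB.sub (hasFDerivAt_id x)).sub A.hasFDerivAt
  refine hfd.le_of_lip' (mul_nonneg hε.le (sub_nonneg.2 hst)) ?_
  filter_upwards [Metric.closedBall_mem_nhds x (lt_min hη (half_pos hη'))] with y hy
  rw [Metric.mem_closedBall, dist_eq_norm, le_min_iff] at hy
  have hyK := hxK y (by rw [Metric.mem_closedBall, dist_eq_norm]; exact hy.1)
  have hsx := hΦ.isSol hs hst (hsub hxx)
  have hsy := hΦ.isSol hs hst (hsub hyK)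
  have hsI : s ∈ Icc s t := ⟨le_rfl, hst⟩
  have htI : t ∈ Icc s t := ⟨hst, le_rfl⟩
  have hApp : A (y - x) = ∫ r in s..t, fderiv ℝ (fun y => v y r) x (y - x) := by
    rw [hA, ContinuousLinearMap.intervalIntegral_apply hAi]
  have hAi' : IntervalIntegrable (fun r => fderiv ℝ (fun y => v y r) x (y - x)) volume s t :=
    ⟨(ContinuousLinearMap.apply ℝ (Vec n) (y - x)).integrable_comp hAi.1,
      (ContinuousLinearMap.apply ℝ (Vec n) (y - x)).integrable_comp hAi.2⟩
  have heq : Φ s t y - y - A y - (Φ s t x - x - A x) =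
      ∫ r in s..t, (v (Φ s r y) r - v (Φ s r x) r - fderiv ℝ (fun y => v y r) x (y - x)) := by
    rw [intervalIntegral.integral_sub ((hsy.intervalIntegrable hsI htI).sub
      (hsx.intervalIntegrable hsI htI)) hAi', ← hApp, intervalIntegral.integral_sub
      (hsy.intervalIntegrable hsI htI) (hsx.intervalIntegrable hsI htI),
      ← hsy.sub_eq hsI htI, ← hsx.sub_eq hsI htI, hΦ.self hs (hsub hxx), hΦ.self hs (hsub hyK),
      map_sub]
    abel
  rw [heq]
  have hbound := intervalIntegral.norm_integral_le_of_norm_le_const (a := s) (b := t)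
    (f := fun r => v (Φ s r y) r - v (Φ s r x) r - fderiv ℝ (fun y => v y r) x (y - x))
    (C := ε * ‖y - x‖) fun r hr => by
      rw [uIoc_of_le hst] at hr
      have hrI := Ioc_subset_Icc_self hr
      have hrs : r - s ≤ t - s := by linarith [hr.2]
      have hrs0 : 0 ≤ r - s := sub_nonneg.2 hrI.1
      obtain ⟨h1, h2⟩ := hshort s r hs hrI.1 (hrI.2.trans ht) (hrs.trans hts.1)
      have h3 := h2 x hxx y hyK hy.1
      have hCη : C * (r - s) ≤ η' / 2 := by
        calc C * (r - s) ≤ C * (η' / (2 * C)) := by gcongr; exact hrs.trans hts.2.1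
          _ = η' / 2 := by field_simp
      have hmx : Φ s r x ∈ Metric.closedBall x η' := by
        rw [Metric.mem_closedBall, dist_eq_norm]
        linarith [h1 x hxx]
      have hmy : Φ s r y ∈ Metric.closedBall x η' := by
        rw [Metric.mem_closedBall, dist_eq_norm]
        calc ‖Φ s r y - x‖ = ‖(Φ s r y - y) + (y - x)‖ := by congr 1; abel
          _ ≤ C * (r - s) + η' / 2 := (norm_add_le _ _).trans (add_le_add (h1 y hyK) hy.2)
          _ ≤ η' := by linarith
      have h4 := htay x hx _ hmy _ hmx r ⟨hs.trans hrI.1, hrI.2.trans ht⟩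
      have h5 : ‖Φ s r y - Φ s r x‖ ≤ 2 * ‖y - x‖ := by
        have h6 : 2 * C * (r - s) * ‖y - x‖ ≤ 1 * ‖y - x‖ := by
          gcongr
          have : C * (r - s) ≤ C * δ := by gcongr; exact hrs.trans hts.1
          linarith
        calc ‖Φ s r y - Φ s r x‖ = ‖(Φ s r y - Φ s r x - (y - x)) + (y - x)‖ := by congr 1; abel
          _ ≤ _ := (norm_add_le _ _).trans (by linarith)
      have h7 : ‖fderiv ℝ (fun y => v y r) x (Φ s r y - Φ s r x - (y - x))‖ ≤
          D' * (2 * C * (r - s) * ‖y - x‖) := by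
        refine (ContinuousLinearMap.le_opNorm _ _).trans ?_
        gcongr
        exact ((hD x hx r ⟨hs.trans hrI.1, hrI.2.trans ht⟩).2).trans (le_max_left _ _)
      have h8 : D' * (2 * C * (r - s) * ‖y - x‖) ≤ ε / 2 * ‖y - x‖ := by
        calc D' * (2 * C * (r - s) * ‖y - x‖) ≤
            D' * (2 * C * (ε / (4 * C * D')) * ‖y - x‖) := by gcongr; exact hrs.trans hts.2.2
          _ = ε / 2 * ‖y - x‖ := by field_simp; ring
      calc ‖v (Φ s r y) r - v (Φ s r x) r - fderiv ℝ (fun y => v y r) x (y - x)‖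
          = ‖(v (Φ s r y) r - v (Φ s r x) r -
              fderiv ℝ (fun y => v y r) x (Φ s r y - Φ s r x)) +
              fderiv ℝ (fun y => v y r) x (Φ s r y - Φ s r x - (y - x))‖ := by
            congr 1; rw [map_sub _ (Φ s r y - Φ s r x)]; abel
        _ ≤ ε / 4 * ‖Φ s r y - Φ s r x‖ + ε / 2 * ‖y - x‖ :=
            (norm_add_le _ _).trans (add_le_add h4 (h7.trans h8))
        _ ≤ ε / 4 * (2 * ‖y - x‖) + ε / 2 * ‖y - x‖ := by gcongr
        _ = ε * ‖y - x‖ := by ring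
  rw [abs_of_nonneg (sub_nonneg.2 hst)] at hbound
  exact hbound.trans (le_of_eq (by ring))

/-- Liouville's formula as a one-sided first-order estimate: the Jacobian determinant of the flow
over a short time is at least one plus the integrated divergence, up to a small error. -/
theorem IsFlow.exists_le_det {Φ : ℝ → ℝ → Vec n → Vec n} (hΦ : IsFlow X v Φ)
    (hv : RegField X v) {K : Set (Vec n)} (hK : IsCompact K) (hKX : K ⊆ X) (T : ℝ) {ε : ℝ}
    (hε : 0 < ε) : ∃ δ > 0, ∀ s t, 0 ≤ s → s ≤ t → t ≤ T → t - s ≤ δ → ∀ x ∈ K, ∀ B,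
      HasFDerivAt (Φ s t) B x →
        1 + traceCLM n (∫ r in s..t, fderiv ℝ (fun y => v y r) x) - ε * (t - s) ≤ B.det := by
  obtain ⟨D, hD⟩ := hv.bdd K hK hKX T
  set D' := max D 1 with hD'
  have hD'pos : 0 < D' := lt_max_of_lt_right one_pos
  set τ := ‖traceCLM n‖ with hτ
  have hτ0 : 0 ≤ τ := by positivity
  obtain ⟨c, hc, hdet⟩ := exists_le_det_of_near_one (n := n) (ε := ε / (2 * (D' + 1)))
    (by positivity)
  set ε₁ := min 1 (ε / (2 * (τ + 1))) with hε₁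
  have hε₁pos : 0 < ε₁ := by positivity
  obtain ⟨δ, hδ, h⟩ := hΦ.exists_fderiv_le hv hK hKX T hε₁pos
  refine ⟨min δ (c / (D' + 1)), by positivity, fun s t hs hst ht hts x hx B hB => ?_⟩
  simp only [le_min_iff] at hts
  have hts0 : 0 ≤ t - s := sub_nonneg.2 hst
  have h1 := h s t hs hst ht hts.1 x hx B hB
  set A := ∫ r in s..t, fderiv ℝ (fun y => v y r) x with hA
  have h2 : ‖A‖ ≤ D' * (t - s) := by
    have := intervalIntegral.norm_integral_le_of_norm_le_const (a := s) (b := t)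
      (f := fun r => fderiv ℝ (fun y => v y r) x) (C := D') fun r hr => by
        rw [uIoc_of_le hst] at hr
        exact ((hD x hx r ⟨hs.trans hr.1.le, hr.2.trans ht⟩).2).trans (le_max_left _ _)
    rwa [abs_of_nonneg hts0] at this
  have h3 : ‖B - 1‖ ≤ (D' + 1) * (t - s) := by
    calc ‖B - 1‖ = ‖(B - 1 - A) + A‖ := by congr 1; abel
      _ ≤ ε₁ * (t - s) + D' * (t - s) := (norm_add_le _ _).trans (add_le_add h1 h2)
      _ ≤ 1 * (t - s) + D' * (t - s) := by gcongr; exact min_le_left _ _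
      _ = _ := by ring
  have h4 := hdet B (h3.trans (by
    calc (D' + 1) * (t - s) ≤ (D' + 1) * (c / (D' + 1)) := by gcongr; exact hts.2
      _ = c := by field_simp))
  have h5 : ε / (2 * (D' + 1)) * ‖B - 1‖ ≤ ε / 2 * (t - s) := by
    calc ε / (2 * (D' + 1)) * ‖B - 1‖ ≤ ε / (2 * (D' + 1)) * ((D' + 1) * (t - s)) := by gcongr
      _ = _ := by field_simp
  have h6 : |traceCLM n (B - 1 - A)| ≤ ε / 2 * (t - s) := by
    calc |traceCLM n (B - 1 - A)| ≤ τ * ‖B - 1 - A‖ := (traceCLM n).le_opNorm _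
      _ ≤ (τ + 1) * (ε / (2 * (τ + 1)) * (t - s)) := by
          gcongr
          · linarith
          · exact h1.trans (by gcongr; exact min_le_right _ _)
      _ = _ := by field_simp
  rw [map_sub] at h6
  linarith [(abs_le.1 h6).1]

/-! ### Transport of densities by the flow -/

/-- A time-dependent function which is `C¹` in space on the open set `X`, with values and spatial
derivative jointly continuous on `X × [0, ∞)`. -/
structure ContC1 {G : Type*} [NormedAddCommGroup G] [NormedSpace ℝ G] (X : Set (Vec n))
    (h : Vec n → ℝ → G) : Prop where
  diff : ∀ t, 0 ≤ t → ∀ x ∈ X, DifferentiableAt ℝ (fun y => h y t) x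
  cont : ContinuousOn (fun z : Vec n × ℝ => h z.1 z.2) (X ×ˢ Ici 0)
  cont_fderiv : ContinuousOn (fun z : Vec n × ℝ => fderiv ℝ (fun y => h y z.2) z.1) (X ×ˢ Ici 0)

/-- A nonnegative time-dependent density on `X` which is `C¹` in space, jointly continuously. -/
structure RegDensity (X : Set (Vec n)) (ρ : Vec n → ℝ → ℝ) : Prop extends ContC1 X ρ where
  nonneg : ∀ x ∈ X, ∀ t, 0 ≤ t → 0 ≤ ρ x t

/-- The spatial divergence of `ρ v`. -/
noncomputable def divFlux (ρ : Vec n → ℝ → ℝ) (v : Vec n → ℝ → Vec n) (x : Vec n) (t : ℝ) : ℝ :=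
  ρ x t * traceCLM n (fderiv ℝ (fun y => v y t) x) + fderiv ℝ (fun y => ρ y t) x (v x t)

/-- The density `ρ` solves the continuity equation `∂ₜ ρ + ∇ · (ρ v) = 0`, integrated in time and
almost everywhere in space. -/
def SolvesContinuity (X : Set (Vec n)) (ρ : Vec n → ℝ → ℝ) (v : Vec n → ℝ → Vec n) : Prop :=
  ∀ s t, 0 ≤ s → s ≤ t → ∀ᵐ x ∂(volume.restrict X),
    ρ x t - ρ x s = -∫ r in s..t, divFlux ρ v x r

/-- A continuous function on `X × [0, ∞)` is bounded and uniformly continuous on compact sets. -/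
theorem exists_bound_modulus {E : Type*} [NormedAddCommGroup E] {f : Vec n × ℝ → E}
    (hf : ContinuousOn f (X ×ˢ Ici 0)) {K : Set (Vec n)} (hK : IsCompact K) (hKX : K ⊆ X)
    (T : ℝ) : (∃ C, ∀ x ∈ K, ∀ t ∈ Icc 0 T, ‖f (x, t)‖ ≤ C) ∧
      ∀ ε > 0, ∃ γ > 0, ∀ x ∈ K, ∀ y ∈ K, ∀ s ∈ Icc 0 T, ∀ t ∈ Icc 0 T,
        ‖x - y‖ ≤ γ → |s - t| ≤ γ → ‖f (x, s) - f (y, t)‖ ≤ ε := by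
  have hsub : K ×ˢ Icc 0 T ⊆ X ×ˢ Ici 0 := prod_mono hKX Icc_subset_Ici_self
  have hcomp : IsCompact (K ×ˢ Icc 0 T) := hK.prod isCompact_Icc
  have hc := hf.mono hsub
  refine ⟨?_, fun ε hε => ?_⟩
  · obtain ⟨C, hC⟩ := hcomp.exists_bound_of_continuousOn hc
    exact ⟨C, fun x hx t ht => hC (x, t) ⟨hx, ht⟩⟩
  · obtain ⟨γ, hγ, h⟩ := Metric.uniformContinuousOn_iff.1
      (hcomp.uniformContinuousOn_of_continuous hc) ε hε
    refine ⟨γ / 2, half_pos hγ, fun x hx y hy s hs t ht hxy hst => ?_⟩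
    rw [← dist_eq_norm]
    refine (h (x, s) ⟨hx, hs⟩ (y, t) ⟨hy, ht⟩ ?_).le
    rw [Prod.dist_eq, max_lt_iff]
    simp only
    rw [dist_eq_norm, Real.dist_eq]
    constructor <;> linarith

set_option maxHeartbeats 1000000 in
/-- The infinitesimal form of the conservation of mass: `ρ(Φ x, t) det DΦ(x) ≥ ρ(x, s)` up to an
error which is small compared to `t - s`. -/
theorem IsFlow.exists_density_le {Φ : ℝ → ℝ → Vec n → Vec n} (hΦ : IsFlow X v Φ)
    (hv : RegField X v) {ρ : Vec n → ℝ → ℝ} (hρ : RegDensity X ρ) {K : Set (Vec n)}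
    (hK : IsCompact K) (hKX : K ⊆ X) (T : ℝ) {ε : ℝ} (hε : 0 < ε) :
    ∃ δ > 0, ∀ s t, 0 ≤ s → s ≤ t → t ≤ T → t - s ≤ δ → ∀ x ∈ K, ∀ B,
      HasFDerivAt (Φ s t) B x → ρ x t - ρ x s = -∫ r in s..t, divFlux ρ v x r →
        ρ x s ≤ ρ (Φ s t x) t * B.det + ε * (t - s) := by
  obtain ⟨η, hη, hsub, hcomp⟩ := exists_cthickening_subset hv.isOpen hK hKX
  obtain ⟨η', hη', L, hL, -, hlip⟩ := hv.lip hK hKX T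
  obtain ⟨δs, hδs, C, hC, hsp⟩ := hv.exists_speed hK hKX T
  obtain ⟨⟨C₁, hC₁⟩, hρmod⟩ := exists_bound_modulus hρ.cont hcomp hsub T
  obtain ⟨⟨C₂, hC₂⟩, hDmod⟩ := exists_bound_modulus hρ.cont_fderiv hcomp hsub T
  have hKη : K ⊆ Metric.cthickening η K := Metric.self_subset_cthickening K
  -- one constant `N` for all bounds
  set N := 1 + L + C + |C₁| + |C₂| + ‖traceCLM n‖ * L with hN
  have hτL : 0 ≤ ‖traceCLM n‖ * L := by positivity
  have hN1 : 1 ≤ N := by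
    have := abs_nonneg C₁; have := abs_nonneg C₂; linarith
  have hNL : L ≤ N := by
    have := abs_nonneg C₁; have := abs_nonneg C₂; linarith
  have hNC : C ≤ N := by
    have := abs_nonneg C₁; have := abs_nonneg C₂; linarith
  have hNC₁ : C₁ ≤ N := by
    have := le_abs_self C₁; have := abs_nonneg C₂; linarith
  have hNC₂ : C₂ ≤ N := by
    have := le_abs_self C₂; have := abs_nonneg C₁; linarith
  have hNτ : ‖traceCLM n‖ * L ≤ N := by
    have := abs_nonneg C₁; have := abs_nonneg C₂; linarith
  have hNpos : 0 < N := by linarith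
  -- the error terms below add up to at most `6 * N * ε₁ * (t - s)`
  set ε₁ := min 1 (ε / (6 * N)) with hε₁
  have hε₁pos : 0 < ε₁ := by positivity
  have hε₁1 : ε₁ ≤ 1 := min_le_left _ _
  obtain ⟨δd, hδd, hdet⟩ := hΦ.exists_le_det hv hK hKX T hε₁pos
  obtain ⟨γ₁, hγ₁, hγ₁'⟩ := hρmod ε₁ hε₁pos
  obtain ⟨γ₂, hγ₂, hγ₂'⟩ := hDmod ε₁ hε₁pos
  set m := min (min η η') (min γ₁ γ₂) with hm
  have hmpos : 0 < m := by positivity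
  refine ⟨min (min δs δd) (min (min (ε₁ / (2 * N ^ 3)) (m / N)) m), by positivity,
    fun s t hs hst ht hts x hx B hB hFP => ?_⟩
  simp only [le_min_iff] at hts
  obtain ⟨⟨hts1, hts2⟩, ⟨hts3, hts4⟩, hts5⟩ := hts
  set τ := t - s with hτ
  have hτ0 : 0 ≤ τ := sub_nonneg.2 hst
  have ht0 : 0 ≤ t := hs.trans hst
  have htI : t ∈ Icc 0 T := ⟨ht0, ht⟩
  have hrI : ∀ r ∈ Icc s t, r ∈ Icc 0 T := fun r hr => ⟨hs.trans hr.1, hr.2.trans ht⟩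
  have hxX := hKX hx
  have hNτm : N * τ ≤ m := by
    calc N * τ ≤ N * (m / N) := by gcongr
      _ = m := by field_simp
  have hN3 : 2 * N ^ 3 * τ ≤ ε₁ := by
    calc 2 * N ^ 3 * τ ≤ 2 * N ^ 3 * (ε₁ / (2 * N ^ 3)) := by gcongr
      _ = ε₁ := by field_simp
  have hNpow : N ^ 2 ≤ 2 * N ^ 3 := by
    have := mul_nonneg (sq_nonneg N) (show 0 ≤ 2 * N - 1 by linarith)
    linarith
  have hmη : m ≤ η := (min_le_left _ _).trans (min_le_left _ _)
  have hmη' : m ≤ η' := (min_le_left _ _).trans (min_le_right _ _)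
  have hmγ₁ : m ≤ γ₁ := (min_le_right _ _).trans (min_le_left _ _)
  have hmγ₂ : m ≤ γ₂ := (min_le_right _ _).trans (min_le_right _ _)
  have hsol := hΦ.isSol hs hst hxX
  have hself := hΦ.self hs hxX
  have hmove : ∀ r ∈ Icc s t, ‖Φ s r x - x‖ ≤ N * τ := by
    intro r hr
    have h1 := hsp s t hs ht hts1 _ hsol (by rw [hself]; exact hx) r hr
    rw [hself] at h1
    refine h1.trans ?_
    have : 0 ≤ r - s := sub_nonneg.2 hr.1
    gcongr
    linarith [hr.2]
  have htt : t ∈ Icc s t := ⟨hst, le_rfl⟩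
  have hss : s ∈ Icc s t := ⟨le_rfl, hst⟩
  set Ψ := Φ s t x with hΨ
  set A := ∫ r in s..t, fderiv ℝ (fun y => v y r) x with hA
  set b := ∫ r in s..t, v x r with hb
  set R := ρ x t with hR
  set g := fderiv ℝ (fun y => ρ y t) x with hg
  have hxη : x ∈ Metric.cthickening η K := hKη hx
  have hRN : |R| ≤ N := (hC₁ x hxη t htI).trans hNC₁
  have hgN : ‖g‖ ≤ N := (hC₂ x hxη t htI).trans hNC₂
  have hvN : ∀ r ∈ Icc s t, ‖v x r‖ ≤ N ∧ ‖fderiv ℝ (fun y => v y r) x‖ ≤ L := fun r hr =>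
    have h := hlip x hx x (Metric.mem_closedBall_self hη'.le) r (hrI r hr)
    ⟨h.1.trans hNL, h.2.1⟩
  have htrN : ∀ r ∈ Icc s t, |traceCLM n (fderiv ℝ (fun y => v y r) x)| ≤ N := fun r hr =>
    ((traceCLM n).le_opNorm _).trans
      ((mul_le_mul_of_nonneg_left (hvN r hr).2 (norm_nonneg _)).trans hNτ)
  have hAi := hv.intervalIntegrable_fderiv hxX hs hst
  have hbi := hv.intervalIntegrable hxX hs hst
  have htri : IntervalIntegrable (fun r => traceCLM n (fderiv ℝ (fun y => v y r) x))
      volume s t := ⟨(traceCLM n).integrable_comp hAi.1, (traceCLM n).integrable_comp hAi.2⟩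
  have htrA : traceCLM n A = ∫ r in s..t, traceCLM n (fderiv ℝ (fun y => v y r) x) :=
    ((traceCLM n).intervalIntegral_comp_comm hAi).symm
  have hgb : g b = ∫ r in s..t, g (v x r) := (g.intervalIntegral_comp_comm hbi).symm
  have hgbi : IntervalIntegrable (fun r => g (v x r)) volume s t :=
    ⟨g.integrable_comp hbi.1, g.integrable_comp hbi.2⟩
  have htrA' : |traceCLM n A| ≤ N * τ := by
    rw [htrA, ← Real.norm_eq_abs]
    have := intervalIntegral.norm_integral_le_of_norm_le_const (a := s) (b := t)
      (f := fun r => traceCLM n (fderiv ℝ (fun y => v y r) x)) (C := N) fun r hr => by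
        rw [uIoc_of_le hst] at hr; exact htrN r (Ioc_subset_Icc_self hr)
    rwa [abs_of_nonneg hτ0] at this
  -- the displacement is the time integral of the field at the starting point
  have ha2 : ‖Ψ - x - b‖ ≤ ε₁ * τ := by
    have h1 : Ψ - x - b = ∫ r in s..t, (v (Φ s r x) r - v x r) := by
      rw [intervalIntegral.integral_sub (hsol.intervalIntegrable hss htt) hbi,
        ← hsol.sub_eq hss htt, hself]
    rw [h1]
    have := intervalIntegral.norm_integral_le_of_norm_le_const (a := s) (b := t)
      (f := fun r => v (Φ s r x) r - v x r) (C := N * (N * τ)) fun r hr => by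
        rw [uIoc_of_le hst] at hr
        have hr' := Ioc_subset_Icc_self hr
        have h2 := hmove r hr'
        refine ((hlip x hx (Φ s r x) (by
          rw [Metric.mem_closedBall, dist_eq_norm]; exact h2.trans (hNτm.trans hmη')) r
          (hrI r hr')).2.2 x (Metric.mem_closedBall_self hη'.le)).trans ?_
        gcongr
    rw [abs_of_nonneg hτ0] at this
    refine this.trans ?_
    gcongr
    calc N * (N * τ) = N ^ 2 * τ := by ring
      _ ≤ 2 * N ^ 3 * τ := by gcongr
      _ ≤ ε₁ := hN3
  -- the spatial increment of the density
  have ha1 : |ρ Ψ t - R - g (Ψ - x)| ≤ ε₁ * (N * τ) := by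
    have hball : Metric.closedBall x (N * τ) ⊆ Metric.cthickening η K :=
      closedBall_subset_cthickening' hx (hNτm.trans hmη)
    have h1 := Convex.norm_image_sub_le_of_norm_fderiv_le' (𝕜 := ℝ) (f := fun y => ρ y t)
      (s := Metric.closedBall x (N * τ)) (φ := g) (C := ε₁) (x := x) (y := Ψ)
      (fun p hp => hρ.diff t ht0 p (hsub (hball hp)))
      (fun p hp => by
        refine hγ₂' p (hball hp) x hxη t htI t htI ?_ (by simpa using hγ₂.le)
        rw [← dist_eq_norm]
        exact (Metric.mem_closedBall.1 hp).trans (hNτm.trans hmγ₂))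
      (convex_closedBall _ _) (Metric.mem_closedBall_self (by positivity))
      (by rw [Metric.mem_closedBall, dist_eq_norm]; exact hmove t htt)
    rw [Real.norm_eq_abs] at h1
    exact h1.trans (by gcongr; exact hmove t htt)
  have ha1' : |ρ Ψ t - R - g b| ≤ 2 * N * ε₁ * τ := by
    have h2 : |g (Ψ - x - b)| ≤ N * (ε₁ * τ) :=
      (g.le_opNorm _).trans (mul_le_mul hgN ha2 (norm_nonneg _) hNpos.le)
    have h3 : ρ Ψ t - R - g b = (ρ Ψ t - R - g (Ψ - x)) + g (Ψ - x - b) := by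
      rw [map_sub g (Ψ - x) b]; ring
    rw [h3]
    refine (abs_add_le _ _).trans ?_
    linarith
  -- the temporal increment of the density
  have ha3 : |ρ x s - R - (R * traceCLM n A + g b)| ≤ 2 * N * ε₁ * τ := by
    have hρx : ContinuousOn (fun r => ρ x r) (Icc s t) :=
      hρ.cont.comp (f := fun r => (x, r)) (by fun_prop) fun r hr => ⟨hxX, hs.trans hr.1⟩
    have hDx : ContinuousOn (fun r => fderiv ℝ (fun y => ρ y r) x) (Icc s t) :=
      hρ.cont_fderiv.comp (f := fun r => (x, r)) (by fun_prop) fun r hr => ⟨hxX, hs.trans hr.1⟩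
    have hm1 : AEStronglyMeasurable (fun r => divFlux ρ v x r) (volume.restrict (Ioc s t)) := by
      refine AEStronglyMeasurable.add (AEStronglyMeasurable.mul ?_ ?_) ?_
      · exact (hρx.mono Ioc_subset_Icc_self).aestronglyMeasurable measurableSet_Ioc
      · exact (traceCLM n).continuous.comp_aestronglyMeasurable
          (hv.measurable_section_fderiv hxX hs)
      · exact ((ContinuousLinearMap.apply ℝ ℝ).flip.continuous₂.comp_aestronglyMeasurable
          (((hDx.mono Ioc_subset_Icc_self).aestronglyMeasurable measurableSet_Ioc).prodMk
            (hv.measurable_section hxX hs)) :)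
    have hle : ∀ r ∈ Icc s t, |divFlux ρ v x r -
        (R * traceCLM n (fderiv ℝ (fun y => v y r) x) + g (v x r))| ≤ 2 * N * ε₁ := by
      intro r hr
      have hrt : |r - t| ≤ m := by
        rw [abs_le]; constructor <;> linarith [hr.1, hr.2]
      have h1 : |ρ x r - R| ≤ ε₁ := hγ₁' x hxη x hxη r (hrI r hr) t htI (by simpa using hγ₁.le)
        (hrt.trans hmγ₁)
      have h2 : ‖fderiv ℝ (fun y => ρ y r) x - g‖ ≤ ε₁ :=
        hγ₂' x hxη x hxη r (hrI r hr) t htI (by simpa using hγ₂.le) (hrt.trans hmγ₂)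
      have h3 : |(ρ x r - R) * traceCLM n (fderiv ℝ (fun y => v y r) x)| ≤ ε₁ * N := by
        rw [abs_mul]; exact mul_le_mul h1 (htrN r hr) (abs_nonneg _) hε₁pos.le
      have h4 : |(fderiv ℝ (fun y => ρ y r) x - g) (v x r)| ≤ ε₁ * N :=
        (ContinuousLinearMap.le_opNorm _ _).trans
          (mul_le_mul h2 (hvN r hr).1 (norm_nonneg _) hε₁pos.le)
      have h5 : divFlux ρ v x r - (R * traceCLM n (fderiv ℝ (fun y => v y r) x) + g (v x r)) =
          (ρ x r - R) * traceCLM n (fderiv ℝ (fun y => v y r) x) +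
            (fderiv ℝ (fun y => ρ y r) x - g) (v x r) := by
        simp only [divFlux, sub_apply]; ring
      rw [h5]
      exact (abs_add_le _ _).trans (by linarith)
    have hrhs : IntervalIntegrable (fun r => R * traceCLM n (fderiv ℝ (fun y => v y r) x) +
        g (v x r)) volume s t := (htri.const_mul R).add hgbi
    have hdi : IntervalIntegrable (fun r => divFlux ρ v x r) volume s t := by
      have h6 : IntervalIntegrable (fun r => divFlux ρ v x r -
          (R * traceCLM n (fderiv ℝ (fun y => v y r) x) + g (v x r))) volume s t := by
        refine intervalIntegrable_of_bound hst (hm1.sub ?_) fun r hr =>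
          hle r (Ioc_subset_Icc_self hr)
        exact (intervalIntegrable_iff_integrableOn_Ioc_of_le hst).1 hrhs |>.aestronglyMeasurable
      simpa using h6.add hrhs
    have h7 : ρ x s - R - (R * traceCLM n A + g b) = ∫ r in s..t, (divFlux ρ v x r -
        (R * traceCLM n (fderiv ℝ (fun y => v y r) x) + g (v x r))) := by
      rw [intervalIntegral.integral_sub hdi hrhs, intervalIntegral.integral_add
        (htri.const_mul R) hgbi, intervalIntegral.integral_const_mul, ← htrA, ← hgb]
      linarith
    rw [h7, ← Real.norm_eq_abs]
    have h8 := intervalIntegral.norm_integral_le_of_norm_le_const (a := s) (b := t)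
      (f := fun r => divFlux ρ v x r -
        (R * traceCLM n (fderiv ℝ (fun y => v y r) x) + g (v x r))) (C := 2 * N * ε₁)
      fun r hr => by
        rw [uIoc_of_le hst] at hr
        exact hle r (Ioc_subset_Icc_self hr)
    rwa [abs_of_nonneg hτ0] at h8
  -- the determinant estimate multiplied by `ρ(Φ x, t)`; the cross term is of second order in `τ`
  set P := ρ Ψ t with hP
  have hΨX : Ψ ∈ X := hΦ.mapsTo s t hs hst hxX
  have hP0 : 0 ≤ P := hρ.nonneg Ψ hΨX t ht0
  have hPN : P ≤ N := by
    have hΨη : Ψ ∈ Metric.cthickening η K := closedBall_subset_cthickening' hx le_rfl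
      (by rw [Metric.mem_closedBall, dist_eq_norm]
          exact (hmove t htt).trans (hNτm.trans hmη))
    exact (le_abs_self P).trans ((hC₁ Ψ hΨη t htI).trans hNC₁)
  have hPR : |P - R| ≤ 2 * N ^ 2 * τ := by
    have h1 : |g (Ψ - x)| ≤ N * (N * τ) :=
      (g.le_opNorm _).trans (mul_le_mul hgN (hmove t htt) (norm_nonneg _) hNpos.le)
    have h2 : P - R = (P - R - g (Ψ - x)) + g (Ψ - x) := by ring
    rw [h2]
    refine (abs_add_le _ _).trans ?_
    have h3 : ε₁ * (N * τ) ≤ N * (N * τ) := by gcongr; linarith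
    linarith
  have hcross : |(P - R) * traceCLM n A| ≤ ε₁ * τ := by
    rw [abs_mul]
    calc |P - R| * |traceCLM n A| ≤ 2 * N ^ 2 * τ * (N * τ) := by gcongr
      _ = (2 * N ^ 3 * τ) * τ := by ring
      _ ≤ ε₁ * τ := by gcongr
  have hd := hdet s t hs hst ht hts2 x hx B hB
  have hPd : P * (1 + traceCLM n A - ε₁ * τ) ≤ P * B.det := mul_le_mul_of_nonneg_left hd hP0
  have hPε : P * (ε₁ * τ) ≤ N * (ε₁ * τ) := by gcongr
  have h6 : 6 * N * ε₁ ≤ ε := by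
    calc 6 * N * ε₁ ≤ 6 * N * (ε / (6 * N)) := by gcongr; exact min_le_right _ _
      _ = ε := by field_simp
  have h6τ : 6 * N * ε₁ * τ ≤ ε * τ := by gcongr
  have hετ : ε₁ * τ ≤ N * (ε₁ * τ) := le_mul_of_one_le_left (by positivity) hN1
  have e1 := (abs_le.1 ha1').1
  have e3 := (abs_le.1 ha3).2
  have e4 := (abs_le.1 hcross).1
  linarith

/-- Over a short time the mass of a compact set does not decrease along the flow, up to an error
which is small compared to the time step. -/
theorem IsFlow.exists_mass_le {Φ : ℝ → ℝ → Vec n → Vec n} (hΦ : IsFlow X v Φ)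
    (hv : RegField X v) {ρ : Vec n → ℝ → ℝ} (hρ : RegDensity X ρ) (hFP : SolvesContinuity X ρ v)
    {K : Set (Vec n)} (hK : IsCompact K) (hKX : K ⊆ X) (T : ℝ) {ε : ℝ} (hε : 0 < ε) :
    ∃ δ > 0, ∀ s t, 0 ≤ s → s ≤ t → t ≤ T → t - s ≤ δ → ∀ A ⊆ K, IsCompact A →
      ∫⁻ x in A, ENNReal.ofReal (ρ x s) ≤
        (∫⁻ x in Φ s t '' A, ENNReal.ofReal (ρ x t)) +
          ENNReal.ofReal (ε * (t - s)) * volume K := by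
  obtain ⟨η, hη, δ₁, hδ₁, C, hC, hsub, hCδ1, hCδ2, hshort⟩ := hΦ.exists_shortTime hv hK hKX T
  obtain ⟨δ₂, hδ₂, hdens⟩ := hΦ.exists_density_le hv hρ hK hKX T hε
  refine ⟨min δ₁ δ₂, by positivity, fun s t hs hst ht hts A hAK hA => ?_⟩
  rw [le_min_iff] at hts
  obtain ⟨hsp, hlip⟩ := hshort s t hs hst ht hts.1
  have hts0 : 0 ≤ t - s := sub_nonneg.2 hst
  have hCt : C * (t - s) ≤ C * δ₁ := by gcongr; exact hts.1
  have hCt1 : 2 * C * (t - s) ≤ 1 / 2 := by linarith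
  have hCt2 : 2 * (C * (t - s)) ≤ η / 2 := by linarith
  have hfar : ∀ x ∈ Metric.cthickening η K, ∀ y ∈ Metric.cthickening η K,
      ‖Φ s t y - Φ s t x - (y - x)‖ ≤ η / 2 := by
    intro x hx y hy
    calc ‖Φ s t y - Φ s t x - (y - x)‖ = ‖(Φ s t y - y) - (Φ s t x - x)‖ := by congr 1; abel
      _ ≤ C * (t - s) + C * (t - s) := (_root_.norm_sub_le _ _).trans
          (add_le_add (hsp y hy) (hsp x hx))
      _ ≤ η / 2 := by linarith
  have hhalf : ∀ x ∈ Metric.cthickening η K, ∀ y ∈ Metric.cthickening η K,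
      ‖Φ s t y - Φ s t x - (y - x)‖ ≤ 1 / 2 * ‖y - x‖ := by
    intro x hx y hy
    rcases le_or_gt ‖y - x‖ η with h | h
    · exact (hlip x hx y hy h).trans (by gcongr)
    · exact (hfar x hx y hy).trans (by linarith)
  have hAη : A ⊆ Metric.cthickening η K := hAK.trans (Metric.self_subset_cthickening K)
  have hinj : InjOn (Φ s t) A := by
    intro x hx y hy hxy
    have h1 := hhalf x (hAη hx) y (hAη hy)
    rw [hxy, sub_self, zero_sub, norm_neg] at h1
    have h2 : ‖y - x‖ = 0 := le_antisymm (by linarith [norm_nonneg (y - x)]) (norm_nonneg _)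
    exact (sub_eq_zero.1 (norm_eq_zero.1 h2)).symm
  have hLip : LipschitzOnWith 2 (Φ s t) (Metric.thickening η K) := by
    refine LipschitzOnWith.of_dist_le_mul fun y hy x hx => ?_
    have h1 := hhalf x (Metric.thickening_subset_cthickening _ _ hx) y
      (Metric.thickening_subset_cthickening _ _ hy)
    rw [dist_eq_norm, dist_eq_norm]
    calc ‖Φ s t y - Φ s t x‖ = ‖(Φ s t y - Φ s t x - (y - x)) + (y - x)‖ := by congr 1; abel
      _ ≤ 1 / 2 * ‖y - x‖ + ‖y - x‖ := (norm_add_le _ _).trans (by linarith)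
      _ ≤ ((2 : ℝ≥0) : ℝ) * ‖y - x‖ := by
          push_cast; linarith [norm_nonneg (y - x)]
  set D := {x | DifferentiableAt ℝ (Φ s t) x} with hD
  have hDm : MeasurableSet D := measurableSet_of_differentiableAt ℝ (Φ s t)
  have hDae : ∀ᵐ x ∂(volume.restrict A), x ∈ D := by
    rw [ae_restrict_iff' hA.measurableSet]
    filter_upwards [hLip.ae_differentiableWithinAt_of_mem (μ := volume)] with x hx hxA
    have hxt : x ∈ Metric.thickening η K := Metric.self_subset_thickening hη K (hAK hxA)
    exact (hx hxt).differentiableAt (Metric.isOpen_thickening.mem_nhds hxt)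
  -- the change of variables only sees the points of differentiability, which have full measure
  have hres : (volume.restrict A).restrict D = volume.restrict A :=
    Measure.restrict_eq_self_of_ae_mem hDae
  have hres' : volume.restrict (D ∩ A) = volume.restrict A := by
    rw [← hres, Measure.restrict_restrict hDm]
  have hFPA : ∀ᵐ x ∂(volume.restrict A), ρ x t - ρ x s = -∫ r in s..t, divFlux ρ v x r :=
    ae_restrict_of_ae_restrict_of_subset (hAK.trans hKX) (hFP s t hs hst)
  have hcov := lintegral_image_eq_lintegral_abs_det_fderiv_mul volume
    (hDm.inter hA.measurableSet) (f := Φ s t) (f' := fun x => fderiv ℝ (Φ s t) x)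
    (fun x hx => hx.1.hasFDerivAt.hasFDerivWithinAt) (hinj.mono inter_subset_right)
    (fun x => ENNReal.ofReal (ρ x t))
  calc ∫⁻ x in A, ENNReal.ofReal (ρ x s)
      ≤ ∫⁻ x in A, (ENNReal.ofReal |(fderiv ℝ (Φ s t) x).det| *
          ENNReal.ofReal (ρ (Φ s t x) t) + ENNReal.ofReal (ε * (t - s))) := by
        refine lintegral_mono_ae ?_
        filter_upwards [hDae, hFPA, ae_restrict_mem hA.measurableSet] with x hxD hxF hxA
        have h1 := hdens s t hs hst ht hts.2 x (hAK hxA) _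
          (DifferentiableAt.hasFDerivAt hxD) hxF
        have hX := hΦ.mapsTo s t hs hst (hKX (hAK hxA))
        have h2 := hρ.nonneg _ hX t (hs.trans hst)
        rw [← ENNReal.ofReal_mul (abs_nonneg _), ← ENNReal.ofReal_add (by positivity)
          (by positivity)]
        refine ENNReal.ofReal_le_ofReal (h1.trans ?_)
        rw [mul_comm]
        gcongr
        exact le_abs_self _
    _ = (∫⁻ x in A, ENNReal.ofReal |(fderiv ℝ (Φ s t) x).det| *
          ENNReal.ofReal (ρ (Φ s t x) t)) + ENNReal.ofReal (ε * (t - s)) * volume A := by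
        rw [lintegral_add_right _ measurable_const, setLIntegral_const]
    _ = (∫⁻ x in Φ s t '' (D ∩ A), ENNReal.ofReal (ρ x t)) +
          ENNReal.ofReal (ε * (t - s)) * volume A := by rw [hcov, hres']
    _ ≤ _ := by
        gcongr
        · exact inter_subset_right

/-- The mass of a compact set does not decrease along the flow. -/
theorem IsFlow.mass_le {Φ : ℝ → ℝ → Vec n → Vec n} (hΦ : IsFlow X v Φ)
    (hv : RegField X v) {ρ : Vec n → ℝ → ℝ} (hρ : RegDensity X ρ) (hFP : SolvesContinuity X ρ v)
    {A : Set (Vec n)} (hA : IsCompact A) (hAX : A ⊆ X) {T : ℝ} (hT : 0 ≤ T) :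
    ∫⁻ x in A, ENNReal.ofReal (ρ x 0) ≤ ∫⁻ x in Φ 0 T '' A, ENNReal.ofReal (ρ x T) := by
  -- the compact tube swept out by `A`
  set K := (fun p : Vec n × ℝ => Φ 0 p.2 p.1) '' (A ×ˢ Icc 0 T) with hKdef
  have hK : IsCompact K := (hA.prod isCompact_Icc).image_of_continuousOn
    ((hΦ.continuousOn_prod hv le_rfl).mono (prod_mono hAX Subset.rfl))
  have hKX : K ⊆ X := by
    rintro _ ⟨p, hp, rfl⟩
    exact hΦ.mapsTo 0 p.2 le_rfl hp.2.1 (hAX hp.1)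
  have hAK : ∀ t ∈ Icc 0 T, Φ 0 t '' A ⊆ K := by
    rintro t ht _ ⟨x, hx, rfl⟩
    exact ⟨(x, t), ⟨hx, ht⟩, rfl⟩
  have hAc : ∀ t ∈ Icc 0 T, IsCompact (Φ 0 t '' A) := fun t ht =>
    hA.image_of_continuousOn ((hΦ.continuousOn_space hv le_rfl ht.1).mono hAX)
  have key : ∀ ε > 0, ∫⁻ x in A, ENNReal.ofReal (ρ x 0) ≤
      (∫⁻ x in Φ 0 T '' A, ENNReal.ofReal (ρ x T)) + ENNReal.ofReal (ε * T) * volume K := by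
    intro ε hε
    obtain ⟨δ, hδ, h⟩ := hΦ.exists_mass_le hv hρ hFP hK hKX T hε
    -- `N` steps of length `T / N`, whose errors add up to `ε * T`
    obtain ⟨N, hN⟩ := exists_nat_gt (T / δ)
    have hNpos : (0 : ℝ) < N := (div_nonneg hT hδ.le).trans_lt hN
    have hstep : T / N ≤ δ := by
      rw [div_lt_iff₀ hδ] at hN
      rw [div_le_iff₀ hNpos]; linarith
    have hind : ∀ k : ℕ, k ≤ N → ∫⁻ x in A, ENNReal.ofReal (ρ x 0) ≤
        (∫⁻ x in Φ 0 (k * (T / N)) '' A, ENNReal.ofReal (ρ x (k * (T / N)))) +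
          ENNReal.ofReal (ε * (k * (T / N))) * volume K := by
      intro k
      induction k with
      | zero =>
        intro _
        have h0 : Φ 0 0 '' A = A := by
          rw [image_congr (fun x hx => hΦ.self le_rfl (hAX hx)), image_id']
        simp [h0]
      | succ k ih =>
        intro hk
        have hk' : ((k + 1 : ℕ) : ℝ) ≤ N := by exact_mod_cast hk
        push_cast at hk' ⊢
        have hTN : 0 ≤ T / N := by positivity
        have hs : 0 ≤ k * (T / N) := by positivity
        have hst : k * (T / N) ≤ (k + 1) * (T / N) := by nlinarith
        have hle : (k + 1) * (T / N) ≤ T := by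
          calc (k + 1) * (T / N) ≤ N * (T / N) := by gcongr
            _ = T := by field_simp
        have h1 := h (k * (T / N)) ((k + 1) * (T / N)) hs hst hle (by linarith) _
          (hAK _ ⟨hs, hst.trans hle⟩) (hAc _ ⟨hs, hst.trans hle⟩)
        have h2 : Φ (k * (T / N)) ((k + 1) * (T / N)) '' (Φ 0 (k * (T / N)) '' A) =
            Φ 0 ((k + 1) * (T / N)) '' A := by
          rw [image_image]
          exact image_congr fun x hx => hΦ.comp hv le_rfl hs hst (hAX hx)
        rw [h2] at h1
        refine (ih (Nat.le_of_succ_le hk)).trans ((add_le_add_left h1 _).trans (le_of_eq ?_))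
        rw [add_assoc, ← add_mul, ← ENNReal.ofReal_add (mul_nonneg hε.le (sub_nonneg.2 hst))
          (by positivity)]
        congr 3
        ring
    have := hind N le_rfl
    rwa [mul_div_cancel₀ T hNpos.ne'] at this
  refine ENNReal.le_of_forall_pos_le_add fun c hc _ => ?_
  have hvol : volume K ≠ ⊤ := hK.measure_lt_top.ne
  set V := (volume K).toReal with hV
  have hV0 : 0 ≤ V := ENNReal.toReal_nonneg
  have hcpos : (0 : ℝ) < c := hc
  refine (key (c / ((T + 1) * (V + 1))) (by positivity)).trans ?_
  gcongr
  rw [← ENNReal.ofReal_toReal hvol, ← ENNReal.ofReal_mul (by positivity), ← hV,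
    ← ENNReal.ofReal_coe_nnreal]
  refine ENNReal.ofReal_le_ofReal ?_
  calc (c : ℝ) / ((T + 1) * (V + 1)) * T * V = c * (T / (T + 1)) * (V / (V + 1)) := by
        field_simp
    _ ≤ c * 1 * 1 := by
        gcongr
        · rw [div_le_one (by positivity)]; linarith
        · rw [div_le_one (by positivity)]; linarith
    _ = c := by ring

/-- A density which solves the continuity equation and whose total mass is constant is transported
by the flow of the field. The flow is defined forward in time only, and need not be onto; this is
why mass conservation has to be assumed. -/
theorem IsFlow.map_densMeasure {Φ : ℝ → ℝ → Vec n → Vec n} (hΦ : IsFlow X v Φ)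
    (hv : RegField X v) {ρ : Vec n → ℝ → ℝ} (hρ : RegDensity X ρ) (hFP : SolvesContinuity X ρ v)
    {T : ℝ} (hT : 0 ≤ T) (h0 : IsProbabilityMeasure (densMeasure X fun x => ρ x 0))
    (h1 : IsProbabilityMeasure (densMeasure X fun x => ρ x T)) :
    (densMeasure X fun x => ρ x 0).map (Φ 0 T) = densMeasure X fun x => ρ x T := by
  have hXm : MeasurableSet X := hv.isOpen.measurableSet
  have hdm : ∀ t, ∀ B, MeasurableSet B → densMeasure X (fun x => ρ x t) B =
      ∫⁻ x in B ∩ X, ENNReal.ofReal (ρ x t) := fun t B hB => by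
    rw [densMeasure, withDensity_apply _ hB, Measure.restrict_restrict hB]
  have hac : (densMeasure X fun x => ρ x 0) ≪ volume.restrict X :=
    withDensity_absolutelyContinuous _ _
  have hmeas : AEMeasurable (Φ 0 T) (densMeasure X fun x => ρ x 0) :=
    ((hΦ.continuousOn_space hv le_rfl hT).aemeasurable hXm).mono_ac hac
  have hX0 : densMeasure X (fun x => ρ x 0) Xᶜ = 0 := by
    rw [hdm 0 _ hXm.compl]; simp
  have := Measure.isProbabilityMeasure_map (μ := densMeasure X fun x => ρ x 0) hmeas
  refine Measure.eq_of_le_of_isProbabilityMeasure ?_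
  refine Measure.le_iff.2 fun B hB => ?_
  rw [Measure.map_apply_of_aemeasurable hmeas hB]
  -- inner approximation of the part of the preimage in `X` by compact sets
  have hpre : MeasurableSet (X ∩ Φ 0 T ⁻¹' B) := by
    have hr : Measurable (X.domRestrict (Φ 0 T)) :=
      (hΦ.continuousOn_space hv le_rfl hT).domRestrict.measurable
    have := hXm.subtype_image (hr hB)
    convert this using 1
    ext x
    simp only [mem_inter_iff, mem_preimage, mem_image, Subtype.exists, exists_and_right,
      exists_eq_right]
    exact ⟨fun h => ⟨h.1, h.2⟩, fun ⟨h, h'⟩ => ⟨h, h'⟩⟩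
  have hpreeq : densMeasure X (fun x => ρ x 0) (Φ 0 T ⁻¹' B) ≤
      densMeasure X (fun x => ρ x 0) (X ∩ Φ 0 T ⁻¹' B) := by
    calc densMeasure X (fun x => ρ x 0) (Φ 0 T ⁻¹' B)
        ≤ densMeasure X (fun x => ρ x 0) ((X ∩ Φ 0 T ⁻¹' B) ∪ Xᶜ) := by
          refine measure_mono fun x hx => ?_
          by_cases hxX : x ∈ X
          · exact Or.inl ⟨hxX, hx⟩
          · exact Or.inr hxX
      _ ≤ _ := (measure_union_le _ _).trans (by rw [hX0, add_zero])
  refine hpreeq.trans ?_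
  rw [hpre.measure_eq_iSup_isCompact]
  refine iSup₂_le fun A hAs => iSup_le fun hA => ?_
  have hAX : A ⊆ X := fun x hx => (hAs hx).1
  rw [hdm 0 A hA.measurableSet, inter_eq_left.2 hAX, hdm T B hB]
  refine (hΦ.mass_le hv hρ hFP hA hAX hT).trans ?_
  refine lintegral_mono_set ?_
  rintro _ ⟨x, hx, rfl⟩
  exact ⟨(hAs hx).2, hΦ.mapsTo 0 T le_rfl hT (hAX hx)⟩

/-! ### Regularity of the probability-flow field -/

section ContC1

variable {G G' G'' : Type*} [NormedAddCommGroup G] [NormedSpace ℝ G]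
  [NormedAddCommGroup G'] [NormedSpace ℝ G'] [NormedAddCommGroup G''] [NormedSpace ℝ G'']

theorem SmoothInSpace.contC1 {h : Vec n → ℝ → G} (hX : IsOpen X) (hh : SmoothInSpace 1 X h) :
    ContC1 X h where
  diff t ht x hx := ((hh.1 t ht).contDiffAt (hX.mem_nhds hx)).differentiableAt one_ne_zero
  cont := by
    have h0 := hh.2 0 zero_le_one
    have h1 : ContinuousOn (fun z : Vec n × ℝ =>
        iteratedFDeriv ℝ 0 (fun y => h y z.2) z.1 (fun _ => 0)) (X ×ˢ Ici 0) :=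
      (ContinuousMultilinearMap.apply ℝ (fun _ : Fin 0 => Vec n) G
        (fun _ => 0)).continuous.comp_continuousOn h0
    simpa using h1
  cont_fderiv := by
    have h0 := hh.2 1 le_rfl
    refine continuousOn_clm_apply.2 fun e => ?_
    have h1 : ContinuousOn (fun z : Vec n × ℝ =>
        iteratedFDeriv ℝ 1 (fun y => h y z.2) z.1 (fun _ => e)) (X ×ˢ Ici 0) :=
      (ContinuousMultilinearMap.apply ℝ (fun _ : Fin 1 => Vec n) G
        (fun _ => e)).continuous.comp_continuousOn h0
    simpa using h1

theorem SmoothInSpace.of_two {h : Vec n → ℝ → G} (hh : SmoothInSpace 2 X h) :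
    SmoothInSpace 1 X h :=
  ⟨fun t ht => (hh.1 t ht).of_le (by norm_num), fun l hl => hh.2 l (hl.trans one_le_two)⟩

theorem SmoothInSpace.contC1_fderiv {h : Vec n → ℝ → G} (hX : IsOpen X)
    (hh : SmoothInSpace 2 X h) : ContC1 X (fun x t => fderiv ℝ (fun y => h y t) x) where
  diff t ht x hx := by
    have h1 : ContDiffAt ℝ 1 (fderiv ℝ fun y => h y t) x :=
      ((hh.1 t ht).contDiffAt (hX.mem_nhds hx)).fderiv_right (by norm_num)
    exact h1.differentiableAt one_ne_zero
  cont := (hh.of_two.contC1 hX).cont_fderiv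
  cont_fderiv := by
    have h0 := hh.2 2 le_rfl
    refine continuousOn_clm_apply.2 fun e => continuousOn_clm_apply.2 fun e' => ?_
    have h1 : ContinuousOn (fun z : Vec n × ℝ =>
        iteratedFDeriv ℝ 2 (fun y => h y z.2) z.1 ![e, e']) (X ×ˢ Ici 0) :=
      (ContinuousMultilinearMap.apply ℝ (fun _ : Fin 2 => Vec n) G
        ![e, e']).continuous.comp_continuousOn h0
    simpa [iteratedFDeriv_two_apply] using h1

namespace ContC1

theorem congr {h h' : Vec n → ℝ → G} (hX : IsOpen X) (hh : ContC1 X h)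
    (heq : ∀ x ∈ X, ∀ t, 0 ≤ t → h' x t = h x t) : ContC1 X h' := by
  have hev : ∀ x ∈ X, ∀ t, 0 ≤ t → (fun y => h' y t) =ᶠ[𝓝 x] fun y => h y t :=
    fun x hx t ht => by filter_upwards [hX.mem_nhds hx] with y hy using heq y hy t ht
  exact ⟨fun t ht x hx => (hh.diff t ht x hx).congr_of_eventuallyEq (hev x hx t ht),
    hh.cont.congr fun z hz => heq z.1 hz.1 z.2 hz.2,
    hh.cont_fderiv.congr fun z hz => (hev z.1 hz.1 z.2 hz.2).fderiv_eq⟩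

theorem const (c : G) : ContC1 X (fun _ _ => c) where
  diff _ _ _ _ := differentiableAt_const c
  cont := continuousOn_const
  cont_fderiv := by simpa using continuousOn_const

theorem clm_comp {h : Vec n → ℝ → G} (L : G →L[ℝ] G') (hh : ContC1 X h) :
    ContC1 X (fun x t => L (h x t)) where
  diff t ht x hx := L.differentiableAt.comp x (hh.diff t ht x hx)
  cont := L.continuous.comp_continuousOn hh.cont
  cont_fderiv := by
    have h1 : ContinuousOn (fun z : Vec n × ℝ => L.comp (fderiv ℝ (fun y => h y z.2) z.1))
        (X ×ˢ Ici 0) := continuousOn_const.clm_comp hh.cont_fderiv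
    refine h1.congr fun z hz => ?_
    exact (L.hasFDerivAt.comp z.1 (hh.diff z.2 hz.2 z.1 hz.1).hasFDerivAt).fderiv

theorem add {h h' : Vec n → ℝ → G} (hh : ContC1 X h) (hh' : ContC1 X h') :
    ContC1 X (fun x t => h x t + h' x t) where
  diff t ht x hx := (hh.diff t ht x hx).add (hh'.diff t ht x hx)
  cont := hh.cont.add hh'.cont
  cont_fderiv := (hh.cont_fderiv.add hh'.cont_fderiv).congr fun z hz =>
    fderiv_fun_add (hh.diff z.2 hz.2 z.1 hz.1) (hh'.diff z.2 hz.2 z.1 hz.1)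

theorem sum {ι : Type*} (s : Finset ι) {h : ι → Vec n → ℝ → G} (hh : ∀ i ∈ s, ContC1 X (h i)) :
    ContC1 X (fun x t => ∑ i ∈ s, h i x t) where
  diff t ht x hx := DifferentiableAt.fun_sum fun i hi => (hh i hi).diff t ht x hx
  cont := continuousOn_finsetSum _ fun i hi => (hh i hi).cont
  cont_fderiv := (continuousOn_finsetSum _ fun i hi => (hh i hi).cont_fderiv).congr
    fun z hz => fderiv_fun_sum fun i hi => (hh i hi).diff z.2 hz.2 z.1 hz.1

theorem smul {c : Vec n → ℝ → ℝ} {h : Vec n → ℝ → G} (hc : ContC1 X c) (hh : ContC1 X h) :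
    ContC1 X (fun x t => c x t • h x t) where
  diff t ht x hx := (hc.diff t ht x hx).smul (hh.diff t ht x hx)
  cont := hc.cont.smul hh.cont
  cont_fderiv := by
    have h1 : ContinuousOn (fun z : Vec n × ℝ => c z.1 z.2 • fderiv ℝ (fun y => h y z.2) z.1 +
        (fderiv ℝ (fun y => c y z.2) z.1).smulRight (h z.1 z.2)) (X ×ˢ Ici 0) := by
      refine (hc.cont.smul hh.cont_fderiv).add (continuousOn_clm_apply.2 fun e => ?_)
      simp only [ContinuousLinearMap.smulRight_apply]
      exact (hc.cont_fderiv.clm_apply continuousOn_const).smul hh.cont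
    exact h1.congr fun z hz =>
      fderiv_fun_smul (hc.diff z.2 hz.2 z.1 hz.1) (hh.diff z.2 hz.2 z.1 hz.1)

theorem mul {c h : Vec n → ℝ → ℝ} (hc : ContC1 X c) (hh : ContC1 X h) :
    ContC1 X (fun x t => c x t * h x t) := hc.smul hh

theorem inv {c : Vec n → ℝ → ℝ} (hc : ContC1 X c) (h0 : ∀ x ∈ X, ∀ t, 0 ≤ t → c x t ≠ 0) :
    ContC1 X (fun x t => (c x t)⁻¹) where
  diff t ht x hx := (hc.diff t ht x hx).fun_inv (h0 x hx t ht)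
  cont := hc.cont.inv₀ fun z hz => h0 z.1 hz.1 z.2 hz.2
  cont_fderiv := by
    have h1 : ContinuousOn (fun z : Vec n × ℝ => (-(c z.1 z.2 ^ 2)⁻¹) •
        fderiv ℝ (fun y => c y z.2) z.1) (X ×ˢ Ici 0) :=
      ((hc.cont.pow 2).inv₀ fun z hz => pow_ne_zero 2 (h0 z.1 hz.1 z.2 hz.2)).neg.smul
        hc.cont_fderiv
    refine h1.congr fun z hz => ?_
    exact ((hasDerivAt_inv (h0 z.1 hz.1 z.2 hz.2)).comp_hasFDerivAt z.1
      (hc.diff z.2 hz.2 z.1 hz.1).hasFDerivAt).fderiv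

theorem clm_apply_const {h : Vec n → ℝ → (G →L[ℝ] G')} (hh : ContC1 X h) (e : G) :
    ContC1 X (fun x t => h x t e) :=
  hh.clm_comp (ContinuousLinearMap.apply ℝ G' e)

theorem coord {m : ℕ} {h : Vec n → ℝ → Vec m} (hh : ContC1 X h) (a : Fin m) :
    ContC1 X (fun x t => h x t a) :=
  hh.clm_comp (EuclideanSpace.proj a : Vec m →L[ℝ] ℝ)

end ContC1

end ContC1

theorem measurable_indicator_of_continuousOn {E : Type*} [NormedAddCommGroup E]
    [MeasurableSpace E] [BorelSpace E] {f : Vec n × ℝ → E} (hX : IsOpen X)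
    (hf : ContinuousOn f (X ×ˢ Ici (0 : ℝ))) :
    Measurable ((X ×ˢ Ici (0 : ℝ)).indicator f) := by
  classical
  rw [← piecewise_eq_indicator]
  exact hf.measurable_piecewise continuousOn_const (hX.measurableSet.prod measurableSet_Ici)

namespace RegField

theorem of_contC1 (hX : IsOpen X) (hv : ContC1 X v) : RegField X v where
  isOpen := hX
  diff := hv.diff
  bdd K hK hKX T := by
    obtain ⟨C₁, h₁⟩ := (exists_bound_modulus hv.cont hK hKX T).1
    obtain ⟨C₂, h₂⟩ := (exists_bound_modulus hv.cont_fderiv hK hKX T).1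
    exact ⟨max C₁ C₂, fun x hx t ht => ⟨(h₁ x hx t ht).trans (le_max_left _ _),
      (h₂ x hx t ht).trans (le_max_right _ _)⟩⟩
  equi K hK hKX T ε hε := by
    obtain ⟨η, hη, h⟩ := (exists_bound_modulus hv.cont_fderiv hK hKX T).2 ε hε
    exact ⟨η, hη, fun x hx y hy hxy t ht => h x hx y hy t ht t ht hxy (by simpa using hη.le)⟩
  meas := measurable_indicator_of_continuousOn hX hv.cont
  meas_fderiv := measurable_indicator_of_continuousOn hX hv.cont_fderiv

theorem add {v' : Vec n → ℝ → Vec n} (hv : RegField X v) (hv' : RegField X v') :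
    RegField X (fun x t => v x t + v' x t) := by
  have hd : ∀ t, 0 ≤ t → ∀ x ∈ X, fderiv ℝ (fun y => v y t + v' y t) x =
      fderiv ℝ (fun y => v y t) x + fderiv ℝ (fun y => v' y t) x := fun t ht x hx =>
    fderiv_fun_add (hv.diff t ht x hx) (hv'.diff t ht x hx)
  refine ⟨hv.isOpen, fun t ht x hx => (hv.diff t ht x hx).add (hv'.diff t ht x hx),
    fun K hK hKX T => ?_, fun K hK hKX T ε hε => ?_, ?_, ?_⟩
  · obtain ⟨C, hC⟩ := hv.bdd K hK hKX T
    obtain ⟨C', hC'⟩ := hv'.bdd K hK hKX T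
    refine ⟨C + C', fun x hx t ht => ⟨?_, ?_⟩⟩
    · exact (norm_add_le _ _).trans (add_le_add (hC x hx t ht).1 (hC' x hx t ht).1)
    · rw [hd t ht.1 x (hKX hx)]
      exact (norm_add_le _ _).trans (add_le_add (hC x hx t ht).2 (hC' x hx t ht).2)
  · obtain ⟨η, hη, h⟩ := hv.equi K hK hKX T (ε / 2) (half_pos hε)
    obtain ⟨η', hη', h'⟩ := hv'.equi K hK hKX T (ε / 2) (half_pos hε)
    refine ⟨min η η', lt_min hη hη', fun x hx y hy hxy t ht => ?_⟩
    rw [hd t ht.1 x (hKX hx), hd t ht.1 y (hKX hy), add_sub_add_comm]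
    refine (norm_add_le _ _).trans ?_
    linarith [h x hx y hy (hxy.trans (min_le_left _ _)) t ht,
      h' x hx y hy (hxy.trans (min_le_right _ _)) t ht]
  · convert hv.meas.add hv'.meas using 1
    ext1 z
    by_cases hz : z ∈ X ×ˢ Ici (0 : ℝ) <;> simp [hz]
  · convert hv.meas_fderiv.add hv'.meas_fderiv using 1
    ext1 z
    by_cases hz : z ∈ X ×ˢ Ici (0 : ℝ)
    · simp only [Pi.add_apply, indicator_of_mem hz]
      exact hd z.2 hz.2 z.1 hz.1
    · simp [hz]

/-- Multiplication by a measurable, locally bounded function of time. -/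
theorem time_smul (hv : RegField X v) {c : ℝ → ℝ} (hc : Measurable c)
    (hb : ∀ T, ∃ C, ∀ t ∈ Icc 0 T, |c t| ≤ C) : RegField X (fun x t => c t • v x t) := by
  have hd : ∀ t, 0 ≤ t → ∀ x ∈ X, fderiv ℝ (fun y => c t • v y t) x =
      c t • fderiv ℝ (fun y => v y t) x := fun t ht x hx =>
    fderiv_fun_const_smul (hv.diff t ht x hx) (c t)
  refine ⟨hv.isOpen, fun t ht x hx => (hv.diff t ht x hx).const_smul (c t),
    fun K hK hKX T => ?_, fun K hK hKX T ε hε => ?_, ?_, ?_⟩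
  · obtain ⟨C, hC⟩ := hv.bdd K hK hKX T
    obtain ⟨C', hC'⟩ := hb T
    refine ⟨C' * C, fun x hx t ht => ?_⟩
    have h0 := (abs_nonneg _).trans (hC' t ht)
    refine ⟨?_, ?_⟩
    · rw [norm_smul]
      exact mul_le_mul (hC' t ht) (hC x hx t ht).1 (norm_nonneg _) h0
    · rw [hd t ht.1 x (hKX hx), norm_smul]
      exact mul_le_mul (hC' t ht) (hC x hx t ht).2 (norm_nonneg _) h0
  · obtain ⟨C', hC'⟩ := hb T
    obtain ⟨η, hη, h⟩ := hv.equi K hK hKX T (ε / (|C'| + 1)) (by positivity)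
    refine ⟨η, hη, fun x hx y hy hxy t ht => ?_⟩
    rw [hd t ht.1 x (hKX hx), hd t ht.1 y (hKX hy)]
    have hsub : c t • fderiv ℝ (fun y => v y t) x - c t • fderiv ℝ (fun y => v y t) y =
        c t • (fderiv ℝ (fun y => v y t) x - fderiv ℝ (fun y => v y t) y) :=
      (smul_sub _ _ _).symm
    rw [hsub, norm_smul]
    calc ‖c t‖ * ‖fderiv ℝ (fun y => v y t) x - fderiv ℝ (fun z => v z t) y‖
        ≤ (|C'| + 1) * (ε / (|C'| + 1)) := by
          refine mul_le_mul ?_ (h x hx y hy hxy t ht) (norm_nonneg _) (by positivity)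
          exact ((hC' t ht).trans (le_abs_self _)).trans (by linarith)
      _ = ε := by field_simp
  · convert (hc.comp measurable_snd).smul hv.meas using 1
    ext1 z
    by_cases hz : z ∈ X ×ˢ Ici (0 : ℝ) <;> simp [hz]
  · convert (hc.comp measurable_snd).smul hv.meas_fderiv using 1
    ext1 z
    by_cases hz : z ∈ X ×ˢ Ici (0 : ℝ)
    · simp only [Pi.smul_apply', indicator_of_mem hz]
      exact hd z.2 hz.2 z.1 hz.1
    · simp only [Pi.smul_apply', indicator_of_notMem hz]
      exact (smul_zero (A := Vec n →L[ℝ] Vec n) (c z.2)).symm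

theorem sum {ι : Type*} (hX : IsOpen X) (s : Finset ι) {v : ι → Vec n → ℝ → Vec n}
    (hv : ∀ i ∈ s, RegField X (v i)) : RegField X (fun x t => ∑ i ∈ s, v i x t) := by
  classical
  induction s using Finset.induction_on with
  | empty => simpa using of_contC1 hX (ContC1.const (X := X) (0 : Vec n))
  | insert i s hi ih =>
    simp only [Finset.sum_insert hi]
    exact (hv i (Finset.mem_insert_self i s)).add
      (ih fun j hj => hv j (Finset.mem_insert_of_mem hj))

end RegField

theorem vec_eq_sum {m : ℕ} (y : Vec m) : y = ∑ a, y a • (basisVec a : Vec m) := by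
  ext a
  simp [basisVec, Finset.sum_apply, Pi.single_apply]

theorem mulV_apply {a b : ℕ} (A : Matrix (Fin a) (Fin b) ℝ) (y : Vec b) (k : Fin a) :
    mulV A y k = ∑ l, A k l * y l := by
  simp [mulV, Matrix.mulVec, dotProduct]

theorem mulV_eq_sum {a b : ℕ} (A : Matrix (Fin a) (Fin b) ℝ) (y : Vec b) :
    mulV A y = ∑ k, ∑ l, (A k l * y l) • (basisVec k : Vec a) := by
  rw [vec_eq_sum (mulV A y)]
  simp only [mulV_apply, Finset.sum_smul]

theorem ContC1.mulV {a : ℕ} {A : Vec n → ℝ → Matrix (Fin n) (Fin a) ℝ} {y : Vec n → ℝ → Vec a}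
    (hA : ∀ k l, ContC1 X (fun x t => A x t k l)) (hy : ContC1 X y) :
    ContC1 X (fun x t => mulV (A x t) (y x t)) := by
  simp only [mulV_eq_sum]
  exact ContC1.sum _ fun k _ => ContC1.sum _ fun l _ =>
    ((hA k l).mul (hy.coord l)).smul (ContC1.const _)

/-- On the domain of positivity the score is `∇ρ / ρ`. -/
theorem score_apply {ρ : Vec n → ℝ → ℝ} {x : Vec n} {t : ℝ}
    (hd : DifferentiableAt ℝ (fun y => ρ y t) x) (h0 : ρ x t ≠ 0) (a : Fin n) :
    score ρ x t a = (ρ x t)⁻¹ * fderiv ℝ (fun y => ρ y t) x (basisVec a) := by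
  have h1 : score ρ x t a = inner ℝ (score ρ x t) (basisVec a : Vec n) := by
    simp [basisVec, EuclideanSpace.inner_single_right]
  rw [h1, score, gradient, InnerProductSpace.toDual_symm_apply, fderiv.log hd h0]
  simp

namespace FaultSystem

variable {m p q N : ℕ} {S : FaultSystem n m p q N}

theorem contC1_score {ρ : Vec n → ℝ → ℝ} (hX : IsOpen X) (hρ : SmoothInSpace 2 X ρ)
    (hpos : ∀ x ∈ X, ∀ t, 0 ≤ t → 0 < ρ x t) : ContC1 X (score ρ) := by
  have h1 := hρ.of_two.contC1 hX
  have h2 : ContC1 X (fun x t => ∑ a, ((ρ x t)⁻¹ * fderiv ℝ (fun y => ρ y t) x (basisVec a)) •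
      (basisVec a : Vec n)) :=
    ContC1.sum _ fun a _ => ((h1.inv fun x hx t ht => (hpos x hx t ht).ne').mul
      ((hρ.contC1_fderiv hX).clm_apply_const _)).smul (ContC1.const _)
  refine h2.congr hX fun x hx t ht => ?_
  rw [vec_eq_sum (score ρ x t)]
  refine Finset.sum_congr rfl fun a _ => ?_
  rw [score_apply (h1.diff t ht x hx) (hpos x hx t ht).ne']

theorem Regular.contC1_diffusion (hS : S.Regular) (a b : Fin n) :
    ContC1 S.X (fun x t => S.diffusion x t a b) :=
  (hS.smooth_diffusion a b).of_two.contC1 hS.isOpen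

theorem Regular.contC1_divDiffusion (hS : S.Regular) : ContC1 S.X S.divDiffusion := by
  have h1 : ContC1 S.X (fun x t => ∑ a, ∑ b,
      (fderiv ℝ (fun y => S.diffusion y t a b) x (basisVec b)) • (basisVec a : Vec n)) :=
    ContC1.sum _ fun a _ => ContC1.sum _ fun b _ =>
      (((hS.smooth_diffusion a b).contC1_fderiv hS.isOpen).clm_apply_const _).smul
        (ContC1.const _)
  refine h1.congr hS.isOpen fun x _ t _ => ?_
  rw [vec_eq_sum (S.divDiffusion x t)]
  simp only [divDiffusion, Finset.sum_smul]

theorem Regular.regField_F (hS : S.Regular) (k : Fin (N + 1)) : RegField S.X (S.F k) := by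
  have hX := hS.isOpen
  have h1 : ContC1 S.X (fun x t => S.f x t + mulV (S.g x t) (S.u x t)) :=
    (hS.smooth_f.contC1 hX).add
      (ContC1.mulV (fun a b => (hS.smooth_g a b).contC1 hX) (hS.smooth_u.contC1 hX))
  have h2 : RegField S.X (fun x t => mulV (S.ψ x t) (S.w k t)) := by
    have h3 : RegField S.X (fun x t => ∑ a, ∑ b,
        S.w k t b • (S.ψ x t a b • (basisVec a : Vec n))) := by
      refine RegField.sum hX _ fun a _ => RegField.sum hX _ fun b _ => ?_
      refine (RegField.of_contC1 hX (((hS.smooth_ψ a b).contC1 hX).smul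
        (ContC1.const (basisVec a : Vec n)))).time_smul ?_ fun T => ?_
      · exact (EuclideanSpace.proj b : Vec p →L[ℝ] ℝ).measurable.comp (hS.measurable_w k)
      · obtain ⟨C, hC⟩ := hS.bounded_w k T
        exact ⟨C, fun t ht => (PiLp.norm_apply_le (S.w k t) b).trans (hC t ht)⟩
    convert h3 using 3 with x t
    rw [mulV_eq_sum]
    simp only [smul_smul, mul_comm]
  exact (RegField.of_contC1 hX h1).add h2

theorem Regular.contC1_correction (hS : S.Regular) {ρ : Vec n → ℝ → ℝ}
    (hρ : SmoothInSpace 2 S.X ρ) (hpos : ∀ x ∈ S.X, ∀ t, 0 ≤ t → 0 < ρ x t) :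
    ContC1 S.X (fun x t => (-(1 / 2) : ℝ) •
      (S.divDiffusion x t + mulV (S.diffusion x t) (score ρ x t))) :=
  (ContC1.const (-(1 / 2) : ℝ)).smul (hS.contC1_divDiffusion.add
    (ContC1.mulV hS.contC1_diffusion (contC1_score hS.isOpen hρ hpos)))

theorem Regular.regField_probFlow (hS : S.Regular) (k : Fin (N + 1)) {ρ : Vec n → ℝ → ℝ}
    (hρ : SmoothInSpace 2 S.X ρ) (hpos : ∀ x ∈ S.X, ∀ t, 0 ≤ t → 0 < ρ x t) :
    RegField S.X (S.probFlow k ρ) := by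
  have h := (hS.regField_F k).add
    (RegField.of_contC1 hS.isOpen (hS.contC1_correction hρ hpos))
  convert h using 3 with x t
  rw [probFlow, sub_eq_add_neg, neg_smul]

theorem norm_mulV_le {a b : ℕ} (A : Matrix (Fin a) (Fin b) ℝ) (y : Vec b) :
    ‖mulV A y‖ ≤ frob A * ‖y‖ := by
  have h0 : 0 ≤ frob A := Real.sqrt_nonneg _
  refine (abs_le_of_sq_le_sq' ?_ (mul_nonneg h0 (norm_nonneg _))).2
  have hf : frob A ^ 2 = ∑ k, ∑ l, A k l ^ 2 := Real.sq_sqrt (by positivity)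
  rw [mul_pow, hf, EuclideanSpace.real_norm_sq_eq,
    EuclideanSpace.real_norm_sq_eq, Finset.sum_mul]
  refine Finset.sum_le_sum fun k _ => ?_
  rw [mulV_apply]
  exact Finset.sum_mul_sq_le_sq_mul_sq _ _ _

/-- The distance between the probability-flow fields of two faults. -/
theorem norm_probFlow_sub_le {i j : Fin (N + 1)} {ρi ρj : Vec n → ℝ → ℝ} {x : Vec n} {t : ℝ}
    {ψbar σbar sbar Δw : ℝ} (hψ : frob (S.ψ x t) ≤ ψbar) (hσ : frob (S.diffusion x t) ≤ σbar)
    (hs : ‖score ρj x t - score ρi x t‖ ≤ sbar) (hw : ‖S.w i t - S.w j t‖ ≤ Δw) :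
    ‖S.probFlow i ρi x t - S.probFlow j ρj x t‖ ≤ ψbar * Δw + 1 / 2 * σbar * sbar := by
  have hadd : ∀ {a b : ℕ} (A : Matrix (Fin a) (Fin b) ℝ) (y y' : Vec b),
      mulV A (y - y') = mulV A y - mulV A y' := fun A y y' => map_sub (Matrix.toEuclideanLin A) y y'
  have h1 : S.probFlow i ρi x t - S.probFlow j ρj x t = mulV (S.ψ x t) (S.w i t - S.w j t) +
      (1 / 2 : ℝ) • mulV (S.diffusion x t) (score ρj x t - score ρi x t) := by
    rw [hadd, hadd]
    simp only [probFlow, F]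
    module
  rw [h1]
  have h0 : ∀ {a b : ℕ} (A : Matrix (Fin a) (Fin b) ℝ), 0 ≤ frob A := fun A => Real.sqrt_nonneg _
  have h2 := (norm_mulV_le (S.ψ x t) (S.w i t - S.w j t)).trans
    (mul_le_mul hψ hw (norm_nonneg _) ((h0 _).trans hψ))
  have h3 := (norm_mulV_le (S.diffusion x t) (score ρj x t - score ρi x t)).trans
    (mul_le_mul hσ hs (norm_nonneg _) ((h0 _).trans hσ))
  refine (norm_add_le _ _).trans ?_
  rw [norm_smul]
  norm_num
  linarith

end FaultSystem

/-! ### The Fokker-Planck equation in divergence form -/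

/-- The smooth functions with compact support in `X`. -/
structure IsTest (X : Set (Vec n)) (φ : Vec n → ℝ) : Prop where
  smooth : ContDiff ℝ ∞ φ
  compact : HasCompactSupport φ
  supp : tsupport φ ⊆ X

namespace IsTest

variable {φ : Vec n → ℝ}

theorem fderiv_apply (hφ : IsTest X φ) (e : Vec n) : IsTest X (fun x => fderiv ℝ φ x e) where
  smooth := (hφ.smooth.fderiv_right (m := ∞) (by simp)).clm_apply contDiff_const
  compact := hφ.compact.fderiv_apply (𝕜 := ℝ) e
  supp := (tsupport_fderiv_apply_subset ℝ e).trans hφ.supp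

theorem eq_zero (hφ : IsTest X φ) {x : Vec n} (hx : x ∉ X) : φ x = 0 :=
  image_eq_zero_of_notMem_tsupport fun h => hx (hφ.supp h)

theorem integrable_mul (hφ : IsTest X φ) {u : Vec n → ℝ} (hu : ContinuousOn u X) :
    Integrable (fun x => u x * φ x) := by
  have h1 : IntegrableOn (fun x => u x * φ x) (tsupport φ) :=
    ((hu.mono hφ.supp).mul hφ.smooth.continuous.continuousOn).integrableOn_compact hφ.compact
  refine (integrableOn_iff_integrable_of_support_subset fun x hx => ?_).1 h1
  exact subset_tsupport φ (right_ne_zero_of_mul hx)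

/-- Integration by parts against a test function. -/
theorem integral_by_parts (hφ : IsTest X φ) {u : Vec n → ℝ}
    (hu : ∀ x ∈ X, DifferentiableAt ℝ u x) (hu' : ContinuousOn (fderiv ℝ u) X) (e : Vec n) :
    ∫ x, u x * fderiv ℝ φ x e = -∫ x, fderiv ℝ u x e * φ x := by
  have hc : ContinuousOn u X := fun x hx => (hu x hx).continuousAt.continuousWithinAt
  exact integral_mul_fderiv_eq_neg_fderiv_mul_of_integrable
    (hφ.integrable_mul (hu'.clm_apply continuousOn_const))
    ((hφ.fderiv_apply e).integrable_mul hc) (hφ.integrable_mul hc)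
    (fun x hx => hu x (hφ.supp hx))
    (fun x _ => (hφ.smooth.differentiable (by simp)) x)

end IsTest

theorem clm_eq_sum {G : Type*} [NormedAddCommGroup G] [NormedSpace ℝ G] (L : Vec n →L[ℝ] G)
    (y : Vec n) : L y = ∑ a, y a • L (basisVec a) := by
  conv_lhs => rw [vec_eq_sum y]
  simp [map_sum]

theorem ContC1.continuousOn_slice {G : Type*} [NormedAddCommGroup G] [NormedSpace ℝ G]
    {h : Vec n → ℝ → G} (hh : ContC1 X h) {t : ℝ} (ht : 0 ≤ t) :
    ContinuousOn (fun x => h x t) X ∧ ContinuousOn (fderiv ℝ fun x => h x t) X :=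
  ⟨hh.cont.comp (f := fun x => (x, t)) (by fun_prop) fun _ hx => ⟨hx, ht⟩,
    hh.cont_fderiv.comp (f := fun x => (x, t)) (by fun_prop) fun _ hx => ⟨hx, ht⟩⟩

namespace FaultSystem

variable {m p q N : ℕ} {S : FaultSystem n m p q N}

/-- The first-order part of the flux: `∇ · (ρ Σ) = ρ (∇ · Σ + Σ ∇ log ρ)`. -/
theorem Regular.sum_fderiv_mul_diffusion (hS : S.Regular) {ρ : Vec n → ℝ → ℝ}
    (hρ : ContC1 S.X ρ) {x : Vec n} (hx : x ∈ S.X) {t : ℝ} (ht : 0 ≤ t) (h0 : ρ x t ≠ 0)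
    (L : Vec n →L[ℝ] ℝ) :
    ∑ a, ∑ b, fderiv ℝ (fun y => ρ y t * S.diffusion y t a b) x (basisVec a) * L (basisVec b) =
      ρ x t * L (S.divDiffusion x t + mulV (S.diffusion x t) (score ρ x t)) := by
  have hsym : ∀ y s a b, S.diffusion y s a b = S.diffusion y s b a := fun y s a b => by
    simp only [diffusion, Matrix.mul_apply, Matrix.transpose_apply, mul_comm]
  have h1 : ∀ a b, fderiv ℝ (fun y => ρ y t * S.diffusion y t a b) x (basisVec a) =
      ρ x t * (fderiv ℝ (fun y => S.diffusion y t b a) x (basisVec a) +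
        S.diffusion x t b a * score ρ x t a) := by
    intro a b
    have h2 := fderiv_fun_mul (hρ.diff t ht x hx) ((hS.contC1_diffusion a b).diff t ht x hx)
    rw [h2, score_apply (hρ.diff t ht x hx) h0]
    have h3 : (fun y => S.diffusion y t a b) = fun y => S.diffusion y t b a :=
      funext fun y => hsym y t a b
    rw [h3, hsym x t a b]
    simp only [add_apply, smul_apply, smul_eq_mul]
    field_simp
  rw [clm_eq_sum L, Finset.mul_sum, Finset.sum_comm]
  refine Finset.sum_congr rfl fun b _ => ?_
  simp only [h1, PiLp.add_apply, mulV_apply, divDiffusion, ← Finset.sum_add_distrib, smul_eq_mul,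
    Finset.sum_mul, Finset.mul_sum]
  exact Finset.sum_congr rfl fun a _ => by ring

theorem divFlux_eq_sum {ρ : Vec n → ℝ → ℝ} {x : Vec n} {t : ℝ}
    (hρ : DifferentiableAt ℝ (fun y => ρ y t) x) (hv : DifferentiableAt ℝ (fun y => v y t) x) :
    divFlux ρ v x t = ∑ a, fderiv ℝ (fun y => ρ y t * v y t a) x (basisVec a) := by
  have h1 : ∀ a, fderiv ℝ (fun y => v y t a) x =
      (EuclideanSpace.proj a : Vec n →L[ℝ] ℝ).comp (fderiv ℝ (fun y => v y t) x) := fun a =>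
    ((EuclideanSpace.proj a : Vec n →L[ℝ] ℝ).hasFDerivAt.comp x hv.hasFDerivAt).fderiv
  have h2 : ∀ a, DifferentiableAt ℝ (fun y => v y t a) x := fun a =>
    ((EuclideanSpace.proj a : Vec n →L[ℝ] ℝ).hasFDerivAt.comp x hv.hasFDerivAt).differentiableAt
  rw [divFlux, traceCLM_apply, clm_eq_sum (fderiv ℝ (fun y => ρ y t) x), Finset.mul_sum,
    ← Finset.sum_add_distrib]
  refine Finset.sum_congr rfl fun a _ => ?_
  rw [fderiv_fun_mul hρ (h2 a), h1]
  simp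

/-- The generator is dual to the divergence of the probability flux: two integrations by parts,
the first of which turns the second-order part into a drift. -/
theorem Regular.integral_generator (hS : S.Regular) (k : Fin (N + 1)) {ρ : Vec n → ℝ → ℝ}
    (hρ : SmoothInSpace 2 S.X ρ) (hpos : ∀ x ∈ S.X, ∀ t, 0 ≤ t → 0 < ρ x t) {φ : Vec n → ℝ}
    (hφ : IsTest S.X φ) {t : ℝ} (ht : 0 ≤ t) :
    ∫ x, ρ x t * generator (S.F k) S.diffusion φ x t =
      -∫ x, divFlux ρ (S.probFlow k ρ) x t * φ x := by
  have hρ1 := hρ.of_two.contC1 hS.isOpen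
  have hF := hS.regField_F k
  have hv := hS.regField_probFlow k hρ hpos
  have hρc := (hρ1.continuousOn_slice ht).1
  have hFc : ContinuousOn (fun x => S.F k x t) S.X := fun x hx =>
    (hF.diff t ht x hx).continuousAt.continuousWithinAt
  have hvc : ContinuousOn (fun x => S.probFlow k ρ x t) S.X := fun x hx =>
    (hv.diff t ht x hx).continuousAt.continuousWithinAt
  have hu : ∀ a b, ContC1 S.X (fun x t => ρ x t * S.diffusion x t a b) := fun a b =>
    hρ1.mul (hS.contC1_diffusion a b)
  have hcoord : ∀ {y : Vec n → Vec n}, ContinuousOn y S.X →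
      ∀ a, ContinuousOn (fun x => y x a) S.X := fun hy a =>
    (EuclideanSpace.proj a : Vec n →L[ℝ] ℝ).continuous.comp_continuousOn hy
  -- the drift part and the second-order part
  have hi1 : Integrable fun x => ∑ a, (ρ x t * S.F k x t a) * fderiv ℝ φ x (basisVec a) :=
    integrable_finsetSum _ fun a _ =>
      (hφ.fderiv_apply (basisVec a)).integrable_mul (hρc.mul (hcoord hFc a))
  have hi2 : ∀ a b, Integrable fun x => (ρ x t * S.diffusion x t a b) *
      fderiv ℝ (fun y => fderiv ℝ φ y (basisVec b)) x (basisVec a) := fun a b =>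
    ((hφ.fderiv_apply (basisVec b)).fderiv_apply (basisVec a)).integrable_mul
      ((hu a b).continuousOn_slice ht).1
  have hi3 : ∀ a b, Integrable fun x => fderiv ℝ (fun y => ρ y t * S.diffusion y t a b) x
      (basisVec a) * fderiv ℝ φ x (basisVec b) := fun a b =>
    (hφ.fderiv_apply (basisVec b)).integrable_mul
      (((hu a b).continuousOn_slice ht).2.clm_apply continuousOn_const)
  have hi4 : ∀ a, Integrable fun x => (ρ x t * S.probFlow k ρ x t a) * fderiv ℝ φ x (basisVec a) :=
    fun a => (hφ.fderiv_apply (basisVec a)).integrable_mul (hρc.mul (hcoord hvc a))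
  have e1 : ∫ x, ρ x t * generator (S.F k) S.diffusion φ x t =
      (∫ x, ∑ a, (ρ x t * S.F k x t a) * fderiv ℝ φ x (basisVec a)) +
        (1 / 2) * ∑ a, ∑ b, ∫ x, (ρ x t * S.diffusion x t a b) *
          fderiv ℝ (fun y => fderiv ℝ φ y (basisVec b)) x (basisVec a) := by
    have : ∀ x, ρ x t * generator (S.F k) S.diffusion φ x t =
        (∑ a, (ρ x t * S.F k x t a) * fderiv ℝ φ x (basisVec a)) +
        (1 / 2) * ∑ a, ∑ b, (ρ x t * S.diffusion x t a b) *
          fderiv ℝ (fun y => fderiv ℝ φ y (basisVec b)) x (basisVec a) := fun x => by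
      rw [generator, clm_eq_sum (fderiv ℝ φ x) (S.F k x t)]
      simp only [mul_add, Finset.mul_sum, smul_eq_mul]
      congr 1
      · exact Finset.sum_congr rfl fun a _ => by ring
      · exact Finset.sum_congr rfl fun a _ => Finset.sum_congr rfl fun b _ => by ring
    simp only [this]
    rw [integral_add hi1 ((integrable_finsetSum _ fun a _ => integrable_finsetSum _ fun b _ =>
      hi2 a b).const_mul _), integral_const_mul, integral_finsetSum _ fun a _ =>
      integrable_finsetSum _ fun b _ => hi2 a b]
    simp only [integral_finsetSum _ fun b _ => hi2 _ b]
  have e2 : ∀ a b, ∫ x, (ρ x t * S.diffusion x t a b) *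
      fderiv ℝ (fun y => fderiv ℝ φ y (basisVec b)) x (basisVec a) =
      -∫ x, fderiv ℝ (fun y => ρ y t * S.diffusion y t a b) x (basisVec a) *
        fderiv ℝ φ x (basisVec b) := fun a b =>
    (hφ.fderiv_apply (basisVec b)).integral_by_parts ((hu a b).diff t ht)
      ((hu a b).continuousOn_slice ht).2 (basisVec a)
  have e3 : ∫ x, ρ x t * generator (S.F k) S.diffusion φ x t =
      ∑ a, ∫ x, (ρ x t * S.probFlow k ρ x t a) * fderiv ℝ φ x (basisVec a) := by
    rw [e1, ← integral_finsetSum _ fun a _ => hi4 a]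
    simp only [e2, Finset.sum_neg_distrib]
    simp only [← integral_finsetSum _ fun b _ => hi3 _ b]
    rw [← integral_finsetSum _ fun a _ => integrable_finsetSum _ fun b _ => hi3 a b, mul_neg,
      ← sub_eq_add_neg, ← integral_const_mul, ← integral_sub hi1 ((integrable_finsetSum _
        fun a _ => integrable_finsetSum _ fun b _ => hi3 a b).const_mul _)]
    refine integral_congr_ae (Eventually.of_forall fun x => ?_)
    simp only
    by_cases hx : x ∈ S.X
    · rw [hS.sum_fderiv_mul_diffusion hρ1 hx ht (hpos x hx t ht).ne' (fderiv ℝ φ x)]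
      have h4 : ∀ y : Vec n, ∑ a, ρ x t * y a * fderiv ℝ φ x (basisVec a) =
          ρ x t * fderiv ℝ φ x y := fun y => by
        rw [clm_eq_sum (fderiv ℝ φ x) y, Finset.mul_sum]
        exact Finset.sum_congr rfl fun a _ => by simp [mul_assoc]
      rw [h4, h4, probFlow, map_sub, map_smul, smul_eq_mul]
      ring
    · have h5 : ∀ e, fderiv ℝ φ x e = 0 := fun e => (hφ.fderiv_apply e).eq_zero hx
      simp [h5]
  have hdiffv : ∀ a, ∀ x ∈ S.X, DifferentiableAt ℝ (fun x => ρ x t * S.probFlow k ρ x t a) x :=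
    fun a x hx => (hρ1.diff t ht x hx).mul
      ((EuclideanSpace.proj a : Vec n →L[ℝ] ℝ).differentiableAt.comp x (hv.diff t ht x hx))
  have hcv : ∀ a, ContinuousOn (fderiv ℝ fun x => ρ x t * S.probFlow k ρ x t a) S.X := by
    intro a
    -- the equicontinuity of the derivative, used at a single time
    have hcF : ContinuousOn (fderiv ℝ fun x => S.probFlow k ρ x t) S.X := by
      intro x hx
      obtain ⟨η₀, hη₀, hsub, hcomp⟩ := exists_cthickening_subset hS.isOpen
        (isCompact_singleton (x := x)) (singleton_subset_iff.2 hx)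
      refine ContinuousAt.continuousWithinAt (Metric.continuousAt_iff.2 fun ε hε => ?_)
      obtain ⟨η, hη, h⟩ := hv.equi _ hcomp hsub t (ε / 2) (half_pos hε)
      refine ⟨min η η₀, lt_min hη hη₀, fun {y} hy => ?_⟩
      have hxK : x ∈ Metric.cthickening η₀ {x} := Metric.self_subset_cthickening _ rfl
      have hyK : y ∈ Metric.cthickening η₀ {x} :=
        closedBall_subset_cthickening' (mem_singleton x) le_rfl
          (Metric.mem_closedBall.2 (hy.le.trans (min_le_right _ _)))
      rw [dist_eq_norm] at hy ⊢
      exact (h y hyK x hxK (hy.le.trans (min_le_left _ _)) t ⟨ht, le_rfl⟩).trans_lt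
        (half_lt_self hε)
    have h6 : ContinuousOn (fun x => ρ x t • (EuclideanSpace.proj a : Vec n →L[ℝ] ℝ).comp
        (fderiv ℝ (fun y => S.probFlow k ρ y t) x) +
        S.probFlow k ρ x t a • fderiv ℝ (fun y => ρ y t) x) S.X :=
      (hρc.smul (continuousOn_const.clm_comp hcF)).add
        ((hcoord hvc a).smul (hρ1.continuousOn_slice ht).2)
    refine h6.congr fun x hx => ?_
    have h7 := ((EuclideanSpace.proj a : Vec n →L[ℝ] ℝ).hasFDerivAt.comp x
      (hv.diff t ht x hx).hasFDerivAt)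
    exact ((hρ1.diff t ht x hx).hasFDerivAt.mul h7).fderiv
  rw [e3]
  simp only [fun a => hφ.integral_by_parts (hdiffv a) (hcv a) (basisVec a),
    Finset.sum_neg_distrib]
  rw [← integral_finsetSum _ fun a _ =>
    hφ.integrable_mul ((hcv a).clm_apply continuousOn_const)]
  congr 1
  refine integral_congr_ae (Eventually.of_forall fun x => ?_)
  simp only
  by_cases hx : x ∈ S.X
  · rw [divFlux_eq_sum (hρ1.diff t ht x hx) (hv.diff t ht x hx), Finset.sum_mul]
  · simp [hφ.eq_zero hx]

end FaultSystem

/-! ### From the martingale problem to the continuity equation -/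

/-- Measurable functions on `X × [0, ∞)` which are bounded on `K × [0, T]` for every compact
`K ⊆ X` and every `T`. -/
structure LocBounded (X : Set (Vec n)) (h : Vec n → ℝ → ℝ) : Prop where
  meas : Measurable ((X ×ˢ Ici (0 : ℝ)).indicator fun z => h z.1 z.2)
  bdd : ∀ K, IsCompact K → K ⊆ X → ∀ T, ∃ C, ∀ x ∈ K, ∀ t ∈ Icc 0 T, ‖h x t‖ ≤ C

namespace LocBounded

variable {h h' : Vec n → ℝ → ℝ}

theorem of_continuousOn (hX : IsOpen X)
    (hh : ContinuousOn (fun z : Vec n × ℝ => h z.1 z.2) (X ×ˢ Ici 0)) : LocBounded X h where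
  meas := measurable_indicator_of_continuousOn hX hh
  bdd _ hK hKX T := (exists_bound_modulus hh hK hKX T).1

theorem add (hh : LocBounded X h) (hh' : LocBounded X h') :
    LocBounded X fun x t => h x t + h' x t where
  meas := by
    convert hh.meas.add hh'.meas using 1
    exact indicator_add _ _ _
  bdd K hK hKX T := by
    obtain ⟨C, hC⟩ := hh.bdd K hK hKX T
    obtain ⟨C', hC'⟩ := hh'.bdd K hK hKX T
    exact ⟨C + C', fun x hx t ht => (norm_add_le _ _).trans (add_le_add (hC x hx t ht)
      (hC' x hx t ht))⟩

theorem mul (hh : LocBounded X h) (hh' : LocBounded X h') :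
    LocBounded X fun x t => h x t * h' x t where
  meas := by
    convert hh.meas.mul hh'.meas using 1
    exact indicator_mul _ _ _
  bdd K hK hKX T := by
    obtain ⟨C, hC⟩ := hh.bdd K hK hKX T
    obtain ⟨C', hC'⟩ := hh'.bdd K hK hKX T
    refine ⟨C * C', fun x hx t ht => (norm_mul_le _ _).trans ?_⟩
    exact mul_le_mul (hC x hx t ht) (hC' x hx t ht) (norm_nonneg _)
      ((norm_nonneg _).trans (hC x hx t ht))

theorem const (hX : IsOpen X) (c : ℝ) : LocBounded X fun _ _ => c :=
  of_continuousOn hX continuousOn_const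

theorem sum {ι : Type*} (hX : IsOpen X) (s : Finset ι) {h : ι → Vec n → ℝ → ℝ}
    (hh : ∀ i, LocBounded X (h i)) : LocBounded X fun x t => ∑ i ∈ s, h i x t := by
  classical
  induction s using Finset.induction_on with
  | empty => simpa using const hX 0
  | insert i s hi ih =>
    simp only [Finset.sum_insert hi]
    exact (hh i).add ih

theorem of_space (hX : IsOpen X) {φ : Vec n → ℝ} (hφ : Continuous φ) :
    LocBounded X fun x _ => φ x :=
  of_continuousOn hX (hφ.comp continuous_fst).continuousOn

end LocBounded

theorem RegField.locBounded_apply (hv : RegField X v) (a : Fin n) :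
    LocBounded X fun x t => v x t a where
  meas := by
    have h1 := (EuclideanSpace.proj a : Vec n →L[ℝ] ℝ).measurable.comp hv.meas
    convert h1 using 1
    exact indicator_comp_of_zero (g := (EuclideanSpace.proj a : Vec n →L[ℝ] ℝ)) (map_zero _)
  bdd K hK hKX T := by
    obtain ⟨C, hC⟩ := hv.bdd K hK hKX T
    exact ⟨C, fun x hx t ht => (PiLp.norm_apply_le _ a).trans (hC x hx t ht).1⟩

theorem RegField.locBounded_trace (hv : RegField X v) :
    LocBounded X fun x t => traceCLM n (fderiv ℝ (fun y => v y t) x) where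
  meas := by
    have h1 := (traceCLM n).measurable.comp hv.meas_fderiv
    convert h1 using 1
    exact indicator_comp_of_zero (g := traceCLM n) (map_zero _)
  bdd K hK hKX T := by
    obtain ⟨C, hC⟩ := hv.bdd K hK hKX T
    exact ⟨‖traceCLM n‖ * C, fun x hx t ht => ((traceCLM n).le_opNorm _).trans
      (mul_le_mul_of_nonneg_left (hC x hx t ht).2 (norm_nonneg _))⟩

theorem RegField.locBounded_divFlux (hv : RegField X v) {ρ : Vec n → ℝ → ℝ} (hρ : ContC1 X ρ) :
    LocBounded X (divFlux ρ v) := by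
  have h1 : divFlux ρ v = fun x t => ρ x t * traceCLM n (fderiv ℝ (fun y => v y t) x) +
      ∑ a, v x t a * fderiv ℝ (fun y => ρ y t) x (basisVec a) := by
    ext x t
    rw [divFlux, clm_eq_sum (fderiv ℝ (fun y => ρ y t) x) (v x t)]
    rfl
  rw [h1]
  exact ((LocBounded.of_continuousOn hv.isOpen hρ.cont).mul hv.locBounded_trace).add
    (LocBounded.sum hv.isOpen _ fun a => (hv.locBounded_apply a).mul
      (LocBounded.of_continuousOn hv.isOpen (hρ.cont_fderiv.clm_apply continuousOn_const)))

namespace LocBounded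

variable {h : Vec n → ℝ → ℝ} {φ : Vec n → ℝ}

/-- Integrability on the product of a compact set and a bounded time interval. -/
theorem integrable_prod (hh : LocBounded X h) {K : Set (Vec n)} (hK : IsCompact K) (hKX : K ⊆ X)
    {s t : ℝ} (hs : 0 ≤ s) :
    Integrable (fun z : Vec n × ℝ => h z.1 z.2)
      ((volume.restrict K).prod (volume.restrict (Ioc s t))) := by
  obtain ⟨C, hC⟩ := hh.bdd K hK hKX t
  have : IsFiniteMeasure (volume.restrict K) := ⟨by simpa using hK.measure_lt_top⟩
  have hae : ∀ᵐ z ∂((volume.restrict K).prod (volume.restrict (Ioc s t))), z ∈ K ×ˢ Ioc s t := by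
    rw [Measure.prod_restrict]
    exact ae_restrict_mem (hK.measurableSet.prod measurableSet_Ioc)
  refine Integrable.of_bound ?_ C ?_
  · refine AEStronglyMeasurable.congr hh.meas.aestronglyMeasurable ?_
    filter_upwards [hae] with z hz
    exact indicator_of_mem (show z ∈ X ×ˢ Ici (0 : ℝ) from ⟨hKX hz.1, hs.trans hz.2.1.le⟩) _
  · filter_upwards [hae] with z hz
    exact hC z.1 hz.1 z.2 ⟨hs.trans hz.2.1.le, hz.2.2⟩

theorem locallyIntegrableOn (hX : IsOpen X) (hh : LocBounded X h) {s t : ℝ} (hs : 0 ≤ s)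
    (hst : s ≤ t) : LocallyIntegrableOn (fun x => ∫ r in s..t, h x r) X := by
  rw [locallyIntegrableOn_iff hX.isLocallyClosed]
  intro K hKX hK
  simp only [intervalIntegral.integral_of_le hst]
  exact (hh.integrable_prod hK hKX hs).integral_prod_left

/-- Fubini's theorem against a test function. -/
theorem integral_integral_mul (hh : LocBounded X h) (hφ : IsTest X φ) {s t : ℝ} (hs : 0 ≤ s)
    (hst : s ≤ t) :
    ∫ r in s..t, ∫ x, h x r * φ x = ∫ x, (∫ r in s..t, h x r) * φ x := by
  have hX : ∀ u : Vec n → ℝ, ∫ x, u x * φ x = ∫ x in tsupport φ, u x * φ x := fun u =>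
    (setIntegral_eq_integral_of_forall_compl_eq_zero fun x hx => by
      rw [image_eq_zero_of_notMem_tsupport hx, mul_zero]).symm
  have hi : Integrable (fun z : Vec n × ℝ => h z.1 z.2 * φ z.1)
      ((volume.restrict (tsupport φ)).prod (volume.restrict (Ioc s t))) := by
    obtain ⟨C, hC⟩ := hφ.compact.exists_bound_of_continuous hφ.smooth.continuous
    exact (hh.integrable_prod hφ.compact hφ.supp hs).mul_bdd
      (hφ.smooth.continuous.comp continuous_fst).aestronglyMeasurable
      (Eventually.of_forall fun z => hC z.1)
  simp only [hX, intervalIntegral.integral_of_le hst]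
  rw [integral_integral_swap (f := fun r x => h x r * φ x) hi.swap]
  simp only [integral_mul_const]

end LocBounded

theorem integral_comp_law {Ω : Type*} [MeasurableSpace Ω] {P : Measure Ω} {Y : Ω → Vec n}
    {ρ : Vec n → ℝ → ℝ} (hX : IsOpen X) (hY : Measurable Y) (hρ : ContC1 X ρ)
    (hρ0 : ∀ x ∈ X, ∀ t, 0 ≤ t → 0 ≤ ρ x t) {t : ℝ} (ht : 0 ≤ t)
    (hlaw : P.map Y = densMeasure X fun x => ρ x t) {u : Vec n → ℝ} (hu : Measurable u) :
    ∫ o, u (Y o) ∂P = ∫ x in X, ρ x t * u x := by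
  rw [← integral_map (φ := Y) hY.aemeasurable hu.aestronglyMeasurable, hlaw, densMeasure,
    integral_withDensity_eq_integral_toReal_smul₀ ?_ (by simp)]
  · refine setIntegral_congr_fun hX.measurableSet fun x hx => ?_
    simp only [smul_eq_mul]
    rw [ENNReal.toReal_ofReal (hρ0 x hx t ht)]
  · exact ((hρ.continuousOn_slice ht).1.aemeasurable hX.measurableSet).ennreal_ofReal

/-- The expected time integral of a locally bounded function along a process with continuous paths,
in terms of the densities of its marginals. -/
theorem LocBounded.integral_path {Ω : Type*} [MeasurableSpace Ω] {P : Measure Ω}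
    [IsProbabilityMeasure P] {Z : ℝ≥0 → Ω → Vec n} {ρ h : Vec n → ℝ → ℝ} (hX : IsOpen X)
    (hh : LocBounded X h) {K : Set (Vec n)} (hK : IsCompact K) (hKX : K ⊆ X)
    (h0 : ∀ x t, x ∉ K → h x t = 0) (hZX : ∀ t o, Z t o ∈ X) (hZc : ∀ o, Continuous fun t => Z t o)
    (hZm : ∀ t, Measurable (Z t)) (hρ : ContC1 X ρ) (hρ0 : ∀ x ∈ X, ∀ t, 0 ≤ t → 0 ≤ ρ x t)
    (hlaw : ∀ t : ℝ≥0, P.map (Z t) = densMeasure X fun x => ρ x t) {s t : ℝ} (hs : 0 ≤ s)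
    (hst : s ≤ t) :
    (∀ o, IntervalIntegrable (fun r => h (Z r.toNNReal o) r) volume s t) ∧
    ∫ o, (∫ r in s..t, h (Z r.toNNReal o) r) ∂P = ∫ r in s..t, ∫ x, ρ x r * h x r := by
  obtain ⟨C, hC⟩ := hh.bdd K hK hKX t
  -- `h` is controlled on `K`, and vanishes off `K`
  have hCb : ∀ x, ∀ r ∈ Ioc s t, ‖h x r‖ ≤ max C 0 := by
    intro x r hr
    by_cases hx : x ∈ K
    · exact (hC x hx r ⟨hs.trans hr.1.le, hr.2⟩).trans (le_max_left _ _)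
    · rw [h0 x r hx, norm_zero]; exact le_max_right _ _
  have hZj : Measurable fun z : ℝ × Ω => Z z.1.toNNReal z.2 :=
    (measurable_uncurry_of_continuous_of_measurable (u := Z) hZc hZm).comp
      ((measurable_real_toNNReal.comp measurable_fst).prodMk measurable_snd)
  set H := (X ×ˢ Ici (0 : ℝ)).indicator fun z => h z.1 z.2 with hH
  have hHm : Measurable fun z : ℝ × Ω => H (Z z.1.toNNReal z.2, z.1) :=
    hh.meas.comp (hZj.prodMk measurable_fst)
  have hHeq : ∀ r, 0 ≤ r → ∀ x ∈ X, H (x, r) = h x r := fun r hr x hx =>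
    indicator_of_mem (show (x, r) ∈ X ×ˢ Ici (0 : ℝ) from ⟨hx, hr⟩) _
  have hprod : Integrable (fun z : ℝ × Ω => h (Z z.1.toNNReal z.2) z.1)
      ((volume.restrict (Ioc s t)).prod P) := by
    have hae : ∀ᵐ z ∂((volume.restrict (Ioc s t)).prod P), z.1 ∈ Ioc s t :=
      Measure.quasiMeasurePreserving_fst.ae (ae_restrict_mem measurableSet_Ioc)
    refine Integrable.of_bound ?_ (max C 0) ?_
    · refine hHm.aestronglyMeasurable.congr ?_
      filter_upwards [hae] with z hz using hHeq _ (hs.trans hz.1.le) _ (hZX _ _)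
    · filter_upwards [hae] with z hz using hCb _ _ hz
  refine ⟨fun o => intervalIntegrable_of_bound (C := max C 0) hst ?_ fun r hr => hCb _ r hr, ?_⟩
  · refine (hHm.comp (measurable_prodMk_right (y := o))).aestronglyMeasurable.congr ?_
    rw [EventuallyEq, ae_restrict_iff' measurableSet_Ioc]
    exact Eventually.of_forall fun r hr => hHeq _ (hs.trans hr.1.le) _ (hZX _ _)
  · simp only [intervalIntegral.integral_of_le hst]
    rw [integral_integral_swap (f := fun (o : Ω) (r : ℝ) => h (Z r.toNNReal o) r) hprod.swap]
    refine setIntegral_congr_fun measurableSet_Ioc fun r hr => ?_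
    have hr0 : 0 ≤ r := hs.trans hr.1.le
    have h1 : ∫ o, h (Z r.toNNReal o) r ∂P = ∫ o, H (Z r.toNNReal o, r) ∂P :=
      integral_congr_ae (Eventually.of_forall fun o => (hHeq r hr0 _ (hZX _ _)).symm)
    rw [h1, integral_comp_law hX (hZm _) hρ hρ0 hr0 (by simpa [hr0] using hlaw r.toNNReal)
      (u := fun x => H (x, r)) (hh.meas.comp measurable_prodMk_right),
      ← setIntegral_eq_integral_of_forall_compl_eq_zero (s := X)
        (f := fun x => ρ x r * h x r) fun x hx => by rw [h0 x r fun hK => hx (hKX hK), mul_zero]]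
    refine setIntegral_congr_fun hX.measurableSet fun x hx => ?_
    simp only [hHeq r hr0 x hx]

namespace FaultSystem

variable {m p q N : ℕ} {S : FaultSystem n m p q N}

theorem Regular.locBounded_generator (hS : S.Regular) (k : Fin (N + 1)) {φ : Vec n → ℝ}
    (hφ : IsTest S.X φ) : LocBounded S.X (generator (S.F k) S.diffusion φ) := by
  have hX := hS.isOpen
  have h1 : generator (S.F k) S.diffusion φ = fun x t =>
      ∑ a, S.F k x t a * fderiv ℝ φ x (basisVec a) + (1 / 2) * ∑ a, ∑ b, S.diffusion x t a b *
        fderiv ℝ (fun y => fderiv ℝ φ y (basisVec b)) x (basisVec a) := by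
    ext x t
    rw [generator, clm_eq_sum (fderiv ℝ φ x) (S.F k x t)]
    rfl
  rw [h1]
  exact (LocBounded.sum hX _ fun a => ((hS.regField_F k).locBounded_apply a).mul
      (.of_space hX (hφ.fderiv_apply _).smooth.continuous)).add
    ((LocBounded.const hX _).mul (LocBounded.sum hX _ fun a => LocBounded.sum hX _ fun b =>
      (LocBounded.of_continuousOn hX (hS.contC1_diffusion a b).cont).mul
        (.of_space hX ((hφ.fderiv_apply _).fderiv_apply _).smooth.continuous)))

theorem generator_eq_zero {F : Vec n → ℝ → Vec n} {A : Vec n → ℝ → Matrix (Fin n) (Fin n) ℝ}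
    {φ : Vec n → ℝ} {x : Vec n} (hx : x ∉ tsupport φ) (t : ℝ) : generator F A φ x t = 0 := by
  have h1 : ∀ e, fderiv ℝ φ x e = 0 := fun e =>
    image_eq_zero_of_notMem_tsupport (f := fun x => fderiv ℝ φ x e) fun h =>
      hx (tsupport_fderiv_apply_subset ℝ (f := φ) e h)
  have h2 : ∀ e e', fderiv ℝ (fun y => fderiv ℝ φ y e) x e' = 0 := fun e e' =>
    image_eq_zero_of_notMem_tsupport (f := fun x => fderiv ℝ (fun y => fderiv ℝ φ y e) x e')
      fun h =>
      hx (tsupport_fderiv_apply_subset ℝ (f := φ) e (tsupport_fderiv_apply_subset ℝ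
        (f := fun y => fderiv ℝ φ y e) e' h))
  simp [generator, h1, h2]

/-- The marginals of a solution of the stochastic equation solve the continuity equation of the
probability flow: the martingale property gives the Fokker-Planck equation in the sense of
distributions, where both sides are locally integrable functions, so that they agree almost
everywhere. -/
theorem IsMarginal.solvesContinuity (hS : S.Regular) {k : Fin (N + 1)} {ρ₀ : Vec n → ℝ}
    {Ω : Type*} [MeasurableSpace Ω] {P : Measure Ω} {Z : ℝ≥0 → Ω → Vec n} {ρ : Vec n → ℝ → ℝ}
    (hM : S.IsMarginal k ρ₀ P Z ρ) : SolvesContinuity S.X ρ (S.probFlow k ρ) := by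
  intro s t hs hst
  have ht := hs.trans hst
  have hX := hS.isOpen
  have hP := hM.solution.isProbabilityMeasure
  obtain ⟨𝓕, had, hmart⟩ := hM.solution.martingale
  have hZm : ∀ t, Measurable (Z t) := fun t => (had t).mono (𝓕.le t) le_rfl
  have hρ1 := hM.smooth.of_two.contC1 hX
  have hρ0 : ∀ x ∈ S.X, ∀ t, 0 ≤ t → 0 ≤ ρ x t := fun x hx t ht => (hM.pos x hx t ht).le
  have hflux := (hS.regField_probFlow k hM.smooth hM.pos).locBounded_divFlux hρ1
  have hloc : ∀ r, 0 ≤ r → LocallyIntegrableOn (fun x => ρ x r) S.X := fun r hr =>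
    (hρ1.continuousOn_slice hr).1.locallyIntegrableOn hX.measurableSet
  have hmain : ∀ φ : Vec n → ℝ, IsTest S.X φ →
      ∫ x, (ρ x t - ρ x s + ∫ r in s..t, divFlux ρ (S.probFlow k ρ) x r) * φ x = 0 := by
    intro φ hφ
    have hgen := hS.locBounded_generator k hφ
    have hpath := fun a b (ha : 0 ≤ a) (hab : a ≤ b) => hgen.integral_path hX hφ.compact hφ.supp
      (fun x r hx => generator_eq_zero hx r) hM.solution.mem hM.solution.continuous hZm hρ1 hρ0
      hM.law ha hab
    have hφm : ∀ r, Integrable (fun o => φ (Z r o)) P := fun r => by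
      obtain ⟨C, hC⟩ := hφ.compact.exists_bound_of_continuous hφ.smooth.continuous
      exact Integrable.of_bound (hφ.smooth.continuous.measurable.comp (hZm r)).aestronglyMeasurable
        C (Eventually.of_forall fun o => hC _)
    have hφl : ∀ r, 0 ≤ r → ∫ o, φ (Z r.toNNReal o) ∂P = ∫ x, ρ x r * φ x := fun r hr => by
      rw [integral_comp_law hX (hZm _) hρ1 hρ0 hr (by simpa [hr] using hM.law r.toNNReal)
        hφ.smooth.continuous.measurable]
      exact setIntegral_eq_integral_of_forall_compl_eq_zero fun x hx => by
        rw [hφ.eq_zero hx, mul_zero]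
    -- the martingale property between the times `s` and `t`
    have hMt := hmart φ hφ.smooth hφ.compact hφ.supp
    set G : ℝ → Ω → ℝ := fun r o => generator (S.F k) S.diffusion φ (Z r.toNNReal o) r with hG
    set M : ℝ≥0 → Ω → ℝ := fun u o => φ (Z u o) - φ (Z 0 o) - ∫ r in (0 : ℝ)..u, G r o with hMdef
    have hMt' : Martingale M 𝓕 P := hMt
    have hdiff : ∀ o, ∫ r in s..t, G r o = φ (Z t.toNNReal o) - φ (Z s.toNNReal o) -
        (M t.toNNReal o - M s.toNNReal o) := fun o => by
      simp only [hMdef, Real.coe_toNNReal t ht, Real.coe_toNNReal s hs]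
      rw [← intervalIntegral.integral_interval_sub_left ((hpath 0 t le_rfl ht).1 o)
        ((hpath 0 s le_rfl hs).1 o)]
      ring
    have hE : ∫ o, M s.toNNReal o ∂P = ∫ o, M t.toNNReal o ∂P := by
      simpa using hMt'.setIntegral_eq (Real.toNNReal_le_toNNReal hst) MeasurableSet.univ
    have hEG : ∫ o, (∫ r in s..t, G r o) ∂P = (∫ x, ρ x t * φ x) - ∫ x, ρ x s * φ x := by
      have hd1 : Integrable (fun o => φ (Z t.toNNReal o) - φ (Z s.toNNReal o)) P :=
        (hφm _).sub (hφm _)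
      have hd2 : Integrable (fun o => M t.toNNReal o - M s.toNNReal o) P :=
        (hMt'.integrable _).sub (hMt'.integrable _)
      simp only [hdiff]
      rw [integral_sub hd1 hd2,
        integral_sub (hφm _) (hφm _), integral_sub (hMt'.integrable _) (hMt'.integrable _), hE,
        sub_self, sub_zero, hφl t ht, hφl s hs]
    have hkey : (∫ x, ρ x t * φ x) - ∫ x, ρ x s * φ x =
        -∫ x, (∫ r in s..t, divFlux ρ (S.probFlow k ρ) x r) * φ x := by
      rw [← hEG, (hpath s t hs hst).2, ← hflux.integral_integral_mul hφ hs hst,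
        ← intervalIntegral.integral_neg]
      refine intervalIntegral.integral_congr fun r hr => ?_
      rw [uIcc_of_le hst] at hr
      exact hS.integral_generator k hM.smooth hM.pos hφ (hs.trans hr.1)
    have hi : ∀ r, 0 ≤ r → Integrable fun x => ρ x r * φ x := fun r hr =>
      hφ.integrable_mul (hρ1.continuousOn_slice hr).1
    have hi' : Integrable fun x => (∫ r in s..t, divFlux ρ (S.probFlow k ρ) x r) * φ x := by
      obtain ⟨C, hC⟩ := hφ.compact.exists_bound_of_continuous hφ.smooth.continuous
      have h1 := ((hflux.locallyIntegrableOn hX hs hst).integrableOn_compact_subset hφ.supp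
        hφ.compact).mul_bdd (g := φ) hφ.smooth.continuous.aestronglyMeasurable
          (Eventually.of_forall hC)
      exact (integrableOn_iff_integrable_of_support_subset fun x hx =>
        subset_tsupport φ (right_ne_zero_of_mul hx)).1 h1
    simp only [add_mul, sub_mul]
    have hd : Integrable (fun x => ρ x t * φ x - ρ x s * φ x) := (hi t ht).sub (hi s hs)
    rw [integral_add hd hi', integral_sub (hi t ht) (hi s hs), hkey,
      neg_add_cancel]
  have hzero := hX.ae_eq_zero_of_integral_contDiff_smul_eq_zero
    (((hloc t ht).sub (hloc s hs)).add (hflux.locallyIntegrableOn hX hs hst))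
    fun φ h1 h2 h3 => by
      rw [← hmain φ ⟨h1, h2, h3⟩]
      exact integral_congr_ae (Eventually.of_forall fun x => by simp [mul_comm])
  rw [ae_restrict_iff' hX.measurableSet]
  filter_upwards [hzero] with x hx hxX
  have := hx hxX
  simp only [Pi.add_apply, Pi.sub_apply] at this
  linarith

theorem IsMarginal.isProbabilityMeasure {k : Fin (N + 1)} {ρ₀ : Vec n → ℝ}
    {Ω : Type*} [MeasurableSpace Ω] {P : Measure Ω} {Z : ℝ≥0 → Ω → Vec n} {ρ : Vec n → ℝ → ℝ}
    (hM : S.IsMarginal k ρ₀ P Z ρ) {t : ℝ} (ht : 0 ≤ t) :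
    IsProbabilityMeasure (densMeasure S.X fun x => ρ x t) := by
  have hP := hM.solution.isProbabilityMeasure
  obtain ⟨𝓕, had, -⟩ := hM.solution.martingale
  have hZm : Measurable (Z t.toNNReal) := (had _).mono (𝓕.le _) le_rfl
  have h1 := hM.law t.toNNReal
  rw [Real.coe_toNNReal t ht] at h1
  rw [← h1]
  exact Measure.isProbabilityMeasure_map hZm.aemeasurable

/-- The probability flow transports the initial density to the marginal densities. -/
theorem IsMarginal.map_flow (hS : S.Regular) {k : Fin (N + 1)} {ρ₀ : Vec n → ℝ}
    {Ω : Type*} [MeasurableSpace Ω] {P : Measure Ω} {Z : ℝ≥0 → Ω → Vec n} {ρ : Vec n → ℝ → ℝ}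
    (hM : S.IsMarginal k ρ₀ P Z ρ) {Φ : ℝ → ℝ → Vec n → Vec n}
    (hΦ : IsFlow S.X (S.probFlow k ρ) Φ) {t : ℝ} (ht : 0 ≤ t) :
    (densMeasure S.X ρ₀).map (Φ 0 t) = densMeasure S.X fun x => ρ x t := by
  have h0 : densMeasure S.X ρ₀ = densMeasure S.X fun x => ρ x 0 := by
    refine withDensity_congr_ae ?_
    rw [EventuallyEq, ae_restrict_iff' hS.isOpen.measurableSet]
    exact Eventually.of_forall fun x hx => by simp only [hM.initial x hx]
  have hρ : RegDensity S.X ρ :=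
    { hM.smooth.of_two.contC1 hS.isOpen with nonneg := fun x hx t ht => (hM.pos x hx t ht).le }
  rw [h0]
  exact hΦ.map_densMeasure (hS.regField_probFlow k hM.smooth hM.pos) hρ (hM.solvesContinuity hS) ht
    (hM.isProbabilityMeasure le_rfl) (hM.isProbabilityMeasure ht)

end FaultSystem

/-! ### Couplings with bounded displacement -/

/-- There is a coupling of `μ` and `ν` under which the two components are at distance at most `D`
almost surely, so that the `∞`-Wasserstein distance is at most `D`. -/
def CoupledWithin (D : ℝ) (μ ν : Measure (Vec n)) : Prop :=
  ∃ π ∈ couplings μ ν, IsProbabilityMeasure π ∧ ∀ᵐ z ∂π, ‖z.1 - z.2‖ ≤ D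

theorem CoupledWithin.mono {D D' : ℝ} {μ ν : Measure (Vec n)} (h : CoupledWithin D μ ν)
    (hD : D ≤ D') : CoupledWithin D' μ ν := by
  obtain ⟨π, hπ, hp, hae⟩ := h
  exact ⟨π, hπ, hp, hae.mono fun z hz => hz.trans hD⟩

theorem CoupledWithin.W2_le {D : ℝ} {μ ν : Measure (Vec n)} (h : CoupledWithin D μ ν) :
    W2 μ ν ≤ ENNReal.ofReal D := by
  obtain ⟨π, hπ, hp, hae⟩ := h
  have h1 : ∫⁻ z, ‖z.1 - z.2‖ₑ ^ 2 ∂π ≤ ENNReal.ofReal D ^ 2 := by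
    calc ∫⁻ z, ‖z.1 - z.2‖ₑ ^ 2 ∂π ≤ ∫⁻ _, ENNReal.ofReal D ^ 2 ∂π := by
          refine lintegral_mono_ae ?_
          filter_upwards [hae] with z hz
          rw [← ofReal_norm]
          gcongr
      _ = _ := by simp
  calc W2 μ ν ≤ (ENNReal.ofReal D ^ 2) ^ (1 / 2 : ℝ) :=
        ENNReal.rpow_le_rpow ((iInf₂_le π hπ).trans h1) (by norm_num)
    _ = ENNReal.ofReal D := by
        rw [← ENNReal.rpow_natCast, ← ENNReal.rpow_mul]
        norm_num

theorem coupledWithin_map {D : ℝ} {μ : Measure (Vec n)} [IsProbabilityMeasure μ]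
    {f g : Vec n → Vec n} (hf : AEMeasurable f μ) (hg : AEMeasurable g μ)
    (h : ∀ᵐ x ∂μ, ‖f x - g x‖ ≤ D) : CoupledWithin D (μ.map f) (μ.map g) := by
  have hfg : AEMeasurable (fun x => (f x, g x)) μ := hf.prodMk hg
  refine ⟨μ.map fun x => (f x, g x), ⟨?_, ?_⟩, Measure.isProbabilityMeasure_map hfg, ?_⟩
  · rw [AEMeasurable.map_map_of_aemeasurable measurable_fst.aemeasurable hfg]; rfl
  · rw [AEMeasurable.map_map_of_aemeasurable measurable_snd.aemeasurable hfg]; rfl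
  · rw [ae_map_iff hfg (measurableSet_le (by fun_prop) measurable_const)]
    exact h

theorem isTightMeasureSet_range_of_tendsto {μs : ℕ → ProbabilityMeasure (Vec n)}
    {μ : ProbabilityMeasure (Vec n)} (h : Tendsto μs atTop (𝓝 μ)) :
    IsTightMeasureSet {((ν : ProbabilityMeasure (Vec n)) : Measure (Vec n)) | ν ∈ range μs} :=
  isTightMeasureSet_of_isCompact_closure
    (h.isCompact_insert_range.closure_of_subset (subset_insert _ _))

/-- Couplings with bounded displacement persist in the weak limit: by Prokhorov's theorem the
couplings accumulate at a coupling of the limits, and the closed set of pairs at distance at most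
`D` keeps its full mass. -/
theorem coupledWithin_of_tendsto {D : ℝ} {μs νs : ℕ → ProbabilityMeasure (Vec n)}
    {μ ν : ProbabilityMeasure (Vec n)} (hμ : Tendsto μs atTop (𝓝 μ)) (hν : Tendsto νs atTop (𝓝 ν))
    (h : ∀ k, CoupledWithin D (μs k : Measure (Vec n)) (νs k)) :
    CoupledWithin D (μ : Measure (Vec n)) ν := by
  choose π hπ hp hae using h
  set π' : ℕ → ProbabilityMeasure (Vec n × Vec n) := fun k => ⟨π k, hp k⟩ with hπ'
  have hfst : ∀ k, (π' k).map measurable_fst.aemeasurable = μs k := fun k =>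
    Subtype.ext (hπ k).1
  have hsnd : ∀ k, (π' k).map measurable_snd.aemeasurable = νs k := fun k =>
    Subtype.ext (hπ k).2
  have htight : IsTightMeasureSet
      {((ν : ProbabilityMeasure (Vec n × Vec n)) : Measure (Vec n × Vec n)) | ν ∈ range π'} := by
    refine IsTightMeasureSet.prodMk
      ((isTightMeasureSet_range_of_tendsto hμ).subset ?_)
      ((isTightMeasureSet_range_of_tendsto hν).subset ?_)
    · rintro _ ⟨_, ⟨_, ⟨k, rfl⟩, rfl⟩, rfl⟩
      exact ⟨μs k, mem_range_self k, (hπ k).1.symm⟩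
    · rintro _ ⟨_, ⟨_, ⟨k, rfl⟩, rfl⟩, rfl⟩
      exact ⟨νs k, mem_range_self k, (hπ k).2.symm⟩
  have hcomp := isCompact_closure_of_isTightMeasureSet htight
  -- an ultrafilter limit serves as accumulation point, without metrizing the weak topology
  set U : Ultrafilter ℕ := Ultrafilter.of atTop with hU
  have hUle : (U : Filter ℕ) ≤ atTop := Ultrafilter.of_le atTop
  obtain ⟨π₀, -, hlim⟩ := isCompact_iff_ultrafilter_le_nhds.1 hcomp (U.map π')
    (le_principal_iff.2 (mem_of_superset (Filter.image_mem_map univ_mem)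
      (by rw [image_univ]; exact subset_closure)))
  have hlim' : Tendsto π' U (𝓝 π₀) := hlim
  refine ⟨π₀, ⟨?_, ?_⟩, π₀.2, ?_⟩
  · have h1 := ProbabilityMeasure.tendsto_map_of_tendsto_of_continuous π' π₀ hlim' continuous_fst
    have h2 := tendsto_nhds_unique (h1.congr fun k => hfst k) (hμ.mono_left hUle)
    exact congrArg Subtype.val h2
  · have h1 := ProbabilityMeasure.tendsto_map_of_tendsto_of_continuous π' π₀ hlim' continuous_snd
    have h2 := tendsto_nhds_unique (h1.congr fun k => hsnd k) (hν.mono_left hUle)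
    exact congrArg Subtype.val h2
  · have hF : IsClosed {z : Vec n × Vec n | ‖z.1 - z.2‖ ≤ D} :=
      isClosed_le (by fun_prop) continuous_const
    have h1 := ProbabilityMeasure.limsup_measure_closed_le_of_tendsto hlim' hF
    have h2 : ∀ k, (π' k : Measure (Vec n × Vec n)) {z | ‖z.1 - z.2‖ ≤ D} = 1 := fun k => by
      have := hp k
      exact (mem_ae_iff_prob_eq_one hF.measurableSet).1 (hae k)
    simp only [h2, limsup_const] at h1
    exact (mem_ae_iff_prob_eq_one hF.measurableSet).2 (le_antisymm prob_le_one h1)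

theorem coupledWithin_of_convergesWeakly {D : ℝ} {μs νs : ℝ → Measure (Vec n)}
    {μ ν : Measure (Vec n)} [IsProbabilityMeasure μ] [IsProbabilityMeasure ν]
    (hμ : ConvergesWeakly μs μ) (hν : ConvergesWeakly νs ν)
    (h : ∀ t, 0 ≤ t → CoupledWithin D (μs t) (νs t)) : CoupledWithin D μ ν := by
  have hp : ∀ k : ℕ, IsProbabilityMeasure (μs k) ∧ IsProbabilityMeasure (νs k) := fun k => by
    obtain ⟨π, ⟨h1, h2⟩, hp, -⟩ := h k k.cast_nonneg
    rw [← h1, ← h2]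
    exact ⟨Measure.isProbabilityMeasure_map measurable_fst.aemeasurable,
      Measure.isProbabilityMeasure_map measurable_snd.aemeasurable⟩
  refine coupledWithin_of_tendsto (μs := fun k => ⟨μs k, (hp k).1⟩)
    (νs := fun k => ⟨νs k, (hp k).2⟩) (μ := ⟨μ, inferInstance⟩) (ν := ⟨ν, inferInstance⟩)
    ?_ ?_ fun k => h k k.cast_nonneg
  · exact ProbabilityMeasure.tendsto_iff_forall_integral_tendsto.2 fun φ =>
      (hμ φ).comp tendsto_natCast_atTop_atTop
  · exact ProbabilityMeasure.tendsto_iff_forall_integral_tendsto.2 fun φ =>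
      (hν φ).comp tendsto_natCast_atTop_atTop

/-- The density of the pushforward represents the pushforward whenever the latter is given by a
density on `X`. -/
theorem densMeasure_pfDensity (hX : MeasurableSet X) {T : Vec n → Vec n} {ρ η : Vec n → ℝ}
    (hη : AEMeasurable η (volume.restrict X))
    (h : (densMeasure X ρ).map T = densMeasure X η) :
    densMeasure X (pfDensity X T ρ) = densMeasure X η := by
  refine withDensity_congr_ae ?_
  have h1 : densMeasure X η = volume.withDensity (X.indicator fun x => ENNReal.ofReal (η x)) :=
    (withDensity_indicator hX _).symm
  have h2 : AEMeasurable (X.indicator fun x => ENNReal.ofReal (η x)) volume :=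
    (aemeasurable_indicator_iff hX).2 hη.ennreal_ofReal
  have h3 := Measure.rnDeriv_withDensity₀ volume h2
  rw [EventuallyEq, ae_restrict_iff' hX]
  filter_upwards [h3] with x hx hxX
  rw [pfDensity, h, h1, hx, indicator_of_mem hxX, ENNReal.ofReal_toReal ENNReal.ofReal_ne_top]

theorem integral_exp_mul_sub_le {α t : ℝ} (hα : α < 0) :
    ∫ r in (0 : ℝ)..t, Real.exp (α * (t - r)) ≤ 1 / |α| := by
  rw [intervalIntegral.integral_comp_sub_left (fun r => Real.exp (α * r)),
    intervalIntegral.integral_comp_mul_left (fun r => Real.exp r) hα.ne, integral_exp,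
    abs_of_neg hα, smul_eq_mul, sub_self, sub_zero, mul_zero, Real.exp_zero]
  have h1 := Real.exp_pos (α * t)
  have h2 : α⁻¹ * (Real.exp (α * t) - 1) = 1 / (-α) - Real.exp (α * t) / (-α) := by
    field_simp
    ring
  rw [h2]
  exact sub_le_self _ (div_nonneg h1.le (by linarith))

/-! ### Coupling of the marginals by the probability flows -/

namespace FaultSystem

variable {m p q N : ℕ} {S : FaultSystem n m p q N}

/-- The marginals of two stochastic systems with a common initial density are coupled by the two
probability flows. -/
theorem IsMarginal.coupledWithin (hS : S.Regular) {i j : Fin (N + 1)} {ρ₀ : Vec n → ℝ}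
    {Ωi Ωj : Type*} [MeasurableSpace Ωi] [MeasurableSpace Ωj] {Pi : Measure Ωi} {Pj : Measure Ωj}
    {Zi : ℝ≥0 → Ωi → Vec n} {Zj : ℝ≥0 → Ωj → Vec n} {ρi ρj : Vec n → ℝ → ℝ}
    (hρi : S.IsMarginal i ρ₀ Pi Zi ρi) (hρj : S.IsMarginal j ρ₀ Pj Zj ρj)
    {Φi Φj : ℝ → ℝ → Vec n → Vec n}
    (hΦi : IsFlow S.X (S.probFlow i ρi) Φi) (hΦj : IsFlow S.X (S.probFlow j ρj) Φj)
    {t D : ℝ} (ht : 0 ≤ t) (h : ∀ x ∈ S.X, ‖Φi 0 t x - Φj 0 t x‖ ≤ D) :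
    CoupledWithin D (densMeasure S.X fun x => ρi x t) (densMeasure S.X fun x => ρj x t) := by
  have hX := hS.isOpen.measurableSet
  have hac : densMeasure S.X ρ₀ ≪ volume.restrict S.X := withDensity_absolutelyContinuous _ _
  have hm := hρi.map_flow hS hΦi ht
  have hi : AEMeasurable (Φi 0 t) (densMeasure S.X ρ₀) :=
    ((hΦi.continuousOn_space (hS.regField_probFlow i hρi.smooth hρi.pos) le_rfl ht).aemeasurable
      hX).mono_ac hac
  have hj : AEMeasurable (Φj 0 t) (densMeasure S.X ρ₀) :=
    ((hΦj.continuousOn_space (hS.regField_probFlow j hρj.smooth hρj.pos) le_rfl ht).aemeasurable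
      hX).mono_ac hac
  have hp : IsProbabilityMeasure (densMeasure S.X ρ₀) := by
    have h1 := hρi.isProbabilityMeasure ht
    rw [← hm] at h1
    exact ⟨by rw [← h1.measure_univ, Measure.map_apply_of_aemeasurable hi MeasurableSet.univ,
      preimage_univ]⟩
  rw [← hm, ← hρj.map_flow hS hΦj ht]
  refine coupledWithin_map hi hj (hac.ae_le ?_)
  exact (ae_restrict_iff' hX).2 (Eventually.of_forall h)

theorem IsMarginal.densMeasure_pfDensity (hS : S.Regular) {k : Fin (N + 1)} {ρ₀ : Vec n → ℝ}
    {Ω : Type*} [MeasurableSpace Ω] {P : Measure Ω} {Z : ℝ≥0 → Ω → Vec n} {ρ : Vec n → ℝ → ℝ}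
    (hM : S.IsMarginal k ρ₀ P Z ρ) {Φ : ℝ → ℝ → Vec n → Vec n}
    (hΦ : IsFlow S.X (S.probFlow k ρ) Φ) {t : ℝ} (ht : 0 ≤ t) :
    densMeasure S.X (pfDensity S.X (Φ 0 t) ρ₀) = densMeasure S.X fun x => ρ x t := by
  have hX := hS.isOpen.measurableSet
  exact FaultDetection.densMeasure_pfDensity hX
    (((hM.smooth.of_two.contC1 hS.isOpen).continuousOn_slice ht).1.aemeasurable hX)
    (hM.map_flow hS hΦ ht)

end FaultSystem

end FaultDetection

theorem theorem3 {n m p q N : ℕ} (S : FaultSystem n m p q N) (hS : S.Regular)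
    (i j : Fin (N + 1))
    -- the common initial density and the marginals of the two stochastic systems
    (ρ₀ : Vec n → ℝ) (hρ₀ : ρ₀ ∈ admissibleDensities S.X)
    {Ωi Ωj : Type*} [MeasurableSpace Ωi] [MeasurableSpace Ωj]
    (Pi : Measure Ωi) (Pj : Measure Ωj) (Zi : ℝ≥0 → Ωi → Vec n) (Zj : ℝ≥0 → Ωj → Vec n)
    (ρi ρj : Vec n → ℝ → ℝ)
    (hρi : S.IsMarginal i ρ₀ Pi Zi ρi) (hρj : S.IsMarginal j ρ₀ Pj Zj ρj)
    -- the flows of the two probability-flow equations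
    (Φi Φj : ℝ → ℝ → Vec n → Vec n)
    (hΦi : IsFlow S.X (S.probFlow i ρi) Φi) (hΦj : IsFlow S.X (S.probFlow j ρj) Φj)
    -- the bounds on the fault matrix, the diffusion matrix and the score difference
    (ψbar σbar sbar : ℝ)
    (hψ : ∀ x ∈ S.X, ∀ t, 0 ≤ t → frob (S.ψ x t) ≤ ψbar)
    (hσ : ∀ x ∈ S.X, ∀ t, 0 ≤ t → frob (S.diffusion x t) ≤ σbar)
    (hs : ∀ x ∈ S.X, ∀ t, 0 ≤ t → ‖score ρj x t - score ρi x t‖ ≤ sbar)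
    -- contraction of the probability flow of the fault `i`
    (Θ : Vec n → ℝ → Matrix (Fin n) (Fin n) ℝ) (α mlo mhi : ℝ)
    (hΘ : IsContracting S.X (S.probFlow i ρi) Θ α mlo mhi)
    (Δw : ℝ) (hΔw : IsLUB ((fun t => ‖S.w i t - S.w j t‖) '' Ici 0) Δw)
    (κ dbar : ℝ) (hκ : κ = Real.sqrt (mhi / mlo))
    (hdbar : dbar = ψbar * Δw + 1 / 2 * σbar * sbar) :
    (∀ t, 0 ≤ t → W2dens S.X (fun x => ρi x t) (fun x => ρj x t) ≤
      ENNReal.ofReal (κ * dbar * ∫ r in (0 : ℝ)..t, Real.exp (α * (t - r)))) ∧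
    (∀ T ε : ℝ, 0 ≤ T → Identifiable S.X Φi Φj ε ρ₀ 0 T →
      ε ≤ κ * dbar * ∫ r in (0 : ℝ)..T, Real.exp (α * (T - r))) ∧
    (α < 0 →
      limsup (fun t => W2dens S.X (fun x => ρi x t) (fun x => ρj x t)) atTop ≤
        ENNReal.ofReal (κ * dbar / |α|) ∧
      ∀ μ ν : Measure (Vec n), IsProbabilityMeasure μ → IsProbabilityMeasure ν →
        ConvergesWeakly (fun t => densMeasure S.X (fun x => ρi x t)) μ →
        ConvergesWeakly (fun t => densMeasure S.X (fun x => ρj x t)) ν →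
        W2 μ ν ≤ ENNReal.ofReal (κ * dbar / |α|)) := by
  have hvi := hS.regField_probFlow i hρi.smooth hρi.pos
  have hd : ∀ x ∈ S.X, ∀ t, 0 ≤ t → ‖S.probFlow i ρi x t - S.probFlow j ρj x t‖ ≤ dbar :=
    fun x hx t ht => hdbar ▸ FaultSystem.norm_probFlow_sub_le (hψ x hx t ht) (hσ x hx t ht)
      (hs x hx t ht) (hΔw.1 (mem_image_of_mem _ ht))
  have hdist : ∀ t, 0 ≤ t → ∀ x ∈ S.X, ‖Φi 0 t x - Φj 0 t x‖ ≤
      κ * dbar * ∫ r in (0 : ℝ)..t, Real.exp (α * (t - r)) := fun t ht x hx => by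
    rw [norm_sub_rev, hκ]
    exact IsFlow.norm_sub_le hvi hΦi hΦj hΘ hd ht hx
  have hcoup : ∀ t, 0 ≤ t →
      CoupledWithin (κ * dbar * ∫ r in (0 : ℝ)..t, Real.exp (α * (t - r)))
        (densMeasure S.X fun x => ρi x t) (densMeasure S.X fun x => ρj x t) := fun t ht =>
    hρi.coupledWithin hS hρj hΦi hΦj ht (hdist t ht)
  -- a probability density has nonempty domain, so that the bound on the fields is nonnegative
  obtain ⟨x₀, hx₀⟩ : S.X.Nonempty := by
    by_contra hne
    have h1 := hρ₀.2.2.1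
    simp [not_nonempty_iff_eq_empty.1 hne] at h1
  have hκd : 0 ≤ κ * dbar :=
    mul_nonneg (hκ ▸ Real.sqrt_nonneg _) ((norm_nonneg _).trans (hd x₀ hx₀ 0 le_rfl))
  refine ⟨fun t ht => (hcoup t ht).W2_le, fun T ε hT hid => ?_, fun hα => ?_⟩
  · obtain ⟨hε, hid⟩ := hid
    rw [W2dens, hρi.densMeasure_pfDensity hS hΦi hT, hρj.densMeasure_pfDensity hS hΦj hT] at hid
    rcases ENNReal.ofReal_le_ofReal_iff'.1 (hid.trans (hcoup T hT).W2_le) with h | h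
    · exact h
    · exact absurd h hε.not_ge
  · have hcoup' : ∀ t, 0 ≤ t → CoupledWithin (κ * dbar / |α|)
        (densMeasure S.X fun x => ρi x t) (densMeasure S.X fun x => ρj x t) := fun t ht =>
      (hcoup t ht).mono <| by
        rw [div_eq_mul_one_div]
        exact mul_le_mul_of_nonneg_left (integral_exp_mul_sub_le hα) hκd
    refine ⟨?_, fun μ ν hμ hν hμw hνw => ?_⟩
    · exact limsup_le_of_le (by isBoundedDefault)
        ((eventually_ge_atTop 0).mono fun t ht => (hcoup' t ht).W2_le)
    · exact (coupledWithin_of_convergesWeakly hμw hνw hcoup').W2_le
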